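/- Let $\Omega\subset\mathbb{R}^3$ be a bounded simply connected Lipschitz polyhedron with connected boundary $\Gamma$, let $\mathcal T_h$ be a (finite, conforming) partition of $\Omega$ into tetrahedra, let $\mathcal F_h$ be the set of its faces, and let $k\ge 1$. Write $\boldsymbol n$ for the outward unit normal of a tetrahedron $T$ on its faces and $h_F$ for the diameter of the smallest circle containing the face $F$. Put $(\cdot,\cdot)_{\mathcal T_h}=\sum_T\int_T$ and $\langle\cdot,\cdot\rangle_{\partial\mathcal T_h}=\sum_T\int_{\partial T}$, and understand $\nabla\times$, $\nabla\cdot$ elementwise. $\mathcal P_j(\mathcal T_h)$ and $\mathcal P_j(\mathcal F_h)$ denote the functions which on each tetrahedron, respectively on each face, are polynomials of degree at most $j$. *Data.* Let $\boldsymbol f\in[L^2(\Omega)]^3$, $g\in L^2(\Omega)$, and let $\boldsymbol g_1,\boldsymbol g_2\in[L^2(\Gamma)]^3$ be tangential fields. For a boundary face $F$ and an edge $E$ of $F$, with $\boldsymbol n_{FE}$ the unit normal of $E$ in the plane of $F$ pointing out of $F$, the edge moments of $\boldsymbol g_1$ are understood as limits of averages over strips, $$\langle\!\langle \boldsymbol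 g_1\cdot\boldsymbol n_{FE},w\rangle\!\rangle_E:=\lim_{t\to0^+}\frac1t\int_{\{x\in F:\ \mathrm{dist}(x,\operatorname{aff}E)<t\}}(\boldsymbol g_1\cdot\boldsymbol n_{FE})\,w\,dS ,$$ and it is assumed that they exist for all such $F$, $E$ and all polynomials $w$ of degree at most $k$. *Projections.* On each boundary face $F$, $\boldsymbol\Pi^{\Gamma,\mathrm{div}}_{h,k}\boldsymbol g_1$ is the tangential field in $[\mathcal P_k(F)]^3$ with $\langle\!\langle \boldsymbol\Pi^{\Gamma,\mathrm{div}}_{h,k}\boldsymbol g_1\cdot\boldsymbol n_{FE},w\rangle\!\rangle_E=\langle\!\langle \boldsymbol g_1\cdot\boldsymbol n_{FE},w\rangle\!\rangle_E$ for all edges $E$ of $F$ and $w\in\mathcal P_k(E)$ and, if $k\ge2$, $\int_F\boldsymbol\Pi^{\Gamma,\mathrm{div}}_{h,k}\boldsymbol g_1\cdot(\boldsymbol n\times\boldsymbol w)=\int_F\boldsymbol g_1\cdot(\boldsymbol n\times\boldsymbol w)$ for all $\boldsymbol w\in[\mathcal P_{k-2}(F)]^3\oplus\widetilde{\mathcal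 P}_{k-2}(F)\,\boldsymbol x$, where $\widetilde{\mathcal P}_{j}$ stands for homogeneous polynomials of degree $j$. $\boldsymbol\Pi^{\partial}_{k-1}\boldsymbol g_2$ is the facewise $L^2$-projection onto polynomials of degree at most $k-1$. *Spaces.* Let $\boldsymbol R_h=[\mathcal P_{k-1}(\mathcal T_h)]^3$, $\boldsymbol U_h=[\mathcal P_k(\mathcal T_h)]^3$, $P_h=\mathcal P_k(\mathcal T_h)$, $\widehat P_h^0=\{\widehat q\in\mathcal P_k(\mathcal F_h):\widehat q|_\Gamma=0\}$, $$\widehat{\boldsymbol U}_h^{\boldsymbol g_1}=\{\widehat{\boldsymbol v}\in[\mathcal P_k(\mathcal F_h)]^3:\ \widehat{\boldsymbol v}\cdot\boldsymbol n=0,\ \boldsymbol n\times\widehat{\boldsymbol v}|_\Gamma=\boldsymbol\Pi^{\Gamma,\mathrm{div}}_{h,k}\boldsymbol g_1\},$$ $$\widehat{\boldsymbol C}_h^{\boldsymbol g_2}=\{\widehat{\boldsymbol v}\in[\mathcal P_{k-1}(\mathcal F_h)]^3:\ \widehat{\boldsymbol v}\cdot\boldsymbol n=0,\ \boldsymbol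 n\times\widehat{\boldsymbol v}|_\Gamma=\boldsymbol\Pi^{\partial}_{k-1}\boldsymbol g_2\},$$ $\boldsymbol\Sigma_h^{\boldsymbol g}=\boldsymbol R_h\times\boldsymbol U_h\times\widehat{\boldsymbol U}_h^{\boldsymbol g_1}\times\widehat{\boldsymbol C}_h^{\boldsymbol g_2}\times P_h\times\widehat P_h^0$, and let $\boldsymbol\Sigma_h^{\boldsymbol 0}$ be the same space with $\boldsymbol g_1,\boldsymbol g_2$ replaced by $\boldsymbol 0$. *Scheme.* For $\boldsymbol\sigma=(\boldsymbol r,\boldsymbol u,\widehat{\boldsymbol u},\widehat{\boldsymbol c},p,\widehat p)$ and $\boldsymbol\tau=(\boldsymbol s,\boldsymbol v,\widehat{\boldsymbol v},\widehat{\boldsymbol d},q,\widehat q)$ let $$B_h(\boldsymbol\sigma,\boldsymbol\tau)=(\boldsymbol r,\boldsymbol s)_{\mathcal T_h}+b_h(\boldsymbol u,\widehat{\boldsymbol u},\widehat{\boldsymbol c};\boldsymbol s)+b_h(\boldsymbol v,\widehat{\boldsymbol v},\widehat{\boldsymbol d};\boldsymbol r)+c_h(p,\widehat p;\boldsymbol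 v)-s_h^u+c_h(q,\widehat q;\boldsymbol u)+s_h^p,$$ where $$b_h(\boldsymbol u,\widehat{\boldsymbol u},\widehat{\boldsymbol c};\boldsymbol s)=-(\boldsymbol u,\nabla\times\nabla\times\boldsymbol s)_{\mathcal T_h}-\langle\boldsymbol n\times\widehat{\boldsymbol u},\nabla\times\boldsymbol s\rangle_{\partial\mathcal T_h}-\langle\boldsymbol n\times\widehat{\boldsymbol c},\boldsymbol s\rangle_{\partial\mathcal T_h},$$ $$c_h(q,\widehat q;\boldsymbol u)=(\nabla\cdot\boldsymbol u,q)_{\mathcal T_h}-\langle\boldsymbol n\cdot\boldsymbol u,\widehat q\rangle_{\partial\mathcal T_h},\qquad s_h^p=\langle h_F^{-1}(p-\widehat p),q-\widehat q\rangle_{\partial\mathcal T_h},$$ $$s_h^u=\langle h_F^{-3}\boldsymbol n\times(\boldsymbol u-\widehat{\boldsymbol u}),\boldsymbol n\times(\boldsymbol v-\widehat{\boldsymbol v})\rangle_{\partial\mathcal T_h}+\langle h_F^{-1}\boldsymbol n\times(\nabla\times\boldsymbol u-\widehat{\boldsymbol c}),\boldsymbol n\times(\nabla\times\boldsymbol v-\widehat{\boldsymbol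 d})\rangle_{\partial\mathcal T_h},$$ and let $F_h(\boldsymbol\tau)=-(\boldsymbol f,\boldsymbol v)+(g,q)$. Then there is exactly one $\boldsymbol\sigma_h\in\boldsymbol\Sigma_h^{\boldsymbol g}$ such that $$B_h(\boldsymbol\sigma_h,\boldsymbol\tau_h)=F_h(\boldsymbol\tau_h)\qquad\text{for all }\boldsymbol\tau_h\in\boldsymbol\Sigma_h^{\boldsymbol 0}.$$ -/

import Mathlib

open MeasureTheory Filter Topology

noncomputable section

/-- Euclidean three-space. -/
abbrev E3 : Type := EuclideanSpace ℝ (Fin 3)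

/-- Values of vector fields; they are only paired through `⬝ᵥ` and the cross product. -/
abbrev Vec : Type := Fin 3 → ℝ

/-- Real polynomials in the three Cartesian coordinates. -/
abbrev Poly3 : Type := MvPolynomial (Fin 3) ℝ

/-! ### Polynomial vector calculus -/

/-- Value of a polynomial at a point. -/
def pval (p : Poly3) (x : E3) : ℝ := MvPolynomial.eval x.ofLp p

/-- Value of a polynomial vector field at a point. -/
def vval (v : Fin 3 → Poly3) (x : E3) : Vec := fun i => pval (v i) x

/-- The curl of a polynomial vector field. -/
def polyCurl (v : Fin 3 → Poly3) : Fin 3 → Poly3 :=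
  ![MvPolynomial.pderiv 1 (v 2) - MvPolynomial.pderiv 2 (v 1),
    MvPolynomial.pderiv 2 (v 0) - MvPolynomial.pderiv 0 (v 2),
    MvPolynomial.pderiv 0 (v 1) - MvPolynomial.pderiv 1 (v 0)]

/-- The divergence of a polynomial vector field. -/
def polyDiv (v : Fin 3 → Poly3) : Poly3 := ∑ i, MvPolynomial.pderiv i (v i)

/-! ### Geometry -/

/-- The closed simplex spanned by a finite set of vertices. -/
def simplexSet (s : Finset E3) : Set E3 := convexHull ℝ (s : Set E3)

/-- Surface (area) measure on a triangle with vertex set `F`. -/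
def faceMeasure (F : Finset E3) : Measure E3 := (μHE[2] : Measure E3).restrict (simplexSet F)

/-- Arc length measure on a segment with vertex set `e`. -/
def edgeMeasure (e : Finset E3) : Measure E3 := (μHE[1] : Measure E3).restrict (simplexSet e)

/-- The unit normal of the facet `G` of the simplex `S`, within the affine span of `S`,
pointing out of `S`. The vector from the centroid of `S` to the centroid of `G` is a positive
multiple of the vector from the vertex opposite to `G` to the centroid of `G`; its component
orthogonal to `G` is normalised. Used for a face of a tetrahedron and for an edge of a triangle. -/
def outwardNormal (S G : Finset E3) : Vec :=
  let d : E3 := (vectorSpan ℝ (G : Set E3))ᗮ.starProjection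
    (G.centroid ℝ id - S.centroid ℝ id)
  (‖d‖⁻¹ • d).ofLp

/-- The vector `a` is tangential to the simplex `F`. -/
def IsTangential (F : Finset E3) (a : Vec) : Prop :=
  WithLp.toLp 2 a ∈ vectorSpan ℝ (F : Set E3)

/-- `h_F`: the diameter of the smallest ball (equivalently circle) containing the face `F`. -/
def faceDiam (F : Finset E3) : ℝ :=
  2 * sInf {ρ : ℝ | 0 ≤ ρ ∧ ∃ c : E3, simplexSet F ⊆ Metric.closedBall c ρ}

/-- `Ω` has a Lipschitz boundary: near each boundary point, in suitable Cartesian coordinates,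
`Ω` is the region strictly above the graph of a Lipschitz function. -/
def HasLipschitzBoundary (Ω : Set E3) : Prop :=
  ∀ x ∈ frontier Ω, ∃ (e : E3 ≃ᵃⁱ[ℝ] E3) (φ : ℝ × ℝ → ℝ) (C : NNReal) (U : Set E3),
    LipschitzWith C φ ∧ IsOpen U ∧ x ∈ U ∧
      ∀ y ∈ U, (y ∈ Ω ↔ φ (e y 0, e y 1) < e y 2)

/-- A bounded, simply connected Lipschitz domain with connected boundary. It is a polyhedron
as soon as it carries a `SimplicialMesh`. -/
structure IsAdmissibleDomain (Ω : Set E3) : Prop where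
  isOpen : IsOpen Ω
  bounded : Bornology.IsBounded Ω
  simplyConnected : IsSimplyConnected Ω
  connectedBoundary : IsConnected (frontier Ω)
  lipschitz : HasLipschitzBoundary Ω

/-- A (conforming, finite) partition of `Ω` into tetrahedra: a finite simplicial complex with
underlying set `closure Ω`, all of whose simplices are faces of its tetrahedra. -/
structure SimplicialMesh (Ω : Set E3) where
  complex : Geometry.SimplicialComplex ℝ E3
  finite : complex.faces.Finite
  pure : ∀ s ∈ complex.faces, ∃ T ∈ complex.faces, s ⊆ T ∧ T.card = 4
  covers : complex.space = closure Ω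

namespace SimplicialMesh

variable {Ω : Set E3} (M : SimplicialMesh Ω)

/-- The tetrahedra `T` of the mesh, given by their vertices. -/
def cells : Finset (Finset E3) := M.finite.toFinset.filter (fun s => s.card = 4)

/-- The (triangular) faces `F` of the mesh, given by their vertices. -/
def faces : Finset (Finset E3) := M.finite.toFinset.filter (fun s => s.card = 3)

/-- `F` is a boundary face: it lies on `Γ = ∂Ω`. -/
def IsBoundaryFace (F : M.faces) : Prop := simplexSet F.1 ⊆ frontier Ω

open scoped Classical in
/-- `∑_T ∫_{∂T} φ`, where `φ T F` is the integrand on the face `F` of `T`. -/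
def boundarySum (φ : M.cells → M.faces → E3 → ℝ) : ℝ :=
  ∑ T : M.cells, ∑ F : M.faces with F.1 ⊆ T.1, ∫ x, φ T F x ∂(faceMeasure F.1)

/-- `∑_T ∫_T φ`, where `φ T` is the integrand on `T`. -/
def cellSum (φ : M.cells → E3 → ℝ) : ℝ :=
  ∑ T : M.cells, ∫ x in simplexSet T.1, φ T x

end SimplicialMesh

/-! ### Projections of the boundary data -/

/-- `P_j(F)`: polynomials of degree at most `j` on the face `F`, as functions on `F` extended
by zero to the whole space. -/
def facePoly (j : ℕ) (F : Finset E3) : Set (E3 → ℝ) :=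
  {q | ∃ p : Poly3, p.totalDegree ≤ j ∧ q = (simplexSet F).indicator (pval p)}

/-- The tangential fields in `[P_j(F)]³`. -/
def tangentialFacePoly (j : ℕ) (F : Finset E3) : Set (E3 → Vec) :=
  {v | (∀ i, (fun x => v x i) ∈ facePoly j F) ∧ ∀ x ∈ simplexSet F, IsTangential F (v x)}

/-- `π` is the `L²(F)`-projection of the vector field `g` onto `[P_j(F)]³` (for `π ∈ [P_j(F)]³`). -/
def IsL2FaceProjection (j : ℕ) (F : Finset E3) (g π : E3 → Vec) : Prop :=
  ∀ w : Fin 3 → Poly3, (∀ i, (w i).totalDegree ≤ j) →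
    ∫ x, π x ⬝ᵥ vval w x ∂(faceMeasure F) = ∫ x, g x ⬝ᵥ vval w x ∂(faceMeasure F)

/-- The moment `∫_e (g · n_{Fe}) w ds` of the normal trace of the field `g` (on the triangle `F`)
on the edge `e` of `F` exists and equals `m`. The trace is taken as the limit, as `t → 0+`, of
averages over the strips in `F` of width `t` along `e`. -/
def HasEdgeMoment (F e : Finset E3) (g : E3 → Vec) (w : Poly3) (m : ℝ) : Prop :=
  Tendsto
    (fun t : ℝ => t⁻¹ *
      ∫ x in {x : E3 | Metric.infDist x (affineSpan ℝ (e : Set E3) : Set E3) < t},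
        (g x ⬝ᵥ outwardNormal F e) * pval w x ∂(faceMeasure F))
    (𝓝[>] 0) (𝓝 m)

/-- `π` is the `H(div)`-projection of degree `k` of the tangential field `g` on the face `F` with
unit normal `n` (for `π` a tangential field in `[P_k(F)]³`): the moments of the normal components
on the edges of `F` against `P_k` agree, and, if `k ≥ 2`, the moments on `F` against `n × w` agree
for all `w ∈ D_{k-1}(F) = [P_{k-2}(F)]³ ⊕ P̃_{k-2}(F) x`. -/
def IsDivFaceProjection (k : ℕ) (F : Finset E3) (n : Vec) (g π : E3 → Vec) : Prop :=
  (∀ e : Finset E3, e ⊆ F → e.card = 2 → ∀ w : Poly3, w.totalDegree ≤ k →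
    HasEdgeMoment F e g w
      (∫ x, (π x ⬝ᵥ outwardNormal F e) * pval w x ∂(edgeMeasure e))) ∧
  (2 ≤ k → ∀ (a : Fin 3 → Poly3) (b : Poly3),
    (∀ i, (a i).totalDegree ≤ k - 2) → b.IsHomogeneous (k - 2) →
    ∫ x, π x ⬝ᵥ crossProduct n (vval a x + pval b x • x.ofLp) ∂(faceMeasure F) =
      ∫ x, g x ⬝ᵥ crossProduct n (vval a x + pval b x • x.ofLp) ∂(faceMeasure F))

namespace SimplicialMesh

variable {Ω : Set E3} (M : SimplicialMesh Ω)

/-- `g` is a tangential field on `Γ` of class `L²(Γ)`. -/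
def IsTangentialL2 (g : E3 → Vec) : Prop :=
  ∀ F : M.faces, M.IsBoundaryFace F →
    MemLp g 2 (faceMeasure F.1) ∧ ∀ᵐ x ∂(faceMeasure F.1), IsTangential F.1 (g x)

/-- The edge moments entering the `H(div)`-projection of degree `k` of `g` on `Γ` exist, i.e.
`g` is in the domain of that projection. -/
def HasBoundaryEdgeMoments (k : ℕ) (g : E3 → Vec) : Prop :=
  ∀ F : M.faces, M.IsBoundaryFace F → ∀ e : Finset E3, e ⊆ F.1 → e.card = 2 →
    ∀ w : Poly3, w.totalDegree ≤ k → ∃ m : ℝ, HasEdgeMoment F.1 e g w m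

end SimplicialMesh

/-! ### The discrete spaces and the scheme -/

/-- A tuple `(r, u, û, ĉ, p, p̂)` of piecewise polynomials on the tetrahedra and of functions on
the faces of the mesh (extended by zero outside the face). -/
@[ext]
structure HDGTuple {Ω : Set E3} (M : SimplicialMesh Ω) where
  r : M.cells → Fin 3 → Poly3
  u : M.cells → Fin 3 → Poly3
  uHat : M.faces → E3 → Vec
  cHat : M.faces → E3 → Vec
  p : M.cells → Poly3
  pHat : M.faces → E3 → ℝ

namespace SimplicialMesh

variable {Ω : Set E3} (M : SimplicialMesh Ω)

/-- The space `Σ_h^g = R_h × U_h × Û_h^{g₁} × Ĉ_h^{g₂} × P_h × P̂_h^0` with polynomial degree `k`;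
`Σ_h^0` is obtained for `g₁ = g₂ = 0`. -/
structure MemSigma (k : ℕ) (g₁ g₂ : E3 → Vec) (σ : HDGTuple M) : Prop where
  r_mem : ∀ T i, (σ.r T i).totalDegree ≤ k - 1
  u_mem : ∀ T i, (σ.u T i).totalDegree ≤ k
  uHat_mem : ∀ F : M.faces, σ.uHat F ∈ tangentialFacePoly k F.1
  uHat_boundary : ∀ (T : M.cells) (F : M.faces), F.1 ⊆ T.1 → M.IsBoundaryFace F →
    IsDivFaceProjection k F.1 (outwardNormal T.1 F.1) g₁
      (fun x => crossProduct (outwardNormal T.1 F.1) (σ.uHat F x))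
  cHat_mem : ∀ F : M.faces, σ.cHat F ∈ tangentialFacePoly (k - 1) F.1
  cHat_boundary : ∀ (T : M.cells) (F : M.faces), F.1 ⊆ T.1 → M.IsBoundaryFace F →
    IsL2FaceProjection (k - 1) F.1 g₂
      (fun x => crossProduct (outwardNormal T.1 F.1) (σ.cHat F x))
  p_mem : ∀ T, (σ.p T).totalDegree ≤ k
  pHat_mem : ∀ F : M.faces, σ.pHat F ∈ facePoly k F.1
  pHat_boundary : ∀ F : M.faces, M.IsBoundaryFace F → σ.pHat F = 0

/-- `a_h(r, s)`. -/
def aForm (r s : M.cells → Fin 3 → Poly3) : ℝ :=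
  M.cellSum fun T x => vval (r T) x ⬝ᵥ vval (s T) x

/-- `b_h(u, û, ĉ; s)`. -/
def bForm (u : M.cells → Fin 3 → Poly3) (uHat cHat : M.faces → E3 → Vec)
    (s : M.cells → Fin 3 → Poly3) : ℝ :=
  - M.cellSum (fun T x => vval (u T) x ⬝ᵥ vval (polyCurl (polyCurl (s T))) x)
  - M.boundarySum (fun T F x =>
      crossProduct (outwardNormal T.1 F.1) (uHat F x) ⬝ᵥ vval (polyCurl (s T)) x)
  - M.boundarySum (fun T F x =>
      crossProduct (outwardNormal T.1 F.1) (cHat F x) ⬝ᵥ vval (s T) x)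

/-- `c_h(q, q̂; u)`. -/
def cForm (q : M.cells → Poly3) (qHat : M.faces → E3 → ℝ) (u : M.cells → Fin 3 → Poly3) : ℝ :=
  M.cellSum (fun T x => pval (polyDiv (u T)) x * pval (q T) x)
  - M.boundarySum (fun T F x => (outwardNormal T.1 F.1 ⬝ᵥ vval (u T) x) * qHat F x)

/-- The stabilisation `s_h^u(u, û, ĉ; v, v̂, d̂)`. -/
def suForm (u : M.cells → Fin 3 → Poly3) (uHat cHat : M.faces → E3 → Vec)
    (v : M.cells → Fin 3 → Poly3) (vHat dHat : M.faces → E3 → Vec) : ℝ :=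
  M.boundarySum (fun T F x => (faceDiam F.1 ^ 3)⁻¹ *
    (crossProduct (outwardNormal T.1 F.1) (vval (u T) x - uHat F x) ⬝ᵥ
      crossProduct (outwardNormal T.1 F.1) (vval (v T) x - vHat F x)))
  + M.boundarySum (fun T F x => (faceDiam F.1)⁻¹ *
    (crossProduct (outwardNormal T.1 F.1) (vval (polyCurl (u T)) x - cHat F x) ⬝ᵥ
      crossProduct (outwardNormal T.1 F.1) (vval (polyCurl (v T)) x - dHat F x)))

/-- The stabilisation `s_h^p(p, p̂; q, q̂)`. -/
def spForm (p : M.cells → Poly3) (pHat : M.faces → E3 → ℝ)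
    (q : M.cells → Poly3) (qHat : M.faces → E3 → ℝ) : ℝ :=
  M.boundarySum (fun T F x => (faceDiam F.1)⁻¹ *
    ((pval (p T) x - pHat F x) * (pval (q T) x - qHat F x)))

/-- The bilinear form `B_h(σ, τ)`. -/
def BForm (σ τ : HDGTuple M) : ℝ :=
  M.aForm σ.r τ.r + M.bForm σ.u σ.uHat σ.cHat τ.r
  + M.bForm τ.u τ.uHat τ.cHat σ.r + M.cForm σ.p σ.pHat τ.u
  - M.suForm σ.u σ.uHat σ.cHat τ.u τ.uHat τ.cHat
  + M.cForm τ.p τ.pHat σ.u + M.spForm σ.p σ.pHat τ.p τ.pHat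

/-- The right-hand side `F_h(τ) = -(f, v) + (g, q)`; integrals over `Ω` are split over the
tetrahedra. -/
def FForm (f : E3 → Vec) (g : E3 → ℝ) (τ : HDGTuple M) : ℝ :=
  - (∑ T : M.cells, ∫ x in Ω ∩ simplexSet T.1, f x ⬝ᵥ vval (τ.u T) x)
  + (∑ T : M.cells, ∫ x in Ω ∩ simplexSet T.1, g x * pval (τ.p T) x)

end SimplicialMesh

end

/-! The problem is linear and finite-dimensional with a symmetric form, so unique solvability
reduces to two facts: the homogeneous problem has only the zero solution, and some discrete tuple
satisfies the boundary conditions. `exists_representer` then supplies the solution.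

Homogeneous problem. Testing with (r, -u, -û, -ĉ, p, p̂) cancels the b- and c-terms and leaves (r,
r) + s^u + s^p = 0 (`energy`). Hence r = 0, and the hat variables are the tangential traces of u and
curl u and the trace of p. Integrating b_h by parts twice with s = curl curl u gives curl curl u =
0; a further integration by parts gives curl u = 0, because û and ĉ are single-valued and vanish on
Γ (`polyCurl_eq_zero`). The choice v = ∇p makes p piecewise constant, and the divergence theorem for
p² x gives p = 0 (`p_eq_zero`). Taking for q the divergence of u and for q̂ a normal jump shows that
u is elementwise divergence-free and continuous across interior faces. A curl-free and
divergence-free polynomial field that vanishes on a triangle is zero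
(`FaceFrame.eq_zero_of_curl_div`), so all cells carry the same polynomial field u = ∇φ. Since û = 0
on Γ, φ is constant on every boundary face, hence equal to a constant c on the connected Γ, and ∫
|∇φ|² reduces to the boundary term with φ - c, which is zero (`u_eq_zero`).

Boundary data. On a triangle the divergence projection is the Brezzi-Douglas-Marini interpolant.
`bdm_unisolvent` gives its uniqueness, `bdm_dual_unisolvent` its existence. For existence the edge
moments of g₁, which are limits of strip averages, must depend only on the values of the test
polynomial on the edge (`hasEdgeMoment_zero_of_vanish`).

Geometry. The cancellations need that an interior face lies in exactly two cells with opposite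
normals, that a boundary face lies in one cell, that Γ is covered by boundary faces, and that cells
are linked through interior faces. These follow from conformity, from the Lipschitz property and
from segments chosen to avoid all edges. -/

noncomputable section

/-! ### Polynomial algebra: degrees, divisibility, the Euler operator and potentials. -/

section Polynomial

open MvPolynomial

variable {σ τ : Type*}

lemma totalDegree_pderiv_le (i : σ) (p : MvPolynomial σ ℝ) :
    (pderiv i p).totalDegree ≤ p.totalDegree - 1 := by
  classical
  refine Finset.sup_le fun s hs => ?_
  rw [mem_support_iff, coeff_pderiv] at hs
  have h : s + Finsupp.single i 1 ∈ p.support := by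
    rw [mem_support_iff]
    exact fun h0 => hs (by rw [h0]; simp)
  have h2 := le_totalDegree h
  rw [Finsupp.sum_add_index' (by simp) (by simp)] at h2
  simp only [Finsupp.sum_single_index] at h2
  omega

lemma totalDegree_aeval_le {f : σ → MvPolynomial τ ℝ} (hf : ∀ i, (f i).totalDegree ≤ 1)
    (p : MvPolynomial σ ℝ) : (aeval f p).totalDegree ≤ p.totalDegree := by
  rw [aeval_def, eval₂_eq]
  refine totalDegree_finsetSum_le fun s hs => ?_
  refine (totalDegree_mul _ _).trans ?_
  rw [algebraMap_eq, totalDegree_C, zero_add]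
  refine (totalDegree_finsetProd _ _).trans (le_trans ?_ (le_totalDegree hs))
  refine Finset.sum_le_sum fun i _ => (totalDegree_pow _ _).trans ?_
  simpa using Nat.mul_le_mul_left (s i) (hf i)

lemma eval_aeval (f : σ → MvPolynomial τ ℝ) (y : τ → ℝ) (p : MvPolynomial σ ℝ) :
    eval y (aeval f p) = eval (fun i => eval y (f i)) p := by
  induction p using MvPolynomial.induction_on with
  | C a => simp only [aeval_C, algebraMap_eq, eval_C]
  | add p q hp hq => rw [map_add, map_add, map_add, hp, hq]
  | mul_X p i hp => rw [map_mul, map_mul, map_mul, hp, aeval_X, eval_X]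

/-- A polynomial is divisible by `l` if it vanishes after a substitution that is the identity
modulo `l`. -/
lemma dvd_of_aeval_eq_zero {f : σ → MvPolynomial σ ℝ} {l : MvPolynomial σ ℝ}
    (hf : ∀ i, l ∣ X i - f i) {p : MvPolynomial σ ℝ} (hp : aeval f p = 0) : l ∣ p := by
  have h : ∀ q : MvPolynomial σ ℝ, l ∣ q - aeval f q := by
    intro q
    induction q using MvPolynomial.induction_on with
    | C a => simp [algebraMap_eq]
    | add p q hp hq => rw [map_add, add_sub_add_comm]; exact dvd_add hp hq
    | mul_X p i hp =>
      rw [map_mul, aeval_X]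
      have : p * X i - aeval f p * f i = (p - aeval f p) * X i + aeval f p * (X i - f i) := by ring
      rw [this]
      exact dvd_add (hp.mul_right _) ((hf i).mul_left _)
  have h2 := h p
  rwa [hp, sub_zero] at h2

variable [Fintype σ]

/-- The Euler operator `p ↦ ∑ xᵢ ∂ᵢ p`. -/
def eulerOp (p : MvPolynomial σ ℝ) : MvPolynomial σ ℝ := ∑ i, X i * pderiv i p

/-- Monomials are eigenvectors of the Euler operator with their degree as eigenvalue, so adding a
positive multiple of the identity makes it invertible without raising degrees. -/
lemma coeff_eulerOp (s : σ →₀ ℕ) (p : MvPolynomial σ ℝ) :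
    coeff s (eulerOp p) = s.degree * coeff s p := by
  classical
  have h : ∀ m (r : ℝ), eulerOp (monomial m r) = (m.degree : ℕ) • (monomial m r : MvPolynomial σ ℝ) := by
    intro m r
    rw [eulerOp, Finsupp.degree_eq_sum, Finset.sum_smul]
    exact Finset.sum_congr rfl fun i _ => X_mul_pderiv_monomial
  induction p using MvPolynomial.induction_on' with
  | monomial m r =>
    rw [h, coeff_smul, coeff_monomial]
    split_ifs with hm
    · subst hm; simp
    · simp
  | add p q hp hq =>
    have : eulerOp (p + q) = eulerOp p + eulerOp q := by
      simp [eulerOp, mul_add, Finset.sum_add_distrib]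
    rw [this, coeff_add, coeff_add, hp, hq]; ring

/-- Divide the coefficient of each monomial by its degree plus c. The value c = 1 gives the radial
average of the Poincaré lemma; c = 2 solves div (x q) = p in the plane. -/
lemma exists_eulerOp_add_smul {c : ℝ} (hc0 : 0 < c) (p : MvPolynomial σ ℝ) :
    ∃ q : MvPolynomial σ ℝ, q.totalDegree ≤ p.totalDegree ∧ eulerOp q + c • q = p := by
  classical
  have hc : ∀ s, coeff s (∑ m ∈ p.support, monomial m (coeff m p / (m.degree + c)) :
      MvPolynomial σ ℝ) = coeff s p / (s.degree + c) := by
    intro s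
    rw [coeff_sum]
    simp only [coeff_monomial]
    rw [Finset.sum_ite_eq']
    split_ifs with hs
    · rfl
    · rw [notMem_support_iff.1 hs]; simp
  refine ⟨∑ m ∈ p.support, monomial m (coeff m p / (m.degree + c)), ?_, ?_⟩
  · exact totalDegree_finsetSum_le fun m hm => (totalDegree_monomial_le _ _).trans (le_totalDegree hm)
  · ext s
    rw [coeff_add, coeff_eulerOp, coeff_smul, hc]
    have : (s.degree : ℝ) + c ≠ 0 := by positivity
    simp only [smul_eq_mul]
    field_simp

/-- Every coefficient is multiplied by a nonzero number, so no monomial of q is lost. -/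
lemma totalDegree_le_eulerOp_add_smul {c : ℝ} (hc0 : 0 < c) (q : MvPolynomial σ ℝ) :
    q.totalDegree ≤ (eulerOp q + c • q).totalDegree := by
  refine totalDegree_le_of_support_subset fun s hs => ?_
  rw [mem_support_iff] at hs ⊢
  rw [coeff_add, coeff_eulerOp, coeff_smul, smul_eq_mul, ← add_mul]
  exact mul_ne_zero (by positivity) hs

lemma eq_C_of_pderiv_eq_zero {p : MvPolynomial σ ℝ} (h : ∀ i, pderiv i p = 0) :
    p = C (coeff 0 p) := by
  classical
  ext s
  rw [coeff_C]
  split_ifs with hs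
  · rw [hs]
  · obtain ⟨i, hi⟩ : ∃ i, s i ≠ 0 := by
      by_contra! h0
      exact hs (Finsupp.ext fun i => by simp [h0 i])
    have h1 := congrArg (coeff (s - Finsupp.single i 1)) (h i)
    have h2 : s - Finsupp.single i 1 + Finsupp.single i 1 = s :=
      tsub_add_cancel_of_le (Finsupp.single_le_iff.2 (Nat.one_le_iff_ne_zero.2 hi))
    rw [coeff_pderiv, h2, coeff_zero] at h1
    exact (mul_eq_zero.1 h1).resolve_right (by positivity)

/-- The commutator of ∂ᵢ with the Euler operator is ∂ᵢ itself, because ∂ᵢ lowers the degree by one.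
-/
lemma pderiv_eulerOp (i : σ) (p : MvPolynomial σ ℝ) :
    pderiv i (eulerOp p) = pderiv i p + eulerOp (pderiv i p) := by
  classical
  have hcomm : ∀ j, pderiv i (pderiv j p) = pderiv j (pderiv i p) := by
    intro j
    ext s
    simp only [coeff_pderiv]
    rw [add_right_comm]
    by_cases hij : i = j
    · subst hij; ring
    · simp [hij, Ne.symm hij]; ring
  simp only [eulerOp, map_sum, pderiv_mul, Finset.sum_add_distrib, hcomm]
  congr 1
  rw [Finset.sum_eq_single i]
  · simp
  · intro j _ hj; rw [pderiv_X_of_ne hj, zero_mul]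
  · simp

/-- A curl free polynomial vector field is a gradient. -/
lemma exists_potential {d : ℕ} {P : σ → MvPolynomial σ ℝ} (hd : ∀ i, (P i).totalDegree ≤ d)
    (hP : ∀ i j, pderiv i (P j) = pderiv j (P i)) :
    ∃ φ : MvPolynomial σ ℝ, φ.totalDegree ≤ d + 1 ∧ ∀ i, pderiv i φ = P i := by
  classical
  -- Q is the algebraic form of ∫₀¹ P(t x) dt, and the potential taken below is Poincaré's x · Q.
  choose Q hQd hQ using fun i => exists_eulerOp_add_smul one_pos (P i)
  -- By the commutator relation, E + 2 maps ∂ᵢQⱼ to ∂ᵢPⱼ. It is injective, so Q inherits the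
  -- symmetry of P.
  have hcl : ∀ i j, pderiv i (Q j) = pderiv j (Q i) := by
    intro i j
    have h : ∀ i j, eulerOp (pderiv i (Q j)) + 2 • pderiv i (Q j) = pderiv i (P j) := by
      intro i j
      rw [← hQ j, map_add, pderiv_eulerOp, one_smul]; ring
    have h2 := (h i j).trans ((hP i j).trans (h j i).symm)
    ext s
    have h3 := congrArg (coeff s) h2
    rw [coeff_add, coeff_add, coeff_eulerOp, coeff_eulerOp, coeff_smul, coeff_smul] at h3
    simp only [nsmul_eq_mul, ← add_mul] at h3
    refine mul_left_cancel₀ ?_ h3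
    positivity
  refine ⟨∑ i, X i * Q i, ?_, fun j => ?_⟩
  · refine totalDegree_finsetSum_le fun i _ => (totalDegree_mul _ _).trans ?_
    have h1 : (X i : MvPolynomial σ ℝ).totalDegree = 1 := totalDegree_X i
    have := hQd i
    have := hd i
    omega
  · rw [← hQ j, eulerOp, map_sum, one_smul]
    simp only [pderiv_mul, Finset.sum_add_distrib, fun i => hcl j i]
    rw [add_comm]
    congr 1
    rw [Finset.sum_eq_single j]
    · simp
    · intro i _ hi; rw [pderiv_X_of_ne hi, zero_mul]
    · simp

end Polynomial

/-! ### Integration over the reference simplex -/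

/-- The reference simplex in `ℝⁿ`. -/
def refSimplex (n : ℕ) : Set (Fin n → ℝ) := {y | (∀ i, 0 ≤ y i) ∧ ∑ i, y i ≤ 1}

lemma isClosed_refSimplex (n : ℕ) : IsClosed (refSimplex n) := by
  have : refSimplex n = (⋂ i, {y | 0 ≤ y i}) ∩ {y | ∑ i, y i ≤ 1} := by
    ext y; simp [refSimplex]
  rw [this]
  refine IsClosed.inter (isClosed_iInter fun i => ?_) ?_
  · exact isClosed_le continuous_const (continuous_apply i)
  · exact isClosed_le (by fun_prop) continuous_const

lemma isCompact_refSimplex (n : ℕ) : IsCompact (refSimplex n) := by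
  refine (isCompact_Icc (a := (0 : Fin n → ℝ)) (b := 1)).of_isClosed_subset
    (isClosed_refSimplex n) fun y hy => ⟨hy.1, fun i => ?_⟩
  exact (Finset.single_le_sum (fun j _ => hy.1 j) (Finset.mem_univ i)).trans hy.2

lemma integrableOn_refSimplex {n : ℕ} (p : MvPolynomial (Fin n) ℝ) :
    IntegrableOn (fun y => MvPolynomial.eval y p) (refSimplex n) :=
  (MvPolynomial.continuous_eval p).continuousOn.integrableOn_compact (isCompact_refSimplex n)

/-- Integration of polynomials over the reference simplex. -/
def simplexInt (n : ℕ) : MvPolynomial (Fin n) ℝ →ₗ[ℝ] ℝ where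
  toFun p := ∫ y in refSimplex n, MvPolynomial.eval y p
  map_add' p q := by
    simp only [map_add]
    exact integral_add (integrableOn_refSimplex p) (integrableOn_refSimplex q)
  map_smul' c p := by
    simp only [MvPolynomial.smul_eval, RingHom.id_apply, smul_eq_mul]
    exact integral_const_mul c _

lemma simplexInt_apply {n : ℕ} (p : MvPolynomial (Fin n) ℝ) :
    simplexInt n p = ∫ y in refSimplex n, MvPolynomial.eval y p := rfl

/-- Polynomials that agree on the reference simplex are equal. -/
lemma eq_zero_of_eval_refSimplex {n : ℕ} {p : MvPolynomial (Fin n) ℝ}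
    (h : ∀ y, (∀ i, 0 < y i) → ∑ i, y i < 1 → MvPolynomial.eval y p = 0) : p = 0 := by
  -- The open cube of side 1/(n + 1) lies inside the simplex, and a polynomial vanishing on a
  -- product of infinite sets is zero.
  have hn : (0 : ℝ) < ((n : ℝ) + 1)⁻¹ := by positivity
  refine MvPolynomial.funext_set (fun _ => Set.Ioo (0 : ℝ) ((n : ℝ) + 1)⁻¹)
    (fun _ => Set.Ioo_infinite hn) fun y hy => ?_
  rw [map_zero]
  have hy' : ∀ i, y i ∈ Set.Ioo (0 : ℝ) ((n : ℝ) + 1)⁻¹ := fun i => hy i trivial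
  refine h y (fun i => (hy' i).1) ?_
  calc ∑ i, y i ≤ ∑ _i : Fin n, ((n : ℝ) + 1)⁻¹ := Finset.sum_le_sum fun i _ => (hy' i).2.le
    _ = n * ((n : ℝ) + 1)⁻¹ := by simp
    _ < 1 := by rw [← div_eq_mul_inv, div_lt_one (by positivity)]; linarith

/-- A nonnegative continuous function with zero integral vanishes on the open simplex, and its
values there determine a polynomial. -/
lemma eq_zero_of_simplexInt_eq_zero {n : ℕ} {p : MvPolynomial (Fin n) ℝ}
    (h0 : ∀ y ∈ refSimplex n, 0 ≤ MvPolynomial.eval y p) (h : simplexInt n p = 0) : p = 0 := by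
  rw [simplexInt_apply, setIntegral_eq_zero_iff_of_nonneg_ae] at h
  · refine eq_zero_of_eval_refSimplex fun y hy hy1 => ?_
    let U : Set (Fin n → ℝ) := (⋂ i, {y | 0 < y i}) ∩ {y | ∑ i, y i < 1}
    have hU : IsOpen U := by
      refine IsOpen.inter (isOpen_iInter_of_finite fun i => ?_) ?_
      · exact isOpen_lt continuous_const (continuous_apply i)
      · exact isOpen_lt (by fun_prop) continuous_const
    have hUs : U ⊆ refSimplex n := fun y hy =>
      ⟨fun i => le_of_lt (Set.mem_iInter.1 hy.1 i), le_of_lt hy.2⟩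
    have h1 : (fun y => MvPolynomial.eval y p) =ᵐ[volume.restrict U] fun _ => (0 : ℝ) :=
      ae_restrict_of_ae_restrict_of_subset hUs h
    exact Measure.eqOn_open_of_ae_eq h1 hU (MvPolynomial.continuous_eval p).continuousOn continuousOn_const
      (x := y) ⟨Set.mem_iInter.2 hy, hy1⟩
  · exact (ae_restrict_iff' (isClosed_refSimplex n).measurableSet).2 (ae_of_all _ h0)
  · exact integrableOn_refSimplex p

lemma eq_zero_of_simplexInt_mul_self {n : ℕ} {p : MvPolynomial (Fin n) ℝ}
    (h : simplexInt n (p * p) = 0) : p = 0 :=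
  mul_self_eq_zero.1 <| eq_zero_of_simplexInt_eq_zero
    (fun y _ => by rw [map_mul]; exact mul_self_nonneg _) h

lemma cons_mem_refSimplex {n : ℕ} (t : ℝ) (y : Fin n → ℝ) :
    Fin.cons t y ∈ refSimplex (n + 1) ↔ y ∈ refSimplex n ∧ t ∈ Set.Icc 0 (1 - ∑ i, y i) := by
  simp only [refSimplex, Set.mem_ofPred_eq, Fin.forall_fin_succ, Fin.cons_zero, Fin.cons_succ,
    Fin.sum_univ_succ, Set.mem_Icc]
  constructor
  · rintro ⟨⟨h1, h2⟩, h3⟩; exact ⟨⟨h2, by linarith⟩, h1, by linarith⟩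
  · rintro ⟨⟨h1, h2⟩, h3, h4⟩; exact ⟨⟨h3, h1⟩, by linarith⟩

/-- Fubini in the first coordinate: the fibre over y is an interval, so the divergence theorem
becomes one-dimensional. -/
lemma integral_refSimplex_succ {n : ℕ} (f : (Fin (n + 1) → ℝ) → ℝ) (hf : Continuous f) :
    ∫ y in refSimplex (n + 1), f y =
      ∫ y in refSimplex n, ∫ t in (0 : ℝ)..(1 - ∑ i, y i), f (Fin.cons t y) := by
  have hm := volume_preserving_piFinSuccAbove (fun _ : Fin (n + 1) => ℝ) 0
  have hmS := (isClosed_refSimplex (n + 1)).measurableSet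
  have hi : Integrable ((refSimplex (n + 1)).indicator f) :=
    (integrable_indicator_iff hmS).2
      (hf.continuousOn.integrableOn_compact (isCompact_refSimplex _))
  have hsymm : ∀ z : ℝ × (Fin n → ℝ),
      (MeasurableEquiv.piFinSuccAbove (fun _ : Fin (n + 1) => ℝ) 0).symm z = Fin.cons z.1 z.2 := by
    intro z
    simp [MeasurableEquiv.piFinSuccAbove, Fin.insertNthEquiv]
  rw [← integral_indicator hmS, ← hm.symm.integral_comp', Measure.volume_eq_prod, integral_prod_symm]
  · rw [← integral_indicator (isClosed_refSimplex n).measurableSet]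
    refine integral_congr_ae (ae_of_all _ fun y => ?_)
    simp only [hsymm]
    by_cases hy : y ∈ refSimplex n
    · rw [Set.indicator_of_mem hy, intervalIntegral.integral_of_le (by linarith [hy.2]),
        ← integral_Icc_eq_integral_Ioc, ← integral_indicator measurableSet_Icc]
      refine integral_congr_ae (ae_of_all _ fun t => ?_)
      by_cases ht : t ∈ Set.Icc 0 (1 - ∑ i, y i)
      · simp only [Set.indicator_of_mem ht]
        rw [Set.indicator_of_mem ((cons_mem_refSimplex t y).2 ⟨hy, ht⟩)]
      · simp only [Set.indicator_of_notMem ht]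
        rw [Set.indicator_of_notMem fun h => ht ((cons_mem_refSimplex t y).1 h).2]
    · rw [Set.indicator_of_notMem hy]
      refine integral_eq_zero_of_ae (ae_of_all _ fun t => ?_)
      exact Set.indicator_of_notMem (fun h => hy ((cons_mem_refSimplex t y).1 h).1) _
  · have := (hm.symm.integrable_comp_emb (MeasurableEquiv.measurableEmbedding _)).2 hi
    exact this

lemma hasDerivAt_eval_cons {n : ℕ} (p : MvPolynomial (Fin (n + 1)) ℝ) (y : Fin n → ℝ) (t : ℝ) :
    HasDerivAt (fun t : ℝ => MvPolynomial.eval (Fin.cons t y : Fin (n + 1) → ℝ) p)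
      (MvPolynomial.eval (Fin.cons t y : Fin (n + 1) → ℝ) (MvPolynomial.pderiv 0 p)) t := by
  induction p using MvPolynomial.induction_on with
  | C a => simpa using hasDerivAt_const t a
  | add p q hp hq => simpa only [map_add] using HasDerivAt.fun_add hp hq
  | mul_X p i hp =>
    simp only [map_mul, MvPolynomial.eval_X, MvPolynomial.pderiv_mul, map_add]
    refine Fin.cases ?_ (fun j => ?_) i
    · simpa using HasDerivAt.fun_mul hp (hasDerivAt_id' t)
    · simpa [MvPolynomial.pderiv_X_of_ne (Fin.succ_ne_zero j)] using hp.mul_const (y j)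

/-- Substitution for the face of the reference simplex opposite to the origin. -/
def slantSubst (n : ℕ) : MvPolynomial (Fin (n + 1)) ℝ →ₐ[ℝ] MvPolynomial (Fin n) ℝ :=
  MvPolynomial.aeval (Fin.cons (1 - ∑ i, MvPolynomial.X i) MvPolynomial.X)

/-- Substitution for the face of the reference simplex on which the first coordinate vanishes. -/
def zeroSubst (n : ℕ) : MvPolynomial (Fin (n + 1)) ℝ →ₐ[ℝ] MvPolynomial (Fin n) ℝ :=
  MvPolynomial.aeval (Fin.cons 0 MvPolynomial.X)

lemma eval_slantSubst {n : ℕ} (p : MvPolynomial (Fin (n + 1)) ℝ) (y : Fin n → ℝ) :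
    MvPolynomial.eval y (slantSubst n p) =
      MvPolynomial.eval (Fin.cons (1 - ∑ i, y i) y : Fin (n + 1) → ℝ) p := by
  rw [slantSubst, eval_aeval]
  congr 2
  funext i
  refine Fin.cases ?_ (fun j => ?_) i <;> simp

lemma eval_zeroSubst {n : ℕ} (p : MvPolynomial (Fin (n + 1)) ℝ) (y : Fin n → ℝ) :
    MvPolynomial.eval y (zeroSubst n p) = MvPolynomial.eval (Fin.cons 0 y : Fin (n + 1) → ℝ) p := by
  rw [zeroSubst, eval_aeval]
  congr 2
  funext i
  refine Fin.cases ?_ (fun j => ?_) i <;> simp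

/-- The divergence theorem on the reference simplex. -/
lemma simplexInt_pderiv_zero {n : ℕ} (p : MvPolynomial (Fin (n + 1)) ℝ) :
    simplexInt (n + 1) (MvPolynomial.pderiv 0 p) =
      simplexInt n (slantSubst n p) - simplexInt n (zeroSubst n p) := by
  rw [← map_sub, simplexInt_apply, integral_refSimplex_succ _ (MvPolynomial.continuous_eval _), simplexInt_apply]
  refine integral_congr_ae (ae_of_all _ fun y => ?_)
  simp only [map_sub, eval_slantSubst, eval_zeroSubst]
  -- The fundamental theorem of calculus on each fibre, whose endpoints lie on the slanted face and
  -- on the face where the first coordinate vanishes.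
  refine intervalIntegral.integral_eq_sub_of_hasDerivAt (fun t _ => hasDerivAt_eval_cons p y t) ?_
  refine Continuous.intervalIntegrable ?_ _ _
  exact (MvPolynomial.continuous_eval _).comp (Continuous.finCons continuous_id continuous_const)

/-- The reference simplex is symmetric under permutations of the coordinates; this transports the
divergence theorem from the first coordinate to another one. -/
lemma simplexInt_rename {n : ℕ} (e : Equiv.Perm (Fin n)) (p : MvPolynomial (Fin n) ℝ) :
    simplexInt n (MvPolynomial.rename e p) = simplexInt n p := by
  have hm := volume_measurePreserving_piCongrLeft (fun _ : Fin n => ℝ) e.symm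
  have h := hm.setIntegral_preimage_emb (MeasurableEquiv.measurableEmbedding _)
    (fun y => MvPolynomial.eval y p) (refSimplex n)
  have he : ∀ y : Fin n → ℝ, (MeasurableEquiv.piCongrLeft (fun _ : Fin n => ℝ) e.symm) y = y ∘ e := by
    intro y; funext i
    simp [MeasurableEquiv.coe_piCongrLeft, Equiv.piCongrLeft_apply]
  rw [simplexInt_apply, simplexInt_apply, ← h]
  have hpre : (MeasurableEquiv.piCongrLeft (fun _ : Fin n => ℝ) e.symm) ⁻¹' refSimplex n =
      refSimplex n := by
    ext y
    simp only [Set.mem_preimage, he, refSimplex, Set.mem_ofPred_eq, Function.comp_apply]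
    rw [Equiv.sum_comp e y]
    exact and_congr_left' ⟨fun h i => by simpa using h (e.symm i), fun h i => h _⟩
  rw [hpre]
  simp only [he, MvPolynomial.eval_rename]

/-! ### The Brezzi-Douglas-Marini element on the reference triangle -/

section BDM

open MvPolynomial

/-- Trace on the side of the reference triangle on which the first coordinate vanishes. -/
abbrev traceFst : MvPolynomial (Fin 2) ℝ →ₐ[ℝ] MvPolynomial (Fin 1) ℝ := zeroSubst 1

/-- Trace on the side of the reference triangle on which the second coordinate vanishes. -/
def traceSnd : MvPolynomial (Fin 2) ℝ →ₐ[ℝ] MvPolynomial (Fin 1) ℝ :=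
  (zeroSubst 1).comp (rename (Equiv.swap (0 : Fin 2) 1))

/-- Trace on the slanted side of the reference triangle. -/
abbrev traceSlant : MvPolynomial (Fin 2) ℝ →ₐ[ℝ] MvPolynomial (Fin 1) ℝ := slantSubst 1

@[simp] lemma traceFst_X0 : traceFst (X 0) = 0 := by simp [zeroSubst]
@[simp] lemma traceFst_X1 : traceFst (X 1) = X 0 := by
  simp only [zeroSubst, aeval_X]; exact Fin.cons_succ (α := fun _ => MvPolynomial (Fin 1) ℝ) _ _ 0
@[simp] lemma traceSnd_X0 : traceSnd (X 0) = X 0 := by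
  simp only [traceSnd, AlgHom.comp_apply, rename_X, Equiv.swap_apply_left]; exact traceFst_X1
@[simp] lemma traceSnd_X1 : traceSnd (X 1) = 0 := by
  simp only [traceSnd, AlgHom.comp_apply, rename_X, Equiv.swap_apply_right]; exact traceFst_X0
@[simp] lemma traceSlant_X0 : traceSlant (X 0) = 1 - X 0 := by simp [slantSubst]
@[simp] lemma traceSlant_X1 : traceSlant (X 1) = X 0 := by
  simp only [slantSubst, aeval_X]; exact Fin.cons_succ (α := fun _ => MvPolynomial (Fin 1) ℝ) _ _ 0

/-- The chain rule for an affine substitution. On the sides of the triangle it says that the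
derivative of a trace is the trace of a tangential derivative. -/
lemma pderiv_algHom_of_X {m n : ℕ} (f : MvPolynomial (Fin m) ℝ →ₐ[ℝ] MvPolynomial (Fin n) ℝ)
    (j : Fin n) (c : Fin m → ℝ) (h : ∀ i, pderiv j (f (X i)) = C (c i))
    (p : MvPolynomial (Fin m) ℝ) : pderiv j (f p) = f (∑ i, C (c i) * pderiv i p) := by
  induction p using MvPolynomial.induction_on with
  | C a =>
    rw [← algebraMap_eq, AlgHom.commutes, algebraMap_eq, pderiv_C]
    simp [algebraMap_eq]
  | add p q hp hq => simp only [map_add, mul_add, Finset.sum_add_distrib, hp, hq]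
  | mul_X p i hp =>
    have hC : C (c i) = f (C (c i)) := by
      rw [← algebraMap_eq, ← algebraMap_eq, AlgHom.commutes]
    rw [map_mul, pderiv_mul, hp, h, hC, ← map_mul, ← map_mul, ← map_add]
    congr 1
    simp only [pderiv_mul, mul_add, Finset.sum_add_distrib, Finset.sum_mul]
    congr 1
    · exact Finset.sum_congr rfl fun j _ => by ring
    · rw [Finset.sum_eq_single i]
      · simp; ring
      · intro j _ hj; rw [pderiv_X_of_ne hj.symm]; simp
      · simp

lemma pderiv_traceFst (p : MvPolynomial (Fin 2) ℝ) :
    pderiv 0 (traceFst p) = traceFst (pderiv 1 p) := by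
  rw [pderiv_algHom_of_X _ _ ![0, 1]]
  · simp
  · intro i; fin_cases i <;> simp

lemma pderiv_traceSnd (p : MvPolynomial (Fin 2) ℝ) :
    pderiv 0 (traceSnd p) = traceSnd (pderiv 0 p) := by
  rw [pderiv_algHom_of_X _ _ ![1, 0]]
  · simp
  · intro i; fin_cases i <;> simp

lemma pderiv_traceSlant (p : MvPolynomial (Fin 2) ℝ) :
    pderiv 0 (traceSlant p) = traceSlant (pderiv 1 p - pderiv 0 p) := by
  rw [pderiv_algHom_of_X _ _ ![-1, 1]]
  · simp; ring
  · intro i; fin_cases i <;> simp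

lemma simplexInt_one (p : MvPolynomial (Fin 1) ℝ) :
    simplexInt 1 p = ∫ t in (0 : ℝ)..1, eval (fun _ => t) p := by
  have h0 : refSimplex 0 = Set.univ := by ext; simp [refSimplex]
  have hv : (volume : Measure (Fin 0 → ℝ)) = Measure.dirac 0 := by
    rw [volume_pi, Measure.pi_of_empty]
    exact congrArg _ (Subsingleton.elim _ _)
  rw [simplexInt_apply, integral_refSimplex_succ _ (continuous_eval p), h0, Measure.restrict_univ, hv,
    integral_dirac]
  simp only [Finset.univ_eq_empty, Finset.sum_empty, sub_zero]
  refine intervalIntegral.integral_congr fun t _ => ?_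
  refine congrArg (fun z => eval z p) ?_
  funext i
  rw [Fin.fin_one_eq_zero i, Fin.cons_zero]

lemma simplexInt_one_flip (p : MvPolynomial (Fin 1) ℝ) :
    simplexInt 1 (aeval (fun _ => 1 - X 0) p) = simplexInt 1 p := by
  rw [simplexInt_one, simplexInt_one]
  simp only [eval_aeval]
  have := intervalIntegral.integral_comp_sub_left (a := 0) (b := 1)
    (fun t : ℝ => eval (fun _ : Fin 1 => t) p) 1
  simpa using this

lemma simplexInt_two_pderiv_zero (p : MvPolynomial (Fin 2) ℝ) :
    simplexInt 2 (pderiv 0 p) = simplexInt 1 (traceSlant p) - simplexInt 1 (traceFst p) :=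
  simplexInt_pderiv_zero p

/-- Swapping the coordinates reverses the parametrisation of the slanted side, which is why
invariance under t ↦ 1 - t enters. -/
lemma simplexInt_two_pderiv_one (p : MvPolynomial (Fin 2) ℝ) :
    simplexInt 2 (pderiv 1 p) = simplexInt 1 (traceSlant p) - simplexInt 1 (traceSnd p) := by
  have h := pderiv_rename (Equiv.injective (Equiv.swap (0 : Fin 2) 1)) 1 p (R := ℝ)
  rw [Equiv.swap_apply_right] at h
  rw [← simplexInt_rename (Equiv.swap (0 : Fin 2) 1), ← h, simplexInt_two_pderiv_zero,
    ← simplexInt_one_flip (traceSlant _)]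
  congr 2
  have : ((aeval (fun _ => 1 - X 0)).comp ((traceSlant).comp (rename (Equiv.swap (0 : Fin 2) 1))) :
      MvPolynomial (Fin 2) ℝ →ₐ[ℝ] MvPolynomial (Fin 1) ℝ) = traceSlant := by
    refine algHom_ext fun i => ?_
    fin_cases i
    · simp only [AlgHom.comp_apply, Fin.zero_eta, rename_X, Equiv.swap_apply_left, traceSlant_X1,
        aeval_X, traceSlant_X0]
    · simp only [AlgHom.comp_apply, Fin.mk_one, rename_X, Equiv.swap_apply_right, traceSlant_X0,
        traceSlant_X1, map_sub, map_one, aeval_X]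
      ring
  exact DFunLike.congr_fun this p

/-- Restriction to a side, written as a substitution within the plane, factors through the trace. A
vanishing trace thus meets the hypothesis of `dvd_of_aeval_eq_zero`. -/
lemma aeval_fst_eq (p : MvPolynomial (Fin 2) ℝ) :
    aeval ![0, X 1] p = rename (fun _ => (1 : Fin 2)) (traceFst p) := by
  have : (aeval ![0, X 1] : MvPolynomial (Fin 2) ℝ →ₐ[ℝ] MvPolynomial (Fin 2) ℝ) =
      (rename (fun _ => (1 : Fin 2))).comp traceFst := by
    refine algHom_ext fun i => ?_
    fin_cases i <;> simp
  exact DFunLike.congr_fun this p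

lemma aeval_snd_eq (p : MvPolynomial (Fin 2) ℝ) :
    aeval ![X 0, 0] p = rename (fun _ => (0 : Fin 2)) (traceSnd p) := by
  have : (aeval ![X 0, 0] : MvPolynomial (Fin 2) ℝ →ₐ[ℝ] MvPolynomial (Fin 2) ℝ) =
      (rename (fun _ => (0 : Fin 2))).comp traceSnd := by
    refine algHom_ext fun i => ?_
    fin_cases i <;> simp
  exact DFunLike.congr_fun this p

lemma aeval_slant_eq (p : MvPolynomial (Fin 2) ℝ) :
    aeval ![1 - X 1, X 1] p = rename (fun _ => (1 : Fin 2)) (traceSlant p) := by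
  have : (aeval ![1 - X 1, X 1] : MvPolynomial (Fin 2) ℝ →ₐ[ℝ] MvPolynomial (Fin 2) ℝ) =
      (rename (fun _ => (1 : Fin 2))).comp traceSlant := by
    refine algHom_ext fun i => ?_
    fin_cases i <;> simp
  exact DFunLike.congr_fun this p

lemma X0_dvd_of_traceFst {p : MvPolynomial (Fin 2) ℝ} (h : traceFst p = 0) : X 0 ∣ p := by
  refine dvd_of_aeval_eq_zero (f := ![0, X 1]) (fun i => ?_) (by rw [aeval_fst_eq, h, map_zero])
  fin_cases i <;> simp

lemma X1_dvd_of_traceSnd {p : MvPolynomial (Fin 2) ℝ} (h : traceSnd p = 0) : X 1 ∣ p := by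
  refine dvd_of_aeval_eq_zero (f := ![X 0, 0]) (fun i => ?_) (by rw [aeval_snd_eq, h, map_zero])
  fin_cases i <;> simp

/-- The third barycentric coordinate of the reference triangle. -/
def bary : MvPolynomial (Fin 2) ℝ := 1 - X 0 - X 1

@[simp] lemma traceFst_bary : traceFst bary = 1 - X 0 := by simp [bary]
@[simp] lemma traceSnd_bary : traceSnd bary = 1 - X 0 := by simp [bary]
@[simp] lemma traceSlant_bary : traceSlant bary = 0 := by simp [bary]

lemma bary_dvd_of_traceSlant {p : MvPolynomial (Fin 2) ℝ} (h : traceSlant p = 0) : bary ∣ p := by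
  refine dvd_of_aeval_eq_zero (f := ![1 - X 1, X 1]) (fun i => ?_)
    (by rw [aeval_slant_eq, h, map_zero])
  fin_cases i
  · exact ⟨-1, by simp [bary]; ring⟩
  · simp

lemma one_sub_X_ne_zero : (1 - X 0 : MvPolynomial (Fin 1) ℝ) ≠ 0 := fun h => by
  have := congrArg (eval (fun _ => (0 : ℝ))) h
  simp at this

lemma totalDegree_bary : bary.totalDegree = 1 := by
  refine le_antisymm ?_ ?_
  · refine (totalDegree_sub _ _).trans (max_le ((totalDegree_sub _ _).trans ?_) (totalDegree_X _).le)
    exact max_le (by simp) (totalDegree_X _).le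
  · by_contra! h
    have h0 := totalDegree_eq_zero_iff_eq_C.1 (Nat.lt_one_iff.1 h)
    have h1 := congrArg (pderiv 0) h0
    simp [bary] at h1

/-- A polynomial vanishing on the boundary of the triangle is divisible by the cubic bubble. -/
lemma exists_bubble_factor {p : MvPolynomial (Fin 2) ℝ} (h0 : traceFst p = 0)
    (h1 : traceSnd p = 0) (h2 : traceSlant p = 0) :
    ∃ q, p = X 0 * X 1 * bary * q ∧ (q ≠ 0 → q.totalDegree + 3 = p.totalDegree) := by
  -- The sides are treated in turn: a factor already split off has nonzero trace on the remaining
  -- sides, so the vanishing trace passes to the quotient.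
  obtain ⟨p1, rfl⟩ := X0_dvd_of_traceFst h0
  have h3 : traceSnd p1 = 0 := by
    rw [map_mul, traceSnd_X0] at h1
    exact (mul_eq_zero.1 h1).resolve_left (X_ne_zero _)
  have h4 : traceSlant p1 = 0 := by
    rw [map_mul, traceSlant_X0] at h2
    exact (mul_eq_zero.1 h2).resolve_left one_sub_X_ne_zero
  obtain ⟨p2, rfl⟩ := X1_dvd_of_traceSnd h3
  have h5 : traceSlant p2 = 0 := by
    rw [map_mul, traceSlant_X1] at h4
    exact (mul_eq_zero.1 h4).resolve_left (X_ne_zero _)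
  obtain ⟨q, rfl⟩ := bary_dvd_of_traceSlant h5
  have hb : bary ≠ 0 := fun h => by simpa [h] using totalDegree_bary
  refine ⟨q, by ring, fun hq => ?_⟩
  rw [totalDegree_mul_of_isDomain (X_ne_zero _) (mul_ne_zero (X_ne_zero _) (mul_ne_zero hb hq)),
    totalDegree_mul_of_isDomain (X_ne_zero _) (mul_ne_zero hb hq),
    totalDegree_mul_of_isDomain hb hq, totalDegree_X, totalDegree_X, totalDegree_bary]
  ring

lemma coord_nonneg_of_mem_refSimplex {y : Fin 2 → ℝ} (hy : y ∈ refSimplex 2) :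
    0 ≤ eval y (X 0) ∧ 0 ≤ eval y (X 1) ∧ 0 ≤ eval y bary := by
  have := hy.2
  rw [Fin.sum_univ_two] at this
  refine ⟨by simpa using hy.1 0, by simpa using hy.1 1, ?_⟩
  simp only [bary, map_sub, map_one, eval_X]
  linarith

/-- The two-dimensional Green formula for the rotated gradient of a function vanishing on the
boundary. -/
lemma simplexInt_rot {φ c d : MvPolynomial (Fin 2) ℝ} (h0 : traceFst φ = 0)
    (h1 : traceSnd φ = 0) (h2 : traceSlant φ = 0) :
    simplexInt 2 (pderiv 1 φ * c + -pderiv 0 φ * d) =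
      simplexInt 2 (φ * (pderiv 0 d - pderiv 1 c)) := by
  have h : pderiv 1 φ * c + -pderiv 0 φ * d =
      pderiv 1 (φ * c) - pderiv 0 (φ * d) + φ * (pderiv 0 d - pderiv 1 c) := by
    simp only [pderiv_mul]; ring
  rw [h, map_add, map_sub, simplexInt_two_pderiv_zero, simplexInt_two_pderiv_one]
  simp only [map_mul, h0, h1, h2, zero_mul, map_zero, sub_zero, zero_add]

/-- A field of degree at most `k` without normal traces and orthogonal to the interior test fields
vanishes. -/
theorem bdm_unisolvent {k : ℕ} (hk : 1 ≤ k) {α β : MvPolynomial (Fin 2) ℝ}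
    (hα : α.totalDegree ≤ k) (hβ : β.totalDegree ≤ k)
    (h0 : traceFst α = 0) (h1 : traceSnd β = 0) (h2 : traceSlant (α + β) = 0)
    (hc : 2 ≤ k → ∀ c d : MvPolynomial (Fin 2) ℝ, c.totalDegree ≤ k - 2 → d.totalDegree ≤ k - 2 →
      simplexInt 2 (α * c + β * d) = 0)
    (hq : 2 ≤ k → ∀ q : MvPolynomial (Fin 2) ℝ, q.totalDegree ≤ k - 2 →
      simplexInt 2 (α * -(X 1 * q) + β * (X 0 * q)) = 0) : α = 0 ∧ β = 0 := by
  set D := pderiv 0 α + pderiv 1 β with hD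
  have hDd : D.totalDegree ≤ k - 1 := by
    refine (totalDegree_add _ _).trans (max_le ?_ ?_)
    · exact (totalDegree_pderiv_le _ _).trans (by omega)
    · exact (totalDegree_pderiv_le _ _).trans (by omega)
  -- Integrating D² by parts leaves the normal traces, which vanish, and the pairing with ∇D, a test
  -- field of degree at most k - 2. For k = 1 the divergence D is constant and ∇D = 0.
  have hD0 : D = 0 := by
    refine eq_zero_of_simplexInt_mul_self ?_
    have hs : D * D = pderiv 0 (α * D) + pderiv 1 (β * D) -
        (α * pderiv 0 D + β * pderiv 1 D) := by
      simp only [pderiv_mul]; rw [hD]; ring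
    have hlast : simplexInt 2 (α * pderiv 0 D + β * pderiv 1 D) = 0 := by
      rcases Nat.lt_or_ge k 2 with h | h
      · have : D.totalDegree = 0 := by omega
        rw [totalDegree_eq_zero_iff_eq_C.1 this]
        simp
      · refine hc h _ _ ?_ ?_
        · exact (totalDegree_pderiv_le _ _).trans (by omega)
        · exact (totalDegree_pderiv_le _ _).trans (by omega)
    rw [hs, map_sub, map_add, hlast, simplexInt_two_pderiv_zero, simplexInt_two_pderiv_one]
    have hb : traceSlant (α * D) + traceSlant (β * D) = 0 := by
      rw [← map_add, ← add_mul, map_mul, h2, zero_mul]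
    have hb' := congrArg (simplexInt 1) hb
    rw [map_add, map_zero] at hb'
    rw [map_mul traceFst, map_mul traceSnd, h0, h1]
    simp only [zero_mul, map_zero, sub_zero]
    exact hb'
  -- A divergence-free field in the plane is a rotated gradient: (α, β) = (∂₁φ, -∂₀φ), with φ then
  -- normalised to vanish at the origin.
  obtain ⟨φ₀, hφd, hφ⟩ := exists_potential (σ := Fin 2) (P := ![-β, α]) (d := k)
    (by intro i; fin_cases i <;> simp [hα, hβ])
    (by
      have h : pderiv 0 α = -pderiv 1 β := eq_neg_of_add_eq_zero_left hD0
      intro i j; fin_cases i <;> fin_cases j <;> simp [h])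
  set φ := φ₀ - C (eval 0 φ₀) with hφdef
  have hφ0 : pderiv 0 φ = -β := by simp [hφdef, hφ]
  have hφ1 : pderiv 1 φ = α := by simp [hφdef, hφ]
  have hconst : ∀ p : MvPolynomial (Fin 1) ℝ, pderiv 0 p = 0 → ∀ y : Fin 1 → ℝ, eval y p = 0 →
      p = 0 := by
    intro p hp y hy
    have h := eq_C_of_pderiv_eq_zero (p := p) (fun i => by rw [Fin.fin_one_eq_zero i, hp])
    rw [h, eval_C] at hy
    rw [h, hy, C_0]
  have e0 : eval 0 φ = 0 := by simp [hφdef]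
  -- Along a side the derivative of φ is, up to sign, the normal trace of the field, so φ is
  -- constant there and one vertex value suffices.
  have t0 : traceFst φ = 0 := by
    refine hconst _ (by rw [pderiv_traceFst, hφ1, h0]) 0 ?_
    rw [eval_zeroSubst]
    refine Eq.trans ?_ e0
    congr 2
    funext i
    fin_cases i <;> rfl
  have t1 : traceSnd φ = 0 := by
    refine hconst _ (by rw [pderiv_traceSnd, hφ0, map_neg, h1, neg_zero]) 0 ?_
    rw [traceSnd, AlgHom.comp_apply, eval_zeroSubst, eval_rename]
    refine Eq.trans ?_ e0
    congr 2
    funext i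
    fin_cases i <;> rfl
  have t2 : traceSlant φ = 0 := by
    refine hconst _ (by rw [pderiv_traceSlant, hφ0, hφ1, sub_neg_eq_add, h2]) 0 ?_
    -- The slanted side starts at the vertex (1, 0), which also lies on the second side, where φ is
    -- already zero.
    have h := congrArg (eval (fun _ => (1 : ℝ))) t1
    rw [traceSnd, AlgHom.comp_apply, eval_zeroSubst, eval_rename, map_zero] at h
    rw [eval_slantSubst, ← h]
    congr 2
    funext i
    fin_cases i <;> simp
  obtain ⟨χ, hχ, hχd⟩ := exists_bubble_factor t0 t1 t2
  have hχ0 : χ = 0 := by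
    by_contra hne
    have hdeg := hχd hne
    have hφd' : φ.totalDegree ≤ k + 1 :=
      (totalDegree_sub _ _).trans (max_le hφd (by simp))
    -- In the plane div (x q) = (E + 2) q, so q can be chosen with divergence χ. Pairing with the
    -- rotated x q then yields the integral of the bubble times χ².
    obtain ⟨q, hqd, hqχ⟩ := exists_eulerOp_add_smul (c := 2) two_pos χ
    have h := hq (by omega) q (by omega)
    rw [← hφ1, ← neg_neg β, ← hφ0, simplexInt_rot t0 t1 t2] at h
    have h3 : pderiv 0 (X 0 * q) - pderiv 1 (-(X 1 * q)) = χ := by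
      rw [← hqχ, eulerOp, Fin.sum_univ_two, two_smul]
      simp only [map_neg, pderiv_mul, pderiv_X_self]
      ring
    rw [h3] at h
    have h4 : φ * χ = X 0 * X 1 * bary * (χ * χ) := by rw [hχ]; ring
    rw [h4] at h
    have h5 := eq_zero_of_simplexInt_eq_zero (fun y hy => ?_) h
    · have hb : bary ≠ 0 := fun h => by simpa [h] using totalDegree_bary
      simp only [mul_eq_zero, X_ne_zero, hb, hne, or_self] at h5
    · obtain ⟨a0, a1, a2⟩ := coord_nonneg_of_mem_refSimplex hy
      simp only [map_mul]
      exact mul_nonneg (mul_nonneg (mul_nonneg a0 a1) a2) (mul_self_nonneg _)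
  rw [hχ0, mul_zero] at hχ
  rw [hχ] at hφ0 hφ1
  simp only [map_zero] at hφ0 hφ1
  exact ⟨hφ1.symm, neg_eq_zero.1 hφ0.symm⟩

/-- Write w = w(0) + t r = (1 - t) w(0) + t (w(0) + r): thus w itself is a combination of the
admitted weights. Weights of this form are the normal traces of the explicit fields used in the dual
unisolvence. -/
lemma eq_zero_of_edge_moments {k : ℕ} (hk : 1 ≤ k) {w : MvPolynomial (Fin 1) ℝ}
    (hw : w.totalDegree ≤ k)
    (h : ∀ χ : MvPolynomial (Fin 1) ℝ, χ.totalDegree ≤ k - 1 →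
      simplexInt 1 ((1 - X 0) * χ * w) = 0 ∧ simplexInt 1 (X 0 * χ * w) = 0) : w = 0 := by
  obtain ⟨r, hr⟩ : X 0 ∣ w - C (eval 0 w) := by
    refine dvd_of_aeval_eq_zero (f := fun _ => 0) (fun i => ?_) ?_
    · rw [Fin.fin_one_eq_zero i, sub_zero]
    · rw [map_sub, aeval_C, algebraMap_eq, sub_eq_zero]
      refine MvPolynomial.funext fun y => ?_
      rw [eval_aeval, eval_C]
      simp only [map_zero]
      rfl
  have hrd : r.totalDegree ≤ k - 1 := by
    by_cases h0 : r = 0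
    · simp [h0]
    · have h1 := congrArg totalDegree hr
      rw [totalDegree_mul_of_isDomain (X_ne_zero _) h0, totalDegree_X] at h1
      have h2 : (w - C (eval 0 w)).totalDegree ≤ k := (totalDegree_sub _ _).trans (by simp [hw])
      omega
  refine eq_zero_of_simplexInt_mul_self ?_
  have hs : w * w = (1 - X 0) * C (eval 0 w) * w + X 0 * (C (eval 0 w) + r) * w := by
    rw [sub_eq_iff_eq_add] at hr
    linear_combination w * hr
  rw [hs, map_add, (h _ (by simp)).1, (h _ ?_).2, add_zero]
  exact (totalDegree_add _ _).trans (max_le (by simp) hrd)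

lemma totalDegree_mul_le_of_le {σ : Type*} {p q : MvPolynomial σ ℝ} {m n : ℕ}
    (hp : p.totalDegree ≤ m) (hq : q.totalDegree ≤ n) : (p * q).totalDegree ≤ m + n :=
  (totalDegree_mul _ _).trans (add_le_add hp hq)

/-- The test functionals of the element are linearly independent on the fields of degree `k`. -/
theorem bdm_dual_unisolvent {k : ℕ} (hk : 1 ≤ k) {w₀ w₁ w₂ : MvPolynomial (Fin 1) ℝ}
    (hw₀ : w₀.totalDegree ≤ k) (hw₁ : w₁.totalDegree ≤ k) (hw₂ : w₂.totalDegree ≤ k)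
    {c d a₀ a₁ q : MvPolynomial (Fin 2) ℝ} (ha₀ : a₀.totalDegree ≤ k - 2)
    (ha₁ : a₁.totalDegree ≤ k - 2) (hq : q.totalDegree ≤ k - 2)
    (hc : c = a₀ - X 1 * q) (hd : d = a₁ + X 0 * q) (hk1 : 2 ≤ k ∨ (c = 0 ∧ d = 0))
    (h : ∀ α β : MvPolynomial (Fin 2) ℝ, α.totalDegree ≤ k → β.totalDegree ≤ k →
      simplexInt 1 (traceFst α * w₀) + simplexInt 1 (traceSnd β * w₁) +
        simplexInt 1 (traceSlant (α + β) * w₂) + simplexInt 2 (α * c + β * d) = 0) :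
    w₀ = 0 ∧ w₁ = 0 ∧ w₂ = 0 ∧ c = 0 ∧ d = 0 := by
  have hX : ∀ i : Fin 2, (X i : MvPolynomial (Fin 2) ℝ).totalDegree ≤ 1 := fun i =>
    (totalDegree_X i).le
  have hb := totalDegree_bary.le
  have hcd : c = 0 ∧ d = 0 := by
    rcases hk1 with hk2 | h0
    swap
    · exact h0
    -- The rotated gradient of the bubble times χ has no normal traces and pairs with (c, d) to the
    -- integral of the bubble times χ². Hence the rotation χ of (c, d) vanishes.
    set χ := pderiv 0 d - pderiv 1 c with hχ
    have hcd : ∀ p : MvPolynomial (Fin 2) ℝ, p.totalDegree ≤ k - 2 → ∀ i,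
        (X i * p).totalDegree ≤ k - 1 := fun p hp i =>
      (totalDegree_mul_le_of_le (hX i) hp).trans (by omega)
    have hc1 : c.totalDegree ≤ k - 1 := by
      rw [hc]; exact (totalDegree_sub _ _).trans (max_le (by omega) (hcd q hq 1))
    have hd1 : d.totalDegree ≤ k - 1 := by
      rw [hd]; exact (totalDegree_add _ _).trans (max_le (by omega) (hcd q hq 0))
    have hχd : χ.totalDegree ≤ k - 2 := by
      refine (totalDegree_sub _ _).trans (max_le ?_ ?_)
      · exact (totalDegree_pderiv_le _ _).trans (by omega)
      · exact (totalDegree_pderiv_le _ _).trans (by omega)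
    have hχ0 : χ = 0 := by
      set φ := X 0 * X 1 * bary * χ with hφ
      have hφd : φ.totalDegree ≤ k + 1 :=
        (totalDegree_mul_le_of_le (totalDegree_mul_le_of_le
          (totalDegree_mul_le_of_le (hX 0) (hX 1)) hb) hχd).trans (by omega)
      have t0 : traceFst φ = 0 := by rw [hφ, map_mul, map_mul, map_mul, traceFst_X0]; simp
      have t1 : traceSnd φ = 0 := by rw [hφ, map_mul, map_mul, map_mul, traceSnd_X1]; simp
      have t2 : traceSlant φ = 0 := by rw [hφ, map_mul, map_mul traceSlant, traceSlant_bary]; simp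
      have h1 := h (pderiv 1 φ) (-pderiv 0 φ)
        ((totalDegree_pderiv_le _ _).trans (by omega))
        (by rw [totalDegree_neg]; exact (totalDegree_pderiv_le _ _).trans (by omega))
      rw [map_neg traceSnd, ← sub_eq_add_neg, ← pderiv_traceFst, ← pderiv_traceSnd,
        ← pderiv_traceSlant, t0, t1, t2, simplexInt_rot t0 t1 t2] at h1
      simp only [map_zero, zero_mul, neg_zero, zero_add] at h1
      have h4 : φ * χ = X 0 * X 1 * bary * (χ * χ) := by rw [hφ]; ring
      rw [← hχ, h4] at h1
      have h5 := eq_zero_of_simplexInt_eq_zero (fun y hy => ?_) h1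
      · have hb : bary ≠ 0 := fun h => by simpa [h] using totalDegree_bary
        simpa only [mul_eq_zero, X_ne_zero, hb, or_self, false_or] using h5
      · obtain ⟨a0, a1, a2⟩ := coord_nonneg_of_mem_refSimplex hy
        simp only [map_mul]
        exact mul_nonneg (mul_nonneg (mul_nonneg a0 a1) a2) (mul_self_nonneg _)
    -- Vanishing rotation reads (E + 2) q = ∂₁a₀ - ∂₀a₁, so q has degree at most k - 3, or is zero
    -- when k = 2. Therefore x q, and with it c and d, has degree at most k - 2.
    have hq2 : ∀ i, (X i * q).totalDegree ≤ k - 2 := by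
      have he : eulerOp q + (2 : ℝ) • q = pderiv 1 a₀ - pderiv 0 a₁ := by
        rw [hχ, hc, hd] at hχ0
        simp only [map_sub, map_add, pderiv_mul, pderiv_X_self] at hχ0
        rw [eulerOp, Fin.sum_univ_two, two_smul]
        linear_combination hχ0
      have hqd := totalDegree_le_eulerOp_add_smul two_pos q
      rw [he] at hqd
      intro i
      rcases Nat.eq_zero_or_pos (k - 2) with h2 | h2
      · have e0 : a₀.totalDegree = 0 := by omega
        have e1 : a₁.totalDegree = 0 := by omega
        have hq0 : q = 0 := by
          rw [totalDegree_eq_zero_iff_eq_C.1 e0, totalDegree_eq_zero_iff_eq_C.1 e1] at he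
          simp only [pderiv_C, sub_zero] at he
          ext s
          have h3 := congrArg (coeff s) he
          rw [coeff_add, coeff_eulerOp, coeff_smul, smul_eq_mul, ← add_mul, coeff_zero] at h3
          exact (mul_eq_zero.1 h3).resolve_left (by positivity)
        simp [hq0]
      · have h3 : (pderiv 1 a₀ - pderiv 0 a₁).totalDegree ≤ k - 2 - 1 := by
          refine (totalDegree_sub _ _).trans (max_le ?_ ?_)
          · exact (totalDegree_pderiv_le _ _).trans (by omega)
          · exact (totalDegree_pderiv_le _ _).trans (by omega)
        exact (totalDegree_mul_le_of_le (hX i) (hqd.trans h3)).trans (by omega)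
    have hc2 : c.totalDegree ≤ k - 2 := by
      rw [hc]; exact (totalDegree_sub _ _).trans (max_le ha₀ (hq2 1))
    have hd2 : d.totalDegree ≤ k - 2 := by
      rw [hd]; exact (totalDegree_add _ _).trans (max_le ha₁ (hq2 0))
    -- The fields (X₀ bary c, 0) and (0, X₁ bary d) now have degree at most k; they have no normal
    -- traces and pair with (c, d) to a weighted square.
    have key : ∀ (i : Fin 2) (e : MvPolynomial (Fin 2) ℝ),
        simplexInt 2 (X i * bary * (e * e)) = 0 → e = 0 := by
      intro i e he
      have h5 := eq_zero_of_simplexInt_eq_zero (fun y hy => ?_) he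
      · have hb : bary ≠ 0 := fun h => by simpa [h] using totalDegree_bary
        simpa only [mul_eq_zero, X_ne_zero, hb, or_self, false_or] using h5
      · obtain ⟨a0, a1, a2⟩ := coord_nonneg_of_mem_refSimplex hy
        simp only [map_mul]
        refine mul_nonneg (mul_nonneg ?_ a2) (mul_self_nonneg _)
        fin_cases i
        · exact a0
        · exact a1
    constructor
    · have h1 := h (X 0 * bary * c) 0
        ((totalDegree_mul_le_of_le (totalDegree_mul_le_of_le (hX 0) hb) hc2).trans (by omega))
        (by simp)
      refine key 0 c ?_
      rw [add_zero, map_mul traceFst, map_mul traceFst, traceFst_X0, map_mul traceSlant,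
        map_mul traceSlant, traceSlant_bary] at h1
      simpa [mul_assoc] using h1
    · have h1 := h 0 (X 1 * bary * d) (by simp)
        ((totalDegree_mul_le_of_le (totalDegree_mul_le_of_le (hX 1) hb) hd2).trans (by omega))
      refine key 1 d ?_
      rw [zero_add, map_mul traceSnd, map_mul traceSnd, traceSnd_X1, map_mul traceSlant,
        map_mul traceSlant, traceSlant_bary] at h1
      simpa [mul_assoc] using h1
  obtain ⟨hc0, hd0⟩ := hcd
  have h' : ∀ α β : MvPolynomial (Fin 2) ℝ, α.totalDegree ≤ k → β.totalDegree ≤ k →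
      simplexInt 1 (traceFst α * w₀) + simplexInt 1 (traceSnd β * w₁) +
        simplexInt 1 (traceSlant (α + β) * w₂) = 0 := by
    intro α β hα hβ
    have := h α β hα hβ
    simpa [hc0, hd0] using this
  have hlift : ∀ (χ : MvPolynomial (Fin 1) ℝ) (i : Fin 2) (l : MvPolynomial (Fin 2) ℝ),
      χ.totalDegree ≤ k - 1 → l.totalDegree ≤ 1 →
      (l * rename (fun _ => i) χ).totalDegree ≤ k := fun χ i l hχ hl =>
    (totalDegree_mul_le_of_le hl ((totalDegree_rename_le _ _).trans hχ)).trans (by omega)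
  have r0 : ∀ χ, traceFst (rename (fun _ => (1 : Fin 2)) χ) = χ := fun χ => by
    have : (traceFst.comp (rename (fun _ => (1 : Fin 2))) : MvPolynomial (Fin 1) ℝ →ₐ[ℝ] _) =
        AlgHom.id ℝ _ := algHom_ext fun i => by
      rw [AlgHom.comp_apply, rename_X, traceFst_X1, Fin.fin_one_eq_zero i]; rfl
    exact DFunLike.congr_fun this χ
  have r1 : ∀ χ, traceSnd (rename (fun _ => (0 : Fin 2)) χ) = χ := fun χ => by
    have : (traceSnd.comp (rename (fun _ => (0 : Fin 2))) : MvPolynomial (Fin 1) ℝ →ₐ[ℝ] _) =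
        AlgHom.id ℝ _ := algHom_ext fun i => by
      rw [AlgHom.comp_apply, rename_X, traceSnd_X0, Fin.fin_one_eq_zero i]; rfl
    exact DFunLike.congr_fun this χ
  have r2 : ∀ χ, traceSlant (rename (fun _ => (1 : Fin 2)) χ) = χ := fun χ => by
    have : (traceSlant.comp (rename (fun _ => (1 : Fin 2))) : MvPolynomial (Fin 1) ℝ →ₐ[ℝ] _) =
        AlgHom.id ℝ _ := algHom_ext fun i => by
      rw [AlgHom.comp_apply, rename_X, traceSlant_X1, Fin.fin_one_eq_zero i]; rfl
    exact DFunLike.congr_fun this χ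
  refine ⟨?_, ?_, ?_, hc0, hd0⟩
  -- With χ a function of X₁, the fields (bary χ, 0) and (X₁ χ, -X₁ χ) have normal traces (1 - t) χ
  -- and t χ on the first side and none on the others. The other sides are analogous.
  · refine eq_zero_of_edge_moments hk hw₀ fun χ hχ => ⟨?_, ?_⟩
    · have h1 := h' (bary * rename (fun _ => 1) χ) 0 (hlift χ 1 _ hχ hb) (by simp)
      rw [add_zero, map_mul traceFst, map_mul traceSlant, traceSlant_bary, traceFst_bary, r0] at h1
      simpa using h1
    · have h1 := h' (X 1 * rename (fun _ => 1) χ) (-(X 1 * rename (fun _ => 1) χ))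
        (hlift χ 1 _ hχ (hX 1)) (by rw [totalDegree_neg]; exact hlift χ 1 _ hχ (hX 1))
      rw [add_neg_cancel, map_neg, map_mul traceFst, map_mul traceSnd, traceFst_X1, traceSnd_X1,
        r0] at h1
      simpa using h1
  · refine eq_zero_of_edge_moments hk hw₁ fun χ hχ => ⟨?_, ?_⟩
    · have h1 := h' 0 (bary * rename (fun _ => 0) χ) (by simp) (hlift χ 0 _ hχ hb)
      rw [zero_add, map_mul traceSnd, map_mul traceSlant, traceSlant_bary, traceSnd_bary, r1] at h1
      simpa using h1
    · have h1 := h' (-(X 0 * rename (fun _ => 0) χ)) (X 0 * rename (fun _ => 0) χ)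
        (by rw [totalDegree_neg]; exact hlift χ 0 _ hχ (hX 0)) (hlift χ 0 _ hχ (hX 0))
      rw [neg_add_cancel, map_neg, map_mul traceFst, map_mul traceSnd, traceFst_X0, traceSnd_X0,
        r1] at h1
      simpa using h1
  · refine eq_zero_of_edge_moments hk hw₂ fun χ hχ => ⟨?_, ?_⟩
    · have h1 := h' (X 0 * rename (fun _ => 1) χ) 0 (hlift χ 1 _ hχ (hX 0)) (by simp)
      rw [add_zero, map_mul traceFst, map_mul traceSlant, traceSlant_X0, traceFst_X0, r2] at h1
      simpa using h1
    · have h1 := h' 0 (X 1 * rename (fun _ => 1) χ) (by simp) (hlift χ 1 _ hχ (hX 1))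
      rw [zero_add, map_mul traceSnd, map_mul traceSlant, traceSlant_X1, traceSnd_X1, r2] at h1
      simpa using h1

end BDM

/-! ### Polynomials and measures on simplices in space -/

section Param

variable {n : ℕ}

/-- The affine parametrisation of a simplex by the reference simplex. -/
def simplexParam (v : Fin (n + 1) → E3) (y : Fin n → ℝ) : E3 :=
  v 0 + ∑ j, y j • (v j.succ - v 0)

/-- The pullback of a polynomial to the reference simplex. -/
def pullback (v : Fin (n + 1) → E3) : Poly3 →ₐ[ℝ] MvPolynomial (Fin n) ℝ :=
  MvPolynomial.aeval fun i =>
    MvPolynomial.C (v 0 i) + ∑ j, MvPolynomial.C ((v j.succ - v 0) i) * MvPolynomial.X j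

lemma pullback_X (v : Fin (n + 1) → E3) (i : Fin 3) : pullback v (MvPolynomial.X i) =
    MvPolynomial.C (v 0 i) + ∑ j, MvPolynomial.C ((v j.succ - v 0) i) * MvPolynomial.X j := by
  simp only [pullback, MvPolynomial.aeval_X]

lemma eval_pullback (v : Fin (n + 1) → E3) (p : Poly3) (y : Fin n → ℝ) :
    MvPolynomial.eval y (pullback v p) = pval p (simplexParam v y) := by
  rw [pullback, eval_aeval, pval]
  refine congrArg (fun z => MvPolynomial.eval z p) (funext fun i => ?_)
  simp only [map_add, map_sum, map_mul, MvPolynomial.eval_C, MvPolynomial.eval_X, simplexParam,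
    PiLp.add_apply, WithLp.ofLp_sum, Finset.sum_apply, WithLp.ofLp_smul, Pi.smul_apply, smul_eq_mul]
  congr 1
  exact Finset.sum_congr rfl fun j _ => mul_comm _ _

lemma totalDegree_pullback_le (v : Fin (n + 1) → E3) (p : Poly3) :
    (pullback v p).totalDegree ≤ p.totalDegree := by
  refine totalDegree_aeval_le (fun i => ?_) p
  refine (MvPolynomial.totalDegree_add _ _).trans (max_le (by simp) ?_)
  refine MvPolynomial.totalDegree_finsetSum_le fun j _ => ?_
  exact (totalDegree_mul_le_of_le (MvPolynomial.totalDegree_C _).le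
    (MvPolynomial.totalDegree_X j).le).trans (by simp)

/-- The derivative of a polynomial in a constant direction. -/
def dirDeriv (w : E3) (p : Poly3) : Poly3 := ∑ i, MvPolynomial.C (w i) * MvPolynomial.pderiv i p

lemma pderiv_pullback (v : Fin (n + 1) → E3) (j : Fin n) (p : Poly3) :
    MvPolynomial.pderiv j (pullback v p) = pullback v (dirDeriv (v j.succ - v 0) p) := by
  refine pderiv_algHom_of_X _ _ (fun i => (v j.succ - v 0) i) (fun i => ?_) p
  rw [pullback_X, map_add, MvPolynomial.pderiv_C, zero_add, map_sum, Finset.sum_eq_single j]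
  · simp
  · intro l _ hl; simp [MvPolynomial.pderiv_X_of_ne hl]
  · simp

lemma continuous_pval (p : Poly3) : Continuous (pval p) := by
  unfold pval
  exact (MvPolynomial.continuous_eval p).comp (PiLp.continuous_ofLp 2 _)

lemma continuous_simplexParam (v : Fin (n + 1) → E3) : Continuous (simplexParam v) := by
  unfold simplexParam; fun_prop

lemma simplexParam_eq_sum (v : Fin (n + 1) → E3) (y : Fin n → ℝ) :
    simplexParam v y = ∑ i, (Fin.cons (1 - ∑ j, y j) y : Fin (n + 1) → ℝ) i • v i := by
  rw [Fin.sum_univ_succ]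
  simp only [Fin.cons_zero, Fin.cons_succ, simplexParam, smul_sub, Finset.sum_sub_distrib,
    ← Finset.sum_smul, sub_smul, one_smul]
  abel

lemma image_simplexParam (v : Fin (n + 1) → E3) :
    simplexParam v '' refSimplex n = convexHull ℝ (Set.range v) := by
  refine Set.Subset.antisymm ?_ ?_
  · rintro _ ⟨y, hy, rfl⟩
    rw [simplexParam_eq_sum]
    refine (convex_convexHull ℝ _).sum_mem (fun i _ => ?_) ?_ fun i _ =>
      subset_convexHull ℝ _ ⟨i, rfl⟩
    · refine Fin.cases ?_ (fun j => ?_) i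
      · simpa using hy.2
      · simpa using hy.1 j
    · simp [Fin.sum_univ_succ]
  · refine convexHull_min ?_ ?_
    · rintro _ ⟨i, rfl⟩
      refine Fin.cases ⟨0, ⟨by simp, by simp⟩, by simp [simplexParam]⟩ (fun j => ?_) i
      refine ⟨Pi.single j 1, ⟨fun l => ?_, by simp⟩, ?_⟩
      · by_cases h : l = j
        · subst h; simp
        · simp [h]
      · rw [simplexParam, Finset.sum_eq_single j]
        · simp
        · intro l _ hl; simp [hl]
        · simp
    · rintro _ ⟨y, hy, rfl⟩ _ ⟨z, hz, rfl⟩ a b ha hb hab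
      refine ⟨a • y + b • z, ⟨fun i => ?_, ?_⟩, ?_⟩
      · simpa using add_nonneg (mul_nonneg ha (hy.1 i)) (mul_nonneg hb (hz.1 i))
      · simp only [Pi.add_apply, Pi.smul_apply, smul_eq_mul, Finset.sum_add_distrib,
          ← Finset.mul_sum]
        calc _ ≤ a * 1 + b * 1 := add_le_add (mul_le_mul_of_nonneg_left hy.2 ha)
              (mul_le_mul_of_nonneg_left hz.2 hb)
          _ = 1 := by rw [mul_one, mul_one, hab]
      · simp only [simplexParam, Pi.add_apply, Pi.smul_apply, smul_eq_mul, add_smul, mul_smul,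
          Finset.sum_add_distrib, ← Finset.smul_sum, smul_add]
        have : v 0 = a • v 0 + b • v 0 := by rw [← add_smul, hab, one_smul]
        nth_rewrite 1 [this]
        abel

/-- The Jacobian of the parametrisation of a simplex. -/
def simplexJac (v : Fin (n + 1) → E3) : ℝ :=
  Real.sqrt (Matrix.gram ℝ fun j : Fin n => v j.succ - v 0).det

/-- The linear part of the parametrisation of a simplex. -/
def simplexLinear (v : Fin (n + 1) → E3) : EuclideanSpace ℝ (Fin n) →ₗ[ℝ] E3 where
  toFun y := ∑ j, y j • (v j.succ - v 0)
  map_add' y z := by simp [add_smul, Finset.sum_add_distrib]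
  map_smul' c y := by simp [mul_smul, Finset.smul_sum]

lemma simplexLinear_apply (v : Fin (n + 1) → E3) (y : EuclideanSpace ℝ (Fin n)) :
    simplexLinear v y = ∑ j, y j • (v j.succ - v 0) := rfl

lemma simplexJac_eq (v : Fin (n + 1) → E3) : simplexJac v = (simplexLinear v).normDet := by
  have h := (simplexLinear v).normDet_sq_eq_det_gram (EuclideanSpace.basisFun (Fin n) ℝ)
  have h2 : (fun j => simplexLinear v (EuclideanSpace.basisFun (Fin n) ℝ j)) =
      fun j : Fin n => v j.succ - v 0 := by
    funext j
    rw [simplexLinear_apply, Finset.sum_eq_single j]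
    · simp
    · intro l _ hl; simp [hl]
    · simp
  rw [h2] at h
  rw [simplexJac, ← h]
  exact Real.sqrt_sq (simplexLinear v).normDet_nonneg

lemma simplexJac_pos {v : Fin (n + 1) → E3} (hv : AffineIndependent ℝ v) : 0 < simplexJac v := by
  rw [simplexJac_eq]
  refine lt_of_le_of_ne (LinearMap.normDet_nonneg _) (Ne.symm ?_)
  refine ((LinearMap.normDet_ne_zero_tfae _).out 0 1).2 ?_
  rw [affineIndependent_iff_linearIndependent_vsub ℝ v 0] at hv
  have hv2 : LinearIndependent ℝ fun j : Fin n => v j.succ - v 0 :=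
    hv.comp (fun j : Fin n => ⟨j.succ, Fin.succ_ne_zero j⟩) fun a b h => by simpa using h
  rw [LinearMap.ker_eq_bot']
  intro y hy
  ext j
  exact Fintype.linearIndependent_iff.1 hv2 y hy j

open scoped Pointwise in
-- The area formula for an affine map: the Hausdorff measure is translation invariant and a linear
-- map scales it by `normDet`. All cell, face and edge integrals of polynomials reduce to reference
-- simplices in this way.
lemma restrict_simplex_eq (v : Fin (n + 1) → E3) :
    (μHE[n] : Measure E3).restrict (convexHull ℝ (Set.range v)) =
      ENNReal.ofReal (simplexJac v) • (volume.restrict (refSimplex n)).map (simplexParam v) := by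
  ext s hs
  have hm := (continuous_simplexParam v).measurable
  have hA : s ∩ convexHull ℝ (Set.range v) = v 0 +ᵥ
      (simplexLinear v '' (WithLp.toLp 2 '' (simplexParam v ⁻¹' s ∩ refSimplex n))) := by
    rw [← image_simplexParam, Set.inter_comm, ← Set.image_inter_preimage, Set.image_image,
      ← Set.image_vadd, Set.image_image, Set.inter_comm]
    rfl
  have h := (simplexLinear v).euclideanHausdorffMeasure_image_eq_normDet_mul_volume
    (WithLp.toLp 2 '' (simplexParam v ⁻¹' s ∩ refSimplex n))
  rw [finrank_euclideanSpace_fin] at h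
  rw [Measure.restrict_apply hs, hA, measure_vadd, h, simplexJac_eq, Measure.smul_apply,
    Measure.map_apply hm hs, Measure.restrict_apply (hm hs), smul_eq_mul]
  congr 1
  have hpre : (WithLp.toLp 2 : (Fin n → ℝ) → EuclideanSpace ℝ (Fin n)) ⁻¹'
      (WithLp.toLp 2 '' (simplexParam v ⁻¹' s ∩ refSimplex n)) =
        simplexParam v ⁻¹' s ∩ refSimplex n :=
    Set.preimage_image_eq _ (WithLp.toLp_injective 2)
  have hvol := (PiLp.volume_preserving_toLp (Fin n)).measure_preimage_emb
    (MeasurableEquiv.toLp 2 (Fin n → ℝ)).measurableEmbedding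
    (WithLp.toLp 2 '' (simplexParam v ⁻¹' s ∩ refSimplex n))
  rw [hpre] at hvol
  exact hvol.symm

lemma integral_simplex (v : Fin (n + 1) → E3) (p : Poly3) :
    ∫ x, pval p x ∂((μHE[n] : Measure E3).restrict (convexHull ℝ (Set.range v))) =
      simplexJac v * simplexInt n (pullback v p) := by
  rw [restrict_simplex_eq, integral_smul_measure,
    integral_map (continuous_simplexParam v).aemeasurable
      (continuous_pval p).aestronglyMeasurable, simplexInt_apply, smul_eq_mul,
    ENNReal.toReal_ofReal (show 0 ≤ simplexJac v from Real.sqrt_nonneg _)]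
  simp only [eval_pullback]

end Param

/-! ### Normals -/

lemma inner_eq_dot (x y : E3) : inner ℝ x y = x.ofLp ⬝ᵥ y.ofLp := by
  rw [EuclideanSpace.inner_eq_star_dotProduct, star_trivial, dotProduct_comm]

section Normal

variable {S G : Finset E3} {a : E3}

lemma centroid_eq_smul_sum (S : Finset E3) (hS : S.Nonempty) :
    S.centroid ℝ id = (S.card : ℝ)⁻¹ • ∑ x ∈ S, x := by
  rw [Finset.centroid_def, Finset.affineCombination_eq_linear_combination _ _ _
    (S.sum_centroidWeights_eq_one_of_nonempty ℝ hS), Finset.smul_sum]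
  simp [Finset.centroidWeights]

lemma outwardNormal_dot {w : E3} (hw : w ∈ vectorSpan ℝ (G : Set E3)) :
    outwardNormal S G ⬝ᵥ w.ofLp = 0 := by
  have h : inner ℝ ((vectorSpan ℝ (G : Set E3))ᗮ.starProjection
      (G.centroid ℝ id - S.centroid ℝ id)) w = (0 : ℝ) :=
    Submodule.inner_left_of_mem_orthogonal hw (Submodule.starProjection_apply_mem _ _)
  rw [inner_eq_dot] at h
  simp only [outwardNormal, WithLp.ofLp_smul, smul_dotProduct, h, smul_zero]

lemma centroid_mem_affineSpan (hG : G.Nonempty) : G.centroid ℝ id ∈ affineSpan ℝ (G : Set E3) :=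
  convexHull_subset_affineSpan _ (Finset.centroid_mem_convexHull G hG)

/-- The vector that defines `outwardNormal` is a positive multiple of the one from the opposite
vertex, so that vertex fixes the sign of the normal. -/
lemma centroid_sub_centroid_insert (ha : a ∉ G) (hG : G.Nonempty) :
    G.centroid ℝ id - (insert a G).centroid ℝ id =
      ((G.card : ℝ) + 1)⁻¹ • (G.centroid ℝ id - a) := by
  have h0 : (G.card : ℝ) ≠ 0 := by simpa using hG.ne_empty
  have h1 : (G.card : ℝ) + 1 ≠ 0 := by positivity
  have h2 : ∑ x ∈ G, x = (G.card : ℝ) • G.centroid ℝ id := by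
    rw [centroid_eq_smul_sum G hG, smul_smul, mul_inv_cancel₀ h0, one_smul]
  rw [centroid_eq_smul_sum (insert a G) (Finset.insert_nonempty _ _), Finset.sum_insert ha,
    Finset.card_insert_of_notMem ha, h2, Nat.cast_add, Nat.cast_one]
  have h3 : G.centroid ℝ id = ((G.card : ℝ) + 1)⁻¹ • ((G.card : ℝ) + 1) • G.centroid ℝ id := by
    rw [smul_smul, inv_mul_cancel₀ h1, one_smul]
  nth_rewrite 1 [h3]
  rw [← smul_sub]
  congr 1
  rw [add_smul, one_smul]
  abel

/-- Otherwise a would lie in the affine span of G, against affine independence. -/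
lemma starProjection_ne_zero (ha : a ∉ G) (hG : G.Nonempty)
    (hS : AffineIndependent ℝ (fun x : (insert a G : Finset E3) => (x : E3))) :
    (vectorSpan ℝ (G : Set E3))ᗮ.starProjection (G.centroid ℝ id - a) ≠ 0 := by
  intro h
  rw [Submodule.starProjection_apply_eq_zero_iff, Submodule.orthogonal_orthogonal] at h
  have hc := centroid_mem_affineSpan hG
  have hmem : a ∈ affineSpan ℝ (G : Set E3) := by
    have h2 := AffineSubspace.vadd_mem_of_mem_direction
      (s := affineSpan ℝ (G : Set E3)) (v := -(G.centroid ℝ id - a))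
      (by rw [direction_affineSpan]; exact neg_mem h) hc
    simpa using h2
  have h3 := hS.notMem_affineSpan_sdiff ⟨a, Finset.mem_insert_self a G⟩ Set.univ
  refine h3 ?_
  convert hmem using 2
  ext x
  constructor
  · rintro ⟨⟨y, hy⟩, hy2, rfl⟩
    rcases Finset.mem_insert.1 hy with rfl | h
    · simp at hy2
    · exact h
  · intro hx
    refine ⟨⟨x, Finset.mem_insert_of_mem hx⟩, ⟨trivial, ?_⟩, rfl⟩
    rw [Set.mem_singleton_iff, Subtype.mk.injEq]
    rintro rfl
    exact ha hx

/-- The pairing with b - a does not depend on b in G: it is the height of a over G. The lemma serves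
faces of tetrahedra and edges of triangles alike. -/
lemma outwardNormal_facts (ha : a ∉ G) (hG : G.Nonempty)
    (hS : AffineIndependent ℝ (fun x : (insert a G : Finset E3) => (x : E3))) :
    outwardNormal (insert a G) G ⬝ᵥ outwardNormal (insert a G) G = 1 ∧
      ∀ b ∈ G, 0 < outwardNormal (insert a G) G ⬝ᵥ (b - a).ofLp := by
  set K := (vectorSpan ℝ (G : Set E3))ᗮ with hK
  set e := K.starProjection (G.centroid ℝ id - a) with he
  have he0 : e ≠ 0 := starProjection_ne_zero ha hG hS
  have hd : K.starProjection (G.centroid ℝ id - (insert a G).centroid ℝ id) =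
      ((G.card : ℝ) + 1)⁻¹ • e := by
    rw [centroid_sub_centroid_insert ha hG, map_smul]
  have hpos : (0 : ℝ) < ((G.card : ℝ) + 1)⁻¹ := by positivity
  have hn : outwardNormal (insert a G) G = (‖e‖⁻¹ • e).ofLp := by
    change (‖K.starProjection _‖⁻¹ • K.starProjection _).ofLp = _
    rw [hd, norm_smul, Real.norm_of_nonneg hpos.le, smul_smul, mul_inv, mul_assoc,
      mul_comm ‖e‖⁻¹, ← mul_assoc, inv_mul_cancel₀ hpos.ne', one_mul]
  have hne : 0 < ‖e‖ := norm_pos_iff.2 he0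
  refine ⟨?_, fun b hb => ?_⟩
  · rw [hn, ← inner_eq_dot, real_inner_self_eq_norm_sq, norm_smul, norm_inv, norm_norm,
      inv_mul_cancel₀ hne.ne', one_pow]
  · have hc : b - G.centroid ℝ id ∈ vectorSpan ℝ (G : Set E3) := by
      rw [← direction_affineSpan]
      exact AffineSubspace.vsub_mem_direction (subset_affineSpan ℝ _ hb)
        (centroid_mem_affineSpan hG)
    have h1 : inner ℝ e (b - G.centroid ℝ id) = (0 : ℝ) :=
      Submodule.inner_left_of_mem_orthogonal hc (Submodule.starProjection_apply_mem _ _)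
    have h2 : inner ℝ e (G.centroid ℝ id - a) = ‖e‖ ^ 2 := by
      rw [← real_inner_self_eq_norm_sq]
      have := Submodule.starProjection_inner_eq_zero (K := K) (G.centroid ℝ id - a) e
        (Submodule.starProjection_apply_mem _ _)
      rw [inner_sub_left, sub_eq_zero] at this
      rw [real_inner_comm, this]
    rw [hn, ← inner_eq_dot, inner_smul_left, ← sub_add_sub_cancel b (G.centroid ℝ id) a,
      inner_add_right, h1, h2]
    simp only [conj_trivial, zero_add]
    positivity

end Normal

/-! ### The divergence theorem on a tetrahedron -/

lemma dot_fin_three (a b : Vec) : a ⬝ᵥ b = a 0 * b 0 + a 1 * b 1 + a 2 * b 2 := by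
  simp [dotProduct, Fin.sum_univ_three]

/-- Volume is height times base area. The cross product of the base vectors is s n; the base Gram
determinant is s² and the triple product is s times the height. -/
lemma simplexJac_tetra {a b c d : E3} {n : Vec} (hn : n ⬝ᵥ n = 1) (hc : n ⬝ᵥ (c - b).ofLp = 0)
    (hd : n ⬝ᵥ (d - b).ofLp = 0) (hpos : 0 < n ⬝ᵥ (b - a).ofLp) :
    simplexJac ![a, b, c, d] = (n ⬝ᵥ (b - a).ofLp) * simplexJac ![b, c, d] := by
  have h3 : (Matrix.gram ℝ fun j : Fin 3 => (![a, b, c, d] : Fin 4 → E3) j.succ -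
      (![a, b, c, d] : Fin 4 → E3) 0).det = (n ⬝ᵥ (b - a).ofLp) ^ 2 *
      (Matrix.gram ℝ fun j : Fin 2 => (![b, c, d] : Fin 3 → E3) j.succ -
      (![b, c, d] : Fin 3 → E3) 0).det := by
    have hc' : c - a = (c - b) + (b - a) := by abel
    have hd' : d - a = (d - b) + (b - a) := by abel
    rw [Matrix.det_fin_three, Matrix.det_fin_two]
    simp only [Matrix.gram_apply, inner_eq_dot]
    simp only [Fin.isValue, Fin.succ_zero_eq_one, Fin.succ_one_eq_two, Matrix.cons_val_one,
      Matrix.cons_val_zero, Matrix.cons_val, Fin.reduceSucc, hc', hd', WithLp.ofLp_add]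
    generalize (c - b).ofLp = X at *
    generalize (d - b).ofLp = Y at *
    generalize (b - a).ofLp = w at *
    have e0 : X 1 * Y 2 - X 2 * Y 1 = (n 0 * (X 1 * Y 2 - X 2 * Y 1) + n 1 * (X 2 * Y 0 - X 0 * Y 2)
        + n 2 * (X 0 * Y 1 - X 1 * Y 0)) * n 0 := by
      rw [dot_fin_three] at hn hc hd
      linear_combination (-(X 1 * Y 2 - X 2 * Y 1)) * hn + (Y 2 * n 1 - Y 1 * n 2) * hc - (X 2 * n 1 - X 1 * n 2) * hd
    have e1 : X 2 * Y 0 - X 0 * Y 2 = (n 0 * (X 1 * Y 2 - X 2 * Y 1) + n 1 * (X 2 * Y 0 - X 0 * Y 2)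
        + n 2 * (X 0 * Y 1 - X 1 * Y 0)) * n 1 := by
      rw [dot_fin_three] at hn hc hd
      linear_combination (-(X 2 * Y 0 - X 0 * Y 2)) * hn + (Y 0 * n 2 - Y 2 * n 0) * hc - (X 0 * n 2 - X 2 * n 0) * hd
    have e2 : X 0 * Y 1 - X 1 * Y 0 = (n 0 * (X 1 * Y 2 - X 2 * Y 1) + n 1 * (X 2 * Y 0 - X 0 * Y 2)
        + n 2 * (X 0 * Y 1 - X 1 * Y 0)) * n 2 := by
      rw [dot_fin_three] at hn hc hd
      linear_combination (-(X 0 * Y 1 - X 1 * Y 0)) * hn + (Y 1 * n 0 - Y 0 * n 1) * hc - (X 1 * n 0 - X 0 * n 1) * hd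
    generalize hs : n 0 * (X 1 * Y 2 - X 2 * Y 1) + n 1 * (X 2 * Y 0 - X 0 * Y 2)
        + n 2 * (X 0 * Y 1 - X 1 * Y 0) = s at e0 e1 e2
    simp only [dot_fin_three, Pi.add_apply] at hn ⊢
    have hdet : (w 0 * (X 1 * Y 2 - X 2 * Y 1) + w 1 * (X 2 * Y 0 - X 0 * Y 2) +
        w 2 * (X 0 * Y 1 - X 1 * Y 0)) = s * (n 0 * w 0 + n 1 * w 1 + n 2 * w 2) := by
      rw [e0, e1, e2]; ring
    have hcr : (X 1 * Y 2 - X 2 * Y 1) ^ 2 + (X 2 * Y 0 - X 0 * Y 2) ^ 2 +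
        (X 0 * Y 1 - X 1 * Y 0) ^ 2 = s ^ 2 := by
      rw [e0, e1, e2]; linear_combination s ^ 2 * hn
    have h1 : (X 0 * X 0 + X 1 * X 1 + X 2 * X 2) * (Y 0 * Y 0 + Y 1 * Y 1 + Y 2 * Y 2) -
        (X 0 * Y 0 + X 1 * Y 1 + X 2 * Y 2) * (Y 0 * X 0 + Y 1 * X 1 + Y 2 * X 2) = s ^ 2 := by
      rw [← hcr]; ring
    rw [h1, ← mul_pow, mul_comm _ s, ← hdet]
    ring
  rw [simplexJac, simplexJac, h3, Real.sqrt_mul (sq_nonneg _), Real.sqrt_sq hpos.le]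

/-- The slanted face of the reference tetrahedron corresponds to the face opposite to a; in
`zeroSubst_pullback` the face of vanishing first coordinate corresponds to the one opposite to b. -/
lemma slantSubst_pullback (a b c d : E3) (p : Poly3) :
    slantSubst 2 (pullback ![a, b, c, d] p) = pullback ![b, c, d] p := by
  have : (slantSubst 2).comp (pullback ![a, b, c, d]) = pullback ![b, c, d] := by
    refine MvPolynomial.algHom_ext fun i => ?_
    rw [AlgHom.comp_apply, pullback_X, pullback_X]
    refine MvPolynomial.funext fun y => ?_
    rw [eval_slantSubst]
    have h2 : ∀ t : ℝ, (Fin.cons t y : Fin 3 → ℝ) 2 = y 1 := fun _ => rfl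
    simp [Fin.sum_univ_succ, h2]
    ring
  exact DFunLike.congr_fun this p

lemma zeroSubst_pullback (a b c d : E3) (p : Poly3) :
    zeroSubst 2 (pullback ![a, b, c, d] p) = pullback ![a, c, d] p := by
  have : (zeroSubst 2).comp (pullback ![a, b, c, d]) = pullback ![a, c, d] := by
    refine MvPolynomial.algHom_ext fun i => ?_
    rw [AlgHom.comp_apply, pullback_X, pullback_X]
    refine MvPolynomial.funext fun y => ?_
    rw [eval_zeroSubst]
    have h2 : ∀ t : ℝ, (Fin.cons t y : Fin 3 → ℝ) 2 = y 1 := fun _ => rfl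
    simp [Fin.sum_univ_succ, h2]
  exact DFunLike.congr_fun this p

/-- Differentiation along the edge from a to b is ∂₀ in reference coordinates. The two faces
containing this edge contribute nothing, and for the other two the height times the area Jacobian is
the common volume Jacobian. -/
lemma integral_dirDeriv_tetra {a b c d : E3}
    {n m : Vec} (hn : n ⬝ᵥ n = 1) (hnc : n ⬝ᵥ (c - b).ofLp = 0) (hnd : n ⬝ᵥ (d - b).ofLp = 0)
    (hnpos : 0 < n ⬝ᵥ (b - a).ofLp) (hm : m ⬝ᵥ m = 1) (hmc : m ⬝ᵥ (c - a).ofLp = 0)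
    (hmd : m ⬝ᵥ (d - a).ofLp = 0) (hmpos : 0 < m ⬝ᵥ (a - b).ofLp) (p : Poly3) :
    ∫ x in convexHull ℝ (Set.range ![a, b, c, d]), pval (dirDeriv (b - a) p) x =
      (n ⬝ᵥ (b - a).ofLp) *
          ∫ x, pval p x ∂((μHE[2] : Measure E3).restrict (convexHull ℝ (Set.range ![b, c, d]))) +
      (m ⬝ᵥ (b - a).ofLp) *
          ∫ x, pval p x ∂((μHE[2] : Measure E3).restrict (convexHull ℝ (Set.range ![a, c, d]))) := by
  have h1 := simplexJac_tetra hn hnc hnd hnpos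
  have h2 := simplexJac_tetra hm hmc hmd hmpos
  have hswap : simplexJac ![b, a, c, d] = simplexJac ![a, b, c, d] := by
    rw [simplexJac, simplexJac, Matrix.det_fin_three, Matrix.det_fin_three]
    congr 1
    have hc' : c - b = (c - a) - (b - a) := by abel
    have hd' : d - b = (d - a) - (b - a) := by abel
    have ha' : a - b = - (b - a) := by abel
    simp only [Matrix.gram_apply, inner_eq_dot]
    simp only [Fin.isValue, Fin.succ_zero_eq_one, Fin.succ_one_eq_two, Matrix.cons_val_one,
      Matrix.cons_val_zero, Matrix.cons_val, Fin.reduceSucc, hc', hd', ha', WithLp.ofLp_sub,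
      WithLp.ofLp_neg, dotProduct_sub, sub_dotProduct, neg_dotProduct, dotProduct_neg]
    ring
  have hvol : (volume : Measure E3) = μHE[3] :=
    (EuclideanSpace.euclideanHausdorffMeasure_eq_volume 3).symm
  rw [hvol, integral_simplex, integral_simplex, integral_simplex]
  have hp : pullback ![a, b, c, d] (dirDeriv (b - a) p) =
      MvPolynomial.pderiv 0 (pullback ![a, b, c, d] p) := by
    rw [pderiv_pullback]; simp
  have hneg : m ⬝ᵥ (b - a).ofLp = - (m ⬝ᵥ (a - b).ofLp) := by
    rw [← neg_sub b a, WithLp.ofLp_neg, dotProduct_neg, neg_neg]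
  rw [hp, simplexInt_pderiv_zero, slantSubst_pullback, zeroSubst_pullback, hneg, neg_mul,
    ← mul_assoc, ← mul_assoc, ← h1, ← h2, hswap]
  ring

/-! ### Geometry of a single tetrahedron -/

section Tetra

variable {T : Finset E3}

/-- The barycentric coordinates of a tetrahedron. -/
def cellBasis (hT : AffineIndependent ℝ (fun x : T => (x : E3))) (h4 : T.card = 4) :
    AffineBasis T ℝ E3 :=
  ⟨fun x : T => (x : E3), hT, by
    rw [hT.affineSpan_eq_top_iff_card_eq_finrank_add_one]
    simp [h4]⟩

variable (hT : AffineIndependent ℝ (fun x : T => (x : E3))) (h4 : T.card = 4)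

lemma cellBasis_apply (i : T) : cellBasis hT h4 i = (i : E3) := rfl

lemma simplexSet_eq : simplexSet T = {x | ∀ i, 0 ≤ (cellBasis hT h4).coord i x} := by
  rw [← AffineBasis.convexHull_eq_nonneg_coord, simplexSet]
  congr 1
  ext x
  simp [cellBasis_apply]

lemma interior_simplexSet : interior (simplexSet T) = {x | ∀ i, 0 < (cellBasis hT h4).coord i x} := by
  rw [← AffineBasis.interior_convexHull, simplexSet]
  congr 2
  ext x
  simp [cellBasis_apply]

lemma coord_eq_zero_of_mem_affineSpan {e : Finset E3} (he : e ⊆ T) {x : E3}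
    (hx : x ∈ affineSpan ℝ (e : Set E3)) {i : T} (hi : (i : E3) ∉ e) :
    (cellBasis hT h4).coord i x = 0 := by
  have h : affineSpan ℝ (e : Set E3) ≤
      (affineSpan ℝ ({0} : Set ℝ)).comap ((cellBasis hT h4).coord i) := by
    rw [affineSpan_le]
    intro y hy
    have hne : i ≠ ⟨y, he hy⟩ := fun h => hi (by rw [h]; exact hy)
    have := (cellBasis hT h4).coord_apply_ne hne
    rw [cellBasis_apply] at this
    simp [this]
  have h2 := h hx
  simpa using h2

lemma mem_simplexSet_iff {e : Finset E3} (he : e ⊆ T) {x : E3} :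
    x ∈ simplexSet e ↔ (∀ i, 0 ≤ (cellBasis hT h4).coord i x) ∧
      ∀ i : T, (i : E3) ∉ e → (cellBasis hT h4).coord i x = 0 := by
  constructor
  · intro hx
    refine ⟨fun i => ?_, fun i hi =>
      coord_eq_zero_of_mem_affineSpan hT h4 he (convexHull_subset_affineSpan _ hx) hi⟩
    have : x ∈ simplexSet T := convexHull_mono (by exact_mod_cast he) hx
    rw [simplexSet_eq hT h4] at this
    exact this i
  · rintro ⟨h0, h1⟩
    have hx := (cellBasis hT h4).linear_combination_coord_eq_self x
    have hs := (cellBasis hT h4).sum_coord_apply_eq_one x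
    have hsub : ∀ f : T → ℝ, (∀ i : T, (i : E3) ∉ e → f i = 0) →
        ∑ i, f i = ∑ i ∈ Finset.univ.filter (fun i : T => (i : E3) ∈ e), f i := fun f hf => by
      rw [Finset.sum_filter]
      refine Finset.sum_congr rfl fun i _ => ?_
      split_ifs with h
      · rfl
      · exact hf i h
    rw [← hx]
    have hsub' : ∑ i, (cellBasis hT h4).coord i x • cellBasis hT h4 i =
        ∑ i ∈ Finset.univ.filter (fun i : T => (i : E3) ∈ e), (cellBasis hT h4).coord i x • cellBasis hT h4 i := by
      rw [Finset.sum_filter]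
      refine Finset.sum_congr rfl fun i _ => ?_
      split_ifs with h
      · rfl
      · rw [h1 i h, zero_smul]
    rw [hsub']
    refine (convex_convexHull ℝ _).sum_mem (fun i _ => h0 i) ?_ fun i hi => ?_
    · rw [← hsub _ h1, hs]
    · exact subset_convexHull ℝ _ (Finset.mem_filter.1 hi).2

/-- A point of a simplex that lies on none of its facets. -/
def IsRelInterior (F : Finset E3) (m : E3) : Prop :=
  m ∈ simplexSet F ∧ ∀ v ∈ F, m ∉ simplexSet (F.erase v)

lemma isRelInterior_iff {F : Finset E3} (hF : F ⊆ T) {m : E3} :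
    IsRelInterior F m ↔ (∀ i : T, (i : E3) ∈ F → 0 < (cellBasis hT h4).coord i m) ∧
      ∀ i : T, (i : E3) ∉ F → (cellBasis hT h4).coord i m = 0 := by
  constructor
  · rintro ⟨hm, hv⟩
    have h := (mem_simplexSet_iff hT h4 hF).1 hm
    refine ⟨fun i hi => lt_of_le_of_ne (h.1 i) fun h0 => ?_, h.2⟩
    refine hv i hi ((mem_simplexSet_iff hT h4 ((Finset.erase_subset _ _).trans hF)).2
      ⟨h.1, fun j hj => ?_⟩)
    by_cases hji : j = i
    · rw [hji, ← h0]
    · exact h.2 j fun hjF => hj (Finset.mem_erase.2 ⟨fun h => hji (Subtype.ext h), hjF⟩)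
  · rintro ⟨h1, h2⟩
    refine ⟨(mem_simplexSet_iff hT h4 hF).2 ⟨fun i => ?_, h2⟩, fun v hv hm => ?_⟩
    · by_cases hi : (i : E3) ∈ F
      · exact (h1 i hi).le
      · exact (h2 i hi).ge
    · have := ((mem_simplexSet_iff hT h4 ((Finset.erase_subset _ _).trans hF)).1 hm).2
        ⟨v, hF hv⟩ (by simp)
      exact (h1 ⟨v, hF hv⟩ hv).ne' this

lemma coord_centroid {F : Finset E3} (hF : F ⊆ T) (hne : F.Nonempty) {i : T} (hi : (i : E3) ∈ F) :
    0 < (cellBasis hT h4).coord i (F.centroid ℝ id) := by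
  have hcard : (0 : ℝ) < F.card := by exact_mod_cast hne.card_pos
  rw [Finset.centroid_def, Finset.map_affineCombination _ _ _
    (F.sum_centroidWeights_eq_one_of_nonempty ℝ hne),
    Finset.affineCombination_eq_linear_combination _ _ _
    (F.sum_centroidWeights_eq_one_of_nonempty ℝ hne), Finset.sum_eq_single (i : E3)]
  · have : (cellBasis hT h4).coord i (i : E3) = 1 := (cellBasis hT h4).coord_apply_eq i
    simp only [Finset.centroidWeights_apply, Function.comp_apply, id, this, smul_eq_mul, mul_one]
    positivity
  · intro j hj hji
    have : (cellBasis hT h4).coord i j = 0 :=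
      (cellBasis hT h4).coord_apply_ne (j := ⟨j, hF hj⟩) fun h => hji (by rw [h])
    simp [this]
  · exact fun h => absurd hi h

/-- The centroid has positive coordinates at all vertices of F, so any step towards it leaves the
facets of F. -/
lemma isRelInterior_lineMap (hT : AffineIndependent ℝ (fun x : T => (x : E3))) (h4 : T.card = 4)
    {F : Finset E3} (hF : F ⊆ T) (hne : F.Nonempty) {x : E3}
    (hx : x ∈ simplexSet F) {t : ℝ} (ht : 0 < t) (ht1 : t ≤ 1) :
    IsRelInterior F (AffineMap.lineMap x (F.centroid ℝ id) t) := by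
  rw [isRelInterior_iff hT h4 hF]
  have h := (mem_simplexSet_iff hT h4 hF).1 hx
  have hl : ∀ i, (cellBasis hT h4).coord i (AffineMap.lineMap x (F.centroid ℝ id) t) =
      (1 - t) * (cellBasis hT h4).coord i x + t * (cellBasis hT h4).coord i (F.centroid ℝ id) := by
    intro i
    rw [AffineMap.apply_lineMap, AffineMap.lineMap_apply_ring]
  refine ⟨fun i hi => ?_, fun i hi => ?_⟩
  · rw [hl]
    have := mul_pos ht (coord_centroid hT h4 hF hne hi)
    have := mul_nonneg (sub_nonneg.2 ht1) (h.1 i)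
    linarith
  · rw [hl, h.2 i hi, coord_eq_zero_of_mem_affineSpan hT h4 hF (centroid_mem_affineSpan hne) hi]
    ring

lemma isRelInterior_centroid (hT : AffineIndependent ℝ (fun x : T => (x : E3))) (h4 : T.card = 4)
    {F : Finset E3} (hF : F ⊆ T) (hne : F.Nonempty) :
    IsRelInterior F (F.centroid ℝ id) := by
  have := isRelInterior_lineMap hT h4 hF hne (x := F.centroid ℝ id)
    (Finset.centroid_mem_convexHull F hne) one_pos le_rfl
  simpa using this

lemma exists_eq_insert_of_card {F : Finset E3} (hF : F ⊆ T) (h3 : F.card + 1 = T.card) :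
    ∃ d, d ∉ F ∧ T = insert d F := by
  obtain ⟨d, hd⟩ := Finset.card_eq_one.1 (by
    rw [Finset.card_sdiff_of_subset hF]; omega : (T \ F).card = 1)
  have hd' : d ∈ T \ F := by rw [hd]; simp
  refine ⟨d, (Finset.mem_sdiff.1 hd').2, ?_⟩
  rw [← Finset.sdiff_union_of_subset hF, hd]
  rfl

lemma normal_facts (hT : AffineIndependent ℝ (fun x : T => (x : E3)))
    {F : Finset E3} (hF : F ⊆ T) (hne : F.Nonempty) (h3 : F.card + 1 = T.card) :
    outwardNormal T F ⬝ᵥ outwardNormal T F = 1 ∧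
      ∀ d ∈ T, d ∉ F → ∀ b ∈ F, 0 < outwardNormal T F ⬝ᵥ (b - d).ofLp := by
  obtain ⟨a, ha, rfl⟩ := exists_eq_insert_of_card hF h3
  obtain ⟨h1, h2⟩ := outwardNormal_facts ha hne hT
  refine ⟨h1, fun d hd hdF b hb => ?_⟩
  rcases Finset.mem_insert.1 hd with rfl | h
  · exact h2 b hb
  · exact absurd h hdF

lemma sub_mem_vectorSpan {F : Finset E3} {x y : E3} (hx : x ∈ simplexSet F)
    (hy : y ∈ simplexSet F) : x - y ∈ vectorSpan ℝ (F : Set E3) := by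
  rw [← direction_affineSpan]
  exact AffineSubspace.vsub_mem_direction (convexHull_subset_affineSpan _ hx)
    (convexHull_subset_affineSpan _ hy)

/-- The height over a facet is a positive multiple of the barycentric coordinate of the opposite
vertex. -/
lemma exists_normal_dot_sub_eq {F : Finset E3} (hF : F ⊆ T) (h3 : F.card = 3) {d : T}
    (hd : (d : E3) ∉ F) : ∃ h : ℝ, 0 < h ∧ ∀ y ∈ simplexSet F, ∀ x : E3,
      outwardNormal T F ⬝ᵥ (x - y).ofLp = -(h * (cellBasis hT h4).coord d x) := by
  have hne : F.Nonempty := Finset.card_pos.1 (by omega)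
  obtain ⟨b, hb⟩ := hne
  obtain ⟨-, hpos⟩ := normal_facts hT hF ⟨b, hb⟩ (by omega)
  refine ⟨outwardNormal T F ⬝ᵥ (b - (d : E3)).ofLp, hpos d d.2 hd b hb, fun y hy x => ?_⟩
  have hT' : ∀ i : T, i ≠ d → (i : E3) ∈ F := by
    intro i hi
    obtain ⟨a, ha, hTa⟩ := exists_eq_insert_of_card hF (by omega)
    have h1 : (d : E3) = a := by
      exact (Finset.mem_insert.1 (hTa ▸ d.2 : (d : E3) ∈ insert a F)).resolve_right hd
    have h2 : (i : E3) ∈ insert a F := hTa ▸ i.2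
    exact (Finset.mem_insert.1 h2).resolve_left fun h => hi (Subtype.ext (h.trans h1.symm))
  -- Pairing the barycentric expansion with the normal kills the terms of the vertices of F; only
  -- the opposite vertex remains.
  have hx : x - y = ∑ i, (cellBasis hT h4).coord i x • ((i : E3) - y) := by
    simp only [smul_sub, Finset.sum_sub_distrib, ← Finset.sum_smul]
    rw [(cellBasis hT h4).sum_coord_apply_eq_one, one_smul]
    congr 1
    exact ((cellBasis hT h4).linear_combination_coord_eq_self x).symm
  rw [hx, WithLp.ofLp_sum, dotProduct_sum, Finset.sum_eq_single d]
  · have h1 : (d : E3) - y = -(b - (d : E3)) + (b - y) := by abel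
    rw [WithLp.ofLp_smul, dotProduct_smul, h1, WithLp.ofLp_add, WithLp.ofLp_neg, dotProduct_add,
      dotProduct_neg, outwardNormal_dot (sub_mem_vectorSpan (subset_convexHull ℝ _ hb) hy),
      add_zero, smul_eq_mul]
    ring
  · intro i _ hi
    rw [WithLp.ofLp_smul, dotProduct_smul,
      outwardNormal_dot (sub_mem_vectorSpan (subset_convexHull ℝ _ (hT' i hi)) hy), smul_zero]
  · simp

/-- Near a relative interior point of a facet, the tetrahedron is a half space. -/
lemma eventually_mem_of_normal_nonpos (hT : AffineIndependent ℝ (fun x : T => (x : E3))) (h4 : T.card = 4)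
    {F : Finset E3} (hF : F ⊆ T) (h3 : F.card = 3) {m : E3}
    (hm : IsRelInterior F m) :
    ∀ᶠ x in 𝓝 m, outwardNormal T F ⬝ᵥ (x - m).ofLp ≤ 0 → x ∈ simplexSet T := by
  obtain ⟨h1, -⟩ := (isRelInterior_iff hT h4 hF).1 hm
  -- The coordinates at the vertices of F stay positive near m. Only the coordinate of the opposite
  -- vertex can change sign, and the normal controls it.
  have hev : ∀ᶠ x in 𝓝 m, ∀ i : T, (i : E3) ∈ F → 0 < (cellBasis hT h4).coord i x := by
    rw [Filter.eventually_all]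
    intro i
    by_cases hi : (i : E3) ∈ F
    · have hc : Continuous ((cellBasis hT h4).coord i) :=
        continuous_barycentric_coord (cellBasis hT h4) i
      filter_upwards [hc.continuousAt.eventually (lt_mem_nhds (h1 i hi))] with x hx _ using hx
    · exact Eventually.of_forall fun x h => absurd h hi
  filter_upwards [hev] with x hx hn
  rw [simplexSet_eq hT h4]
  intro i
  by_cases hi : (i : E3) ∈ F
  · exact (hx i hi).le
  · obtain ⟨h, hpos, heq⟩ := exists_normal_dot_sub_eq hT h4 hF h3 hi
    rw [heq m hm.1 x] at hn
    by_contra hneg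
    have := mul_neg_of_pos_of_neg hpos (not_le.1 hneg)
    linarith

/-- Both vectors lie in the orthogonal complement of a plane, which is a line. -/
lemma unit_normals_eq_or_neg {F : Finset E3} (hF : AffineIndependent ℝ (fun x : F => (x : E3)))
    (h3 : F.card = 3) {n n' : Vec} (hn : n ⬝ᵥ n = 1) (hn' : n' ⬝ᵥ n' = 1)
    (h : ∀ w ∈ vectorSpan ℝ (F : Set E3), n ⬝ᵥ w.ofLp = 0)
    (h' : ∀ w ∈ vectorSpan ℝ (F : Set E3), n' ⬝ᵥ w.ofLp = 0) : n' = n ∨ n' = -n := by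
  set K := vectorSpan ℝ (F : Set E3) with hK
  have hfr : Module.finrank ℝ K = 2 := by
    have := hF.finrank_vectorSpan (n := 2) (by simp [h3])
    rwa [Subtype.range_coe_subtype] at this
  have hfr' : Module.finrank ℝ Kᗮ = 1 := by
    have := K.finrank_add_finrank_orthogonal
    rw [hfr, finrank_euclideanSpace_fin] at this
    omega
  have hmem : ∀ n : Vec, (∀ w ∈ K, n ⬝ᵥ w.ofLp = 0) → WithLp.toLp 2 n ∈ Kᗮ := fun n h => by
    rw [Submodule.mem_orthogonal']
    intro u hu
    rw [inner_eq_dot]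
    exact h u hu
  have hne : (⟨WithLp.toLp 2 n, hmem n h⟩ : Kᗮ) ≠ 0 := by
    intro h0
    have h1 : WithLp.toLp 2 n = (0 : E3) := congrArg Subtype.val h0
    have h2 : n = 0 := congrArg WithLp.ofLp h1
    rw [h2] at hn
    simp at hn
  obtain ⟨c, hc⟩ := exists_smul_eq_of_finrank_eq_one hfr' hne ⟨WithLp.toLp 2 n', hmem n' h'⟩
  have hc' : n' = c • n := (congrArg (fun z : Kᗮ => (z : E3).ofLp) hc).symm
  rw [hc'] at hn' ⊢
  rw [smul_dotProduct, dotProduct_smul, hn] at hn'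
  have : c = 1 ∨ c = -1 := mul_self_eq_one_iff.1 (by simpa using hn')
  rcases this with rfl | rfl
  · left; simp
  · right; simp

end Tetra

/-! ### Geometry of the mesh -/

lemma isCompact_simplexSet (T : Finset E3) : IsCompact (simplexSet T) :=
  T.finite_toSet.isCompact_convexHull ℝ

lemma isClosed_simplexSet (T : Finset E3) : IsClosed (simplexSet T) :=
  (isCompact_simplexSet T).isClosed

lemma simplexSet_mono {S T : Finset E3} (h : S ⊆ T) : simplexSet S ⊆ simplexSet T :=
  convexHull_mono (by exact_mod_cast h)

/-- Going down from x in the graph coordinates yields points strictly below the graph, near which Ω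
is absent. So x is a limit of exterior points: the domain has no slits, and a boundary face cannot
have cells on both sides. -/
lemma notMem_interior_closure_of_mem_frontier {Ω : Set E3} (hΩ : IsOpen Ω)
    (hL : HasLipschitzBoundary Ω) {x : E3} (hx : x ∈ frontier Ω) : x ∉ interior (closure Ω) := by
  intro hint
  obtain ⟨e, φ, C, U, hφ, hU, hxU, hgraph⟩ := hL x hx
  have hxΩ : x ∉ Ω := by
    rw [hΩ.frontier_eq] at hx
    exact hx.2
  have hle : e x 2 ≤ φ (e x 0, e x 1) := not_lt.1 fun h => hxΩ ((hgraph x hxU).2 h)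
  let y : ℝ → E3 := fun t => e.symm (e x - t • EuclideanSpace.single 2 1)
  have hy0 : y 0 = x := by simp [y]
  have hyc : Continuous y := by
    refine e.symm.continuous.comp ?_
    fun_prop
  have hev : ∀ᶠ t in 𝓝[>] (0 : ℝ), y t ∈ closure Ω ∧ y t ∈ U := by
    have h1 : Tendsto y (𝓝[>] 0) (𝓝 x) := by
      have := hyc.tendsto 0
      rw [hy0] at this
      exact this.mono_left nhdsWithin_le_nhds
    have h2 : closure Ω ∩ U ∈ 𝓝 x := inter_mem (mem_interior_iff_mem_nhds.1 hint) (hU.mem_nhds hxU)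
    exact h1.eventually h2
  obtain ⟨t, ⟨ht1, ht2⟩, ht0⟩ := (hev.and self_mem_nhdsWithin).exists
  have hV : IsOpen (U ∩ {z | e z 2 < φ (e z 0, e z 1)}) := by
    have he : Continuous e := e.continuous
    refine hU.inter (isOpen_lt ?_ (hφ.continuous.comp ?_)) <;> fun_prop
  have hyV : y t ∈ U ∩ {z | e z 2 < φ (e z 0, e z 1)} := by
    refine ⟨ht2, ?_⟩
    have ht : (0 : ℝ) < t := ht0
    simp only [Set.mem_ofPred_eq, y, AffineIsometryEquiv.apply_symm_apply, PiLp.sub_apply,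
      PiLp.smul_apply, smul_eq_mul]
    simp
    linarith
  obtain ⟨z, hz, hzΩ⟩ := mem_closure_iff.1 ht1 _ hV hyV
  have h3 := (hgraph z hz.1).1 hzΩ
  exact absurd hz.2 (not_lt.2 h3.le)

namespace SimplicialMesh

variable {Ω : Set E3} (M : SimplicialMesh Ω)

lemma mem_cells {T : Finset E3} : T ∈ M.cells ↔ T ∈ M.complex.faces ∧ T.card = 4 := by
  simp [cells]

lemma mem_faces {F : Finset E3} : F ∈ M.faces ↔ F ∈ M.complex.faces ∧ F.card = 3 := by
  simp [faces]

variable {M}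

lemma indep_cell {T : Finset E3} (hT : T ∈ M.cells) :
    AffineIndependent ℝ (fun x : T => (x : E3)) := M.complex.indep (M.mem_cells.1 hT).1

lemma indep_face {F : Finset E3} (hF : F ∈ M.faces) :
    AffineIndependent ℝ (fun x : F => (x : E3)) := M.complex.indep (M.mem_faces.1 hF).1

lemma face_nonempty {F : Finset E3} (hF : F ∈ M.faces) : F.Nonempty :=
  Finset.card_pos.1 (by rw [(M.mem_faces.1 hF).2]; norm_num)

lemma exists_cell_of_face {F : Finset E3} (hF : F ∈ M.complex.faces) :
    ∃ T ∈ M.cells, F ⊆ T := by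
  obtain ⟨T, hT, hFT, h4⟩ := M.pure F hF
  exact ⟨T, M.mem_cells.2 ⟨hT, h4⟩, hFT⟩

variable (M)

lemma closure_eq : closure Ω = ⋃ T ∈ M.cells, simplexSet T := by
  rw [← M.covers, Geometry.SimplicialComplex.space]
  refine Set.Subset.antisymm ?_ ?_
  · refine Set.iUnion₂_subset fun F hF => ?_
    obtain ⟨T, hT, hFT⟩ := exists_cell_of_face hF
    exact (simplexSet_mono hFT).trans (Set.subset_biUnion_of_mem (u := simplexSet) hT)
  · refine Set.iUnion₂_subset fun T hT => ?_
    exact Set.subset_biUnion_of_mem (u := simplexSet) (M.mem_cells.1 hT).1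

variable {M}

lemma simplexSet_subset_closure {T : Finset E3} (hT : T ∈ M.cells) :
    simplexSet T ⊆ closure Ω := by
  rw [M.closure_eq]
  exact Set.subset_biUnion_of_mem (u := simplexSet) hT

lemma face_subset_closure {F : Finset E3} (hF : F ∈ M.faces) : simplexSet F ⊆ closure Ω := by
  obtain ⟨T, hT, hFT⟩ := exists_cell_of_face (M.mem_faces.1 hF).1
  exact (simplexSet_mono hFT).trans (simplexSet_subset_closure hT)

lemma mem_simplexSet_inter {S T : Finset E3} (hS : S ∈ M.complex.faces) (hT : T ∈ M.complex.faces)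
    {x : E3} (hxS : x ∈ simplexSet S) (hxT : x ∈ simplexSet T) : x ∈ simplexSet (S ∩ T) := by
  have := M.complex.inter_subset_convexHull hS hT ⟨hxS, hxT⟩
  rwa [← Finset.coe_inter] at this

/-- By conformity m lies in the simplex on F ∩ T. If T missed a vertex v of F, then m would lie on
the facet `F.erase v`. -/
lemma subset_of_isRelInterior {F T : Finset E3} (hF : F ∈ M.complex.faces)
    (hT : T ∈ M.complex.faces) {m : E3} (hm : IsRelInterior F m) (hmT : m ∈ simplexSet T) :
    F ⊆ T := by
  intro v hv
  by_contra hvT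
  refine hm.2 v hv (simplexSet_mono ?_ (mem_simplexSet_inter hF hT hm.1 hmT))
  intro x hx
  obtain ⟨h1, h2⟩ := Finset.mem_inter.1 hx
  exact Finset.mem_erase.2 ⟨fun h => hvT (h ▸ h2), h1⟩

lemma cell_inter_eq {T T' F : Finset E3} (hT : T ∈ M.cells) (hT' : T' ∈ M.cells)
    (hF : F ∈ M.faces) (hne : T ≠ T') (h : F ⊆ T) (h' : F ⊆ T') : T ∩ T' = F := by
  have h4 := (M.mem_cells.1 hT).2
  have h4' := (M.mem_cells.1 hT').2
  have h3 := (M.mem_faces.1 hF).2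
  refine (Finset.eq_of_subset_of_card_le (Finset.subset_inter h h') ?_).symm
  rw [h3]
  by_contra! hc
  have h5 : T ∩ T' = T := Finset.eq_of_subset_of_card_le Finset.inter_subset_left (by omega)
  have h6 : T ∩ T' = T' := Finset.eq_of_subset_of_card_le Finset.inter_subset_right (by omega)
  exact hne (h5.symm.trans h6)

lemma exists_opposite {T F : Finset E3} (hT : T ∈ M.cells) (hF : F ∈ M.faces) (h : F ⊆ T) :
    ∃ d : T, (d : E3) ∉ F := by
  obtain ⟨d, hd, hTd⟩ := exists_eq_insert_of_card h
    (by rw [(M.mem_faces.1 hF).2, (M.mem_cells.1 hT).2])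
  exact ⟨⟨d, by rw [hTd]; exact Finset.mem_insert_self _ _⟩, hd⟩

lemma normal_unit {T F : Finset E3} (hT : T ∈ M.cells) (hF : F ∈ M.faces) (h : F ⊆ T) :
    outwardNormal T F ⬝ᵥ outwardNormal T F = 1 :=
  (normal_facts (indep_cell hT) h (face_nonempty hF)
    (by rw [(M.mem_faces.1 hF).2, (M.mem_cells.1 hT).2])).1

/-- The outward normals of two tetrahedra at a common face are opposite. -/
lemma normal_eq_neg {T T' F : Finset E3} (hT : T ∈ M.cells) (hT' : T' ∈ M.cells)
    (hF : F ∈ M.faces) (hne : T ≠ T') (h : F ⊆ T) (h' : F ⊆ T') :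
    outwardNormal T' F = -outwardNormal T F := by
  have h3 := (M.mem_faces.1 hF).2
  have h4 := (M.mem_cells.1 hT).2
  have h4' := (M.mem_cells.1 hT').2
  refine (unit_normals_eq_or_neg (indep_face hF) h3 (normal_unit hT hF h) (normal_unit hT' hF h')
    (fun w hw => outwardNormal_dot hw) (fun w hw => outwardNormal_dot hw)).resolve_left fun heq => ?_
  -- If the normals agreed, a short step from the centroid against the normal would stay in both
  -- tetrahedra, although these meet only in F.
  set m := F.centroid ℝ id with hm
  have hmF : IsRelInterior F m := isRelInterior_centroid (indep_cell hT) h4 h (face_nonempty hF)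
  have e1 := eventually_mem_of_normal_nonpos (indep_cell hT) h4 h h3 hmF
  have e2 := eventually_mem_of_normal_nonpos (indep_cell hT') h4' h' h3 hmF
  rw [heq] at e2
  have hlim : Tendsto (fun t : ℝ => m - t • WithLp.toLp 2 (outwardNormal T F)) (𝓝[>] 0) (𝓝 m) := by
    have hc : Continuous (fun t : ℝ => m - t • WithLp.toLp 2 (outwardNormal T F)) := by fun_prop
    have := hc.tendsto 0
    simp only [zero_smul, sub_zero] at this
    exact this.mono_left nhdsWithin_le_nhds
  obtain ⟨t, ⟨h1, h2⟩, ht⟩ := ((hlim.eventually (e1.and e2)).and self_mem_nhdsWithin).exists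
  have ht0 : (0 : ℝ) < t := ht
  have hdot : outwardNormal T F ⬝ᵥ (m - t • WithLp.toLp 2 (outwardNormal T F) - m).ofLp = -t := by
    have : m - t • WithLp.toLp 2 (outwardNormal T F) - m =
      (-t) • WithLp.toLp 2 (outwardNormal T F) := by rw [neg_smul]; abel
    rw [this, WithLp.ofLp_smul, dotProduct_smul, normal_unit hT hF h, smul_eq_mul, mul_one]
  have hmem := mem_simplexSet_inter (M.mem_cells.1 hT).1 (M.mem_cells.1 hT').1
    (h1 (by rw [hdot]; linarith)) (h2 (by rw [hdot]; linarith))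
  rw [cell_inter_eq hT hT' hF hne h h'] at hmem
  have h0 := outwardNormal_dot (S := T) (sub_mem_vectorSpan hmem hmF.1)
  rw [hdot] at h0
  linarith

/-- Near m the two tetrahedra are the two half spaces bounded by the plane of F. -/
lemma mem_interior_of_two_cells {T T' F : Finset E3} (hT : T ∈ M.cells) (hT' : T' ∈ M.cells)
    (hF : F ∈ M.faces) (hne : T ≠ T') (h : F ⊆ T) (h' : F ⊆ T') {m : E3}
    (hm : IsRelInterior F m) : m ∈ interior (closure Ω) := by
  rw [mem_interior_iff_mem_nhds]
  have h3 := (M.mem_faces.1 hF).2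
  filter_upwards [eventually_mem_of_normal_nonpos (indep_cell hT) (M.mem_cells.1 hT).2 h h3 hm,
    eventually_mem_of_normal_nonpos (indep_cell hT') (M.mem_cells.1 hT').2 h' h3 hm] with x h1 h2
  rw [normal_eq_neg hT hT' hF hne h h', neg_dotProduct] at h2
  rcases le_total (outwardNormal T F ⬝ᵥ (x - m).ofLp) 0 with hx | hx
  · exact simplexSet_subset_closure hT (h1 hx)
  · exact simplexSet_subset_closure hT' (h2 (by linarith))

lemma isRelInterior_face_centroid {F : Finset E3} (hF : F ∈ M.faces) :
    IsRelInterior F (F.centroid ℝ id) := by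
  obtain ⟨T, hT, hFT⟩ := exists_cell_of_face (M.mem_faces.1 hF).1
  exact isRelInterior_centroid (indep_cell hT) (M.mem_cells.1 hT).2 hFT (face_nonempty hF)

/-- A boundary face belongs to only one tetrahedron. -/
lemma cell_unique_of_boundary (hΩ : IsAdmissibleDomain Ω) {T T' : Finset E3} (hT : T ∈ M.cells)
    (hT' : T' ∈ M.cells) {F : M.faces} (hb : M.IsBoundaryFace F) (h : F.1 ⊆ T) (h' : F.1 ⊆ T') :
    T = T' := by
  by_contra hne
  have hm := isRelInterior_face_centroid F.2
  exact notMem_interior_closure_of_mem_frontier hΩ.isOpen hΩ.lipschitz (hb hm.1)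
    (mem_interior_of_two_cells hT hT' F.2 hne h h' hm)

/-- A face that is not a boundary face belongs to two tetrahedra. -/
lemma exists_other_cell (hΩ : IsOpen Ω) {T : Finset E3} (hT : T ∈ M.cells) {F : M.faces}
    (hb : ¬ M.IsBoundaryFace F) (h : F.1 ⊆ T) : ∃ T' ∈ M.cells, T' ≠ T ∧ F.1 ⊆ T' := by
  classical
  have h4 := (M.mem_cells.1 hT).2
  have h3 := (M.mem_faces.1 F.2).2
  obtain ⟨x, hxF, hxf⟩ := Set.not_subset.1 hb
  have hxΩ : x ∈ Ω := by
    by_contra hx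
    exact hxf (by rw [hΩ.frontier_eq]; exact ⟨face_subset_closure F.2 hxF, hx⟩)
  -- Some point of F lies in the open set Ω; a small shift towards the centroid makes it a relative
  -- interior point.
  obtain ⟨m, hm, hmΩ⟩ : ∃ m, IsRelInterior F.1 m ∧ m ∈ Ω := by
    have hc : Continuous fun t : ℝ => AffineMap.lineMap x (F.1.centroid ℝ id) t :=
      AffineMap.lineMap_continuous
    have h0 : Tendsto (fun t : ℝ => AffineMap.lineMap x (F.1.centroid ℝ id) t) (𝓝[>] 0) (𝓝 x) := by
      have := hc.tendsto 0
      simp only [AffineMap.lineMap_apply_zero] at this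
      exact this.mono_left nhdsWithin_le_nhds
    obtain ⟨t, ht, ht0, ht1⟩ := ((h0.eventually (hΩ.mem_nhds hxΩ)).and
      (Ioo_mem_nhdsGT (zero_lt_one (α := ℝ)))).exists
    exact ⟨_, isRelInterior_lineMap (indep_cell hT) h4 h (face_nonempty F.2) hxF ht0 ht1.le, ht⟩
  -- The cells missing m have a closed union, so a point just outside T along the outward normal
  -- lies in a cell through m. Such a cell contains F.
  have hK : IsClosed (⋃ T' ∈ M.cells.filter (fun T' => m ∉ simplexSet T'), simplexSet T') :=
    isClosed_biUnion_finset fun T' _ => isClosed_simplexSet T'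
  have hmK : m ∈ (⋃ T' ∈ M.cells.filter (fun T' => m ∉ simplexSet T'), simplexSet T')ᶜ := by
    simp only [Set.mem_compl_iff, Set.mem_iUnion, Finset.mem_filter, not_exists]
    exact fun T' hT' => hT'.2
  have hlim : Tendsto (fun t : ℝ => m + t • WithLp.toLp 2 (outwardNormal T F.1)) (𝓝[>] 0)
      (𝓝 m) := by
    have hc : Continuous (fun t : ℝ => m + t • WithLp.toLp 2 (outwardNormal T F.1)) := by fun_prop
    have := hc.tendsto 0
    simp only [zero_smul, add_zero] at this
    exact this.mono_left nhdsWithin_le_nhds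
  obtain ⟨t, ⟨h1, h2⟩, ht⟩ := ((hlim.eventually ((hΩ.eventually_mem hmΩ).and
    (hK.isOpen_compl.eventually_mem hmK))).and self_mem_nhdsWithin).exists
  have ht0 : (0 : ℝ) < t := ht
  set z := m + t • WithLp.toLp 2 (outwardNormal T F.1) with hz
  have hzc : z ∈ closure Ω := subset_closure h1
  rw [M.closure_eq] at hzc
  obtain ⟨T', hT', hzT'⟩ := Set.mem_iUnion₂.1 hzc
  have hmT' : m ∈ simplexSet T' := by
    by_contra hmT'
    exact h2 (Set.mem_iUnion₂.2 ⟨T', Finset.mem_filter.2 ⟨hT', hmT'⟩, hzT'⟩)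
  refine ⟨T', hT', ?_, subset_of_isRelInterior (M.mem_faces.1 F.2).1 (M.mem_cells.1 hT').1 hm hmT'⟩
  rintro rfl
  obtain ⟨d, hd⟩ := exists_opposite hT F.2 h
  obtain ⟨c, hc, heq⟩ := exists_normal_dot_sub_eq (indep_cell hT) h4 h h3 hd
  have h5 := heq m hm.1 z
  rw [hz, add_sub_cancel_left, WithLp.ofLp_smul, dotProduct_smul, normal_unit hT F.2 h,
    smul_eq_mul, mul_one] at h5
  rw [simplexSet_eq (indep_cell hT) h4] at hzT'
  have := mul_nonneg hc.le (hzT' d)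
  linarith

end SimplicialMesh

/-! ### Segments avoiding the edges of the mesh -/

lemma volume_affineSpan_eq_zero (s : Finset E3) (hs : s.card ≤ 3) :
    volume (affineSpan ℝ (s : Set E3) : Set E3) = 0 := by
  refine Measure.addHaar_affineSubspace _ _ fun h => ?_
  have h1 : Module.finrank ℝ (vectorSpan ℝ (s : Set E3)) = 3 := by
    rw [← direction_affineSpan, h, AffineSubspace.direction_top, finrank_top, finrank_euclideanSpace_fin]
  rcases s.eq_empty_or_nonempty with rfl | hne
  · rw [Finset.coe_empty, vectorSpan_empty, finrank_bot] at h1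
    omega
  · obtain ⟨n, hn⟩ : ∃ n, s.card = n + 1 := Nat.exists_eq_succ_of_ne_zero hne.card_pos.ne'
    have h2 := finrank_vectorSpan_image_finset_le ℝ (id : E3 → E3) s hn
    rw [Finset.image_id] at h2
    omega

/-- Lines can be avoided by segments with a given endpoint off the lines. -/
lemma exists_segment_disjoint (L : Finset (Finset E3)) (hL : ∀ e ∈ L, e.card = 2) {y : E3}
    (hy : ∀ e ∈ L, y ∉ affineSpan ℝ (e : Set E3)) {V : Set E3} (hV : IsOpen V) (hne : V.Nonempty) :
    ∃ z ∈ V, ∀ w ∈ segment ℝ y z, ∀ e ∈ L, w ∉ affineSpan ℝ (e : Set E3) := by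
  -- The span of y and an edge is at most a plane, hence null, and z is taken off all of these. If
  -- the segment met the line of e, then z would lie in that span.
  have h0 : volume (⋃ e ∈ L, (affineSpan ℝ ((insert y e : Finset E3) : Set E3) : Set E3)) = 0 := by
    refine (measure_biUnion_null_iff L.countable_toSet).2 fun e he => ?_
    exact volume_affineSpan_eq_zero _ ((Finset.card_insert_le _ _).trans (by rw [hL e he]))
  obtain ⟨z, hzV, hz⟩ : ∃ z ∈ V, z ∉ ⋃ e ∈ L,
      (affineSpan ℝ ((insert y e : Finset E3) : Set E3) : Set E3) := by
    by_contra! hsub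
    exact (hV.measure_pos volume hne).ne' (measure_mono_null hsub h0)
  refine ⟨z, hzV, fun w hw e he hwe => hz (Set.mem_iUnion₂.2 ⟨e, he, ?_⟩)⟩
  rw [segment_eq_image_lineMap] at hw
  obtain ⟨t, -, rfl⟩ := hw
  have hyS : y ∈ affineSpan ℝ ((insert y e : Finset E3) : Set E3) :=
    subset_affineSpan ℝ _ (by simp)
  have hwS : AffineMap.lineMap y z t ∈ affineSpan ℝ ((insert y e : Finset E3) : Set E3) :=
    affineSpan_mono ℝ (by simp) hwe
  have ht : t ≠ 0 := by
    rintro rfl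
    rw [AffineMap.lineMap_apply_zero] at hwe
    exact hy e he hwe
  have hz' : z = AffineMap.lineMap y (AffineMap.lineMap y z t) t⁻¹ := by
    simp only [AffineMap.lineMap_apply, vsub_eq_sub, vadd_eq_add, add_sub_cancel_right, smul_smul,
      inv_mul_cancel₀ ht, one_smul, sub_add_cancel]
  rw [hz']
  exact AffineMap.lineMap_mem _ hyS hwS

lemma exists_mem_notMem_lines (L : Finset (Finset E3)) (hL : ∀ e ∈ L, e.card = 2) {V : Set E3}
    (hV : IsOpen V) (hne : V.Nonempty) : ∃ y ∈ V, ∀ e ∈ L, y ∉ affineSpan ℝ (e : Set E3) := by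
  have h0 : volume (⋃ e ∈ L, (affineSpan ℝ (e : Set E3) : Set E3)) = 0 := by
    refine (measure_biUnion_null_iff L.countable_toSet).2 fun e he => ?_
    exact volume_affineSpan_eq_zero _ (by rw [hL e he]; norm_num)
  by_contra! hsub
  refine (hV.measure_pos volume hne).ne' (measure_mono_null (fun y hy => ?_) h0)
  obtain ⟨e, he, hye⟩ := hsub y hy
  exact Set.mem_iUnion₂.2 ⟨e, he, hye⟩

lemma nonempty_interior_inter {T : Finset E3} (hT : AffineIndependent ℝ (fun x : T => (x : E3)))
    (h4 : T.card = 4) {x : E3} (hx : x ∈ simplexSet T) {V : Set E3} (hV : V ∈ 𝓝 x) :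
    (interior (simplexSet T) ∩ V).Nonempty := by
  have hint : (interior (simplexSet T)).Nonempty := by
    refine ⟨T.centroid ℝ id, ?_⟩
    rw [interior_simplexSet hT h4]
    exact fun i => coord_centroid hT h4 subset_rfl (Finset.card_pos.1 (by omega)) i.2
  have hcl : closure (interior (simplexSet T)) = closure (simplexSet T) :=
    (convex_convexHull ℝ (T : Set E3)).closure_interior_eq_closure_of_nonempty_interior hint
  have hx' : x ∈ closure (interior (simplexSet T)) := by rw [hcl]; exact subset_closure hx
  rw [Set.inter_comm]
  exact mem_closure_iff_nhds.1 hx' V hV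

namespace SimplicialMesh

variable {Ω : Set E3} (M : SimplicialMesh Ω)

/-- The edges of the tetrahedra of the mesh. -/
def edges : Finset (Finset E3) := M.cells.biUnion fun T => T.powersetCard 2

lemma card_of_mem_edges {e : Finset E3} (he : e ∈ M.edges) : e.card = 2 := by
  obtain ⟨T, -, h⟩ := Finset.mem_biUnion.1 he
  exact (Finset.mem_powersetCard.1 h).2

variable {M}

lemma mem_edges {T e : Finset E3} (hT : T ∈ M.cells) (he : e ⊆ T) (h2 : e.card = 2) :
    e ∈ M.edges :=
  Finset.mem_biUnion.2 ⟨T, hT, Finset.mem_powersetCard.2 ⟨he, h2⟩⟩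

/-- Off the edges, a simplex with at least one point spanned by vertices of a tetrahedron has at
least three vertices. -/
lemma three_le_card {T s : Finset E3} (hT : T ∈ M.cells) (hs : s ⊆ T) {x : E3}
    (hx : x ∈ simplexSet s) (hxe : ∀ e ∈ M.edges, x ∉ affineSpan ℝ (e : Set E3)) :
    3 ≤ s.card := by
  by_contra! hc
  obtain ⟨e, hse, heT, h2⟩ := Finset.exists_subsuperset_card_eq hs (n := 2) (by omega)
    (by rw [(M.mem_cells.1 hT).2]; norm_num)
  exact hxe e (mem_edges hT heT h2)
    (convexHull_subset_affineSpan _ (simplexSet_mono hse hx))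

lemma isRelInterior_of_notMem_edges {T F : Finset E3} (hT : T ∈ M.cells) (hFT : F ⊆ T)
    (h3 : F.card = 3) {x : E3} (hx : x ∈ simplexSet F)
    (hxe : ∀ e ∈ M.edges, x ∉ affineSpan ℝ (e : Set E3)) : IsRelInterior F x := by
  refine ⟨hx, fun v hv hxv => ?_⟩
  have := three_le_card hT ((Finset.erase_subset v F).trans hFT) hxv hxe
  rw [Finset.card_erase_of_mem hv] at this
  omega

/-- Two cells meet in the simplex on their common vertices. Off the edges these are at least three,
and not four since the cells differ. -/
lemma exists_common_face {T T' : Finset E3} (hT : T ∈ M.cells) (hT' : T' ∈ M.cells) (hne : T ≠ T')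
    {x : E3} (hxT : x ∈ simplexSet T) (hxT' : x ∈ simplexSet T')
    (hxe : ∀ e ∈ M.edges, x ∉ affineSpan ℝ (e : Set E3)) :
    ∃ F ∈ M.faces, F ⊆ T ∧ F ⊆ T' ∧ x ∈ simplexSet F := by
  have hx := mem_simplexSet_inter (M.mem_cells.1 hT).1 (M.mem_cells.1 hT').1 hxT hxT'
  have h3 := three_le_card hT Finset.inter_subset_left hx hxe
  have h4 := (M.mem_cells.1 hT).2
  have h4' := (M.mem_cells.1 hT').2
  refine ⟨T ∩ T', M.mem_faces.2 ⟨?_, ?_⟩, Finset.inter_subset_left, Finset.inter_subset_right, hx⟩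
  · exact M.complex.down_closed (M.mem_cells.1 hT).1 Finset.inter_subset_left
      (Finset.card_pos.1 (by omega))
  · refine le_antisymm ?_ h3
    by_contra! hc
    have h5 : T ∩ T' = T := Finset.eq_of_subset_of_card_le Finset.inter_subset_left (by omega)
    have h6 : T ∩ T' = T' := Finset.eq_of_subset_of_card_le Finset.inter_subset_right (by omega)
    exact hne (h5.symm.trans h6)

/-- A function on the tetrahedra that does not jump across the interior faces is constant. -/
lemma eq_of_eq_across_faces (hΩ : IsAdmissibleDomain Ω) {α : Type*} (c : M.cells → α)
    (hc : ∀ (T T' : M.cells) (F : M.faces), T ≠ T' → F.1 ⊆ T.1 → F.1 ⊆ T'.1 →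
      ¬ M.IsBoundaryFace F → c T = c T') (T T' : M.cells) : c T = c T' := by
  classical
  by_contra hTT'
  -- If c took a second value, the cells with value `c T` and the remaining cells would give two
  -- closed sets covering the connected Ω, which must meet inside Ω.
  set A : Set E3 := ⋃ S ∈ Finset.univ.filter (fun S : M.cells => c S = c T), simplexSet S.1 with hA
  set B : Set E3 := ⋃ S ∈ Finset.univ.filter (fun S : M.cells => c S ≠ c T), simplexSet S.1 with hB
  have hAc : IsClosed A := isClosed_biUnion_finset fun S _ => isClosed_simplexSet S.1
  have hBc : IsClosed B := isClosed_biUnion_finset fun S _ => isClosed_simplexSet S.1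
  have hAm : ∀ {x}, x ∈ A ↔ ∃ S : M.cells, c S = c T ∧ x ∈ simplexSet S.1 := by
    intro x; simp [hA]
  have hBm : ∀ {x}, x ∈ B ↔ ∃ S : M.cells, c S ≠ c T ∧ x ∈ simplexSet S.1 := by
    intro x; simp [hB]
  have hcov : Ω ⊆ A ∪ B := by
    intro x hx
    have hx' := subset_closure hx
    rw [M.closure_eq] at hx'
    obtain ⟨S, hS, hxS⟩ := Set.mem_iUnion₂.1 hx'
    by_cases h : c ⟨S, hS⟩ = c T
    · exact Or.inl (hAm.2 ⟨_, h, hxS⟩)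
    · exact Or.inr (hBm.2 ⟨_, h, hxS⟩)
  have hmeet : ∀ S : M.cells, ∃ x ∈ Ω, x ∈ simplexSet S.1 := by
    intro S
    have h4 := (M.mem_cells.1 S.2).2
    have hcS := Finset.centroid_mem_convexHull (R := ℝ) S.1 (Finset.card_pos.1 (by omega))
    obtain ⟨y, hy, -⟩ := nonempty_interior_inter (indep_cell S.2) h4 hcS univ_mem
    obtain ⟨x, hx, hxΩ⟩ := mem_closure_iff.1
      (simplexSet_subset_closure S.2 (interior_subset hy)) _ isOpen_interior hy
    exact ⟨x, hxΩ, interior_subset hx⟩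
  have hconn : IsPreconnected Ω := by
    have h1 := hΩ.simplyConnected
    have : IsPathConnected Ω := h1.isPathConnected
    exact this.isConnected.isPreconnected
  obtain ⟨x, hxΩ, hxA, hxB⟩ := isPreconnected_closed_iff.1 hconn A B hAc hBc hcov
    (let ⟨x, h1, h2⟩ := hmeet T; ⟨x, h1, hAm.2 ⟨T, rfl, h2⟩⟩)
    (let ⟨x, h1, h2⟩ := hmeet T'; ⟨x, h1, hBm.2 ⟨T', Ne.symm hTT', h2⟩⟩)
  obtain ⟨SA, hSA, hxSA⟩ := hAm.1 hxA
  obtain ⟨SB, hSB, hxSB⟩ := hBm.1 hxB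
  -- The meeting point may lie on an edge or be a vertex. A nearby segment that avoids all edges and
  -- joins interior points of two such cells meets both sets again, now in a common face.
  obtain ⟨ε, hε, hball⟩ := Metric.isOpen_iff.1 hΩ.isOpen x hxΩ
  have hcard : ∀ e ∈ M.edges, e.card = 2 := fun e he => M.card_of_mem_edges he
  obtain ⟨y, ⟨hy1, hy2⟩, hye⟩ := exists_mem_notMem_lines M.edges hcard
    (isOpen_interior.inter Metric.isOpen_ball)
    (nonempty_interior_inter (indep_cell SA.2) (M.mem_cells.1 SA.2).2 hxSA
      (Metric.ball_mem_nhds x hε))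
  obtain ⟨z, ⟨hz1, hz2⟩, hze⟩ := exists_segment_disjoint M.edges hcard hye
    (isOpen_interior.inter Metric.isOpen_ball)
    (nonempty_interior_inter (indep_cell SB.2) (M.mem_cells.1 SB.2).2 hxSB
      (Metric.ball_mem_nhds x hε))
  have hseg : segment ℝ y z ⊆ Ω := ((convex_ball x ε).segment_subset hy2 hz2).trans hball
  obtain ⟨w, hw, hwA, hwB⟩ := isPreconnected_closed_iff.1 (convex_segment y z).isPreconnected A B
    hAc hBc (hseg.trans hcov)
    ⟨y, left_mem_segment ℝ y z, hAm.2 ⟨SA, hSA, interior_subset hy1⟩⟩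
    ⟨z, right_mem_segment ℝ y z, hBm.2 ⟨SB, hSB, interior_subset hz1⟩⟩
  obtain ⟨S, hS, hwS⟩ := hAm.1 hwA
  obtain ⟨S', hS', hwS'⟩ := hBm.1 hwB
  have hne : S ≠ S' := fun h => hS' (h ▸ hS)
  obtain ⟨F, hF, hFS, hFS', hwF⟩ := exists_common_face S.2 S'.2 (fun h => hne (Subtype.ext h))
    hwS hwS' (hze w hw)
  refine hS' (((hc S S' ⟨F, hF⟩ hne hFS hFS' fun hb => ?_).symm).trans hS)
  have := hb hwF
  rw [hΩ.isOpen.frontier_eq] at this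
  exact this.2 (hseg hw)

/-- The boundary is covered by the boundary faces. -/
lemma frontier_subset (hΩ : IsAdmissibleDomain Ω) {x : E3} (hx : x ∈ frontier Ω) :
    ∃ F : M.faces, M.IsBoundaryFace F ∧ x ∈ simplexSet F.1 := by
  classical
  set U : Set E3 := ⋃ F ∈ Finset.univ.filter (fun F : M.faces => M.IsBoundaryFace F),
    simplexSet F.1 with hU
  have hUc : IsClosed U := isClosed_biUnion_finset fun F _ => isClosed_simplexSet F.1
  have hUm : ∀ {x}, x ∈ U ↔ ∃ F : M.faces, M.IsBoundaryFace F ∧ x ∈ simplexSet F.1 := by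
    intro x; simp [hU]
  rw [← hUm]
  by_contra hxU
  -- A ball around x avoids the boundary faces and, by Lipschitz regularity, contains exterior
  -- points. A segment off the edges leads from inside a cell to the exterior; yet each of its
  -- points in `closure Ω` is interior to it, lying inside a cell or in the relative interior of a
  -- face with two cells. This contradicts connectedness of the segment.
  obtain ⟨ε, hε, hball⟩ := Metric.isOpen_iff.1 hUc.isOpen_compl x hxU
  have hcard : ∀ e ∈ M.edges, e.card = 2 := fun e he => M.card_of_mem_edges he
  have hxc : x ∈ closure Ω := frontier_subset_closure hx
  rw [M.closure_eq] at hxc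
  obtain ⟨T, hT, hxT⟩ := Set.mem_iUnion₂.1 hxc
  obtain ⟨y, ⟨hy1, hy2⟩, hye⟩ := exists_mem_notMem_lines M.edges hcard
    (isOpen_interior.inter Metric.isOpen_ball)
    (nonempty_interior_inter (indep_cell hT) (M.mem_cells.1 hT).2 hxT (Metric.ball_mem_nhds x hε))
  have hext : (Metric.ball x ε ∩ (closure Ω)ᶜ).Nonempty := by
    by_contra hemp
    refine notMem_interior_closure_of_mem_frontier hΩ.isOpen hΩ.lipschitz hx
      (mem_interior_iff_mem_nhds.2 (mem_of_superset (Metric.ball_mem_nhds x hε) fun z hz => ?_))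
    by_contra hzc
    exact hemp ⟨z, hz, hzc⟩
  obtain ⟨z, ⟨hz1, hz2⟩, hze⟩ := exists_segment_disjoint M.edges hcard hye
    (Metric.isOpen_ball.inter isClosed_closure.isOpen_compl) hext
  have hseg : segment ℝ y z ⊆ Metric.ball x ε := (convex_ball x ε).segment_subset hy2 hz1
  have hint : segment ℝ y z ∩ closure Ω ⊆ interior (closure Ω) := by
    rintro w ⟨hw, hwc⟩
    rw [M.closure_eq] at hwc
    obtain ⟨S, hS, hwS⟩ := Set.mem_iUnion₂.1 hwc
    have h4 := (M.mem_cells.1 hS).2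
    by_cases hwi : w ∈ interior (simplexSet S)
    · exact interior_mono (simplexSet_subset_closure hS) hwi
    · rw [interior_simplexSet (indep_cell hS) h4, Set.mem_ofPred_eq, not_forall] at hwi
      obtain ⟨i, hi⟩ := hwi
      have hwS2 := hwS
      rw [simplexSet_eq (indep_cell hS) h4] at hwS2
      have hi0 : (cellBasis (indep_cell hS) h4).coord i w = 0 :=
        le_antisymm (not_lt.1 hi) (hwS2 i)
      have h3 : (S.erase i.1).card = 3 := by rw [Finset.card_erase_of_mem i.2, h4]
      have hwF : w ∈ simplexSet (S.erase i.1) := by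
        refine (mem_simplexSet_iff (indep_cell hS) h4 (Finset.erase_subset _ _)).2 ⟨hwS2, ?_⟩
        intro j hj
        have : j = i := by
          by_contra hne
          exact hj (Finset.mem_erase.2 ⟨fun h => hne (Subtype.ext h), j.2⟩)
        rw [this, hi0]
      have hF : S.erase i.1 ∈ M.faces := M.mem_faces.2
        ⟨M.complex.down_closed (M.mem_cells.1 hS).1 (Finset.erase_subset _ _)
          (Finset.card_pos.1 (by omega)), h3⟩
      by_cases hb : M.IsBoundaryFace ⟨_, hF⟩
      · exact absurd (hUm.2 ⟨_, hb, hwF⟩) (hball (hseg hw))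
      · obtain ⟨S', hS', hne, hFS'⟩ := exists_other_cell hΩ.isOpen hS hb (Finset.erase_subset _ _)
        exact mem_interior_of_two_cells hS hS' hF hne.symm (Finset.erase_subset _ _) hFS'
          (isRelInterior_of_notMem_edges hS (Finset.erase_subset _ _) h3 hwF (hze w hw))
  obtain ⟨w, hw, hw1, hw2⟩ := (convex_segment y z).isPreconnected (interior (closure Ω))
    (closure Ω)ᶜ isOpen_interior isClosed_closure.isOpen_compl
    (fun w hw => by
      by_cases hwc : w ∈ closure Ω
      · exact Or.inl (hint ⟨hw, hwc⟩)
      · exact Or.inr hwc)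
    ⟨y, left_mem_segment ℝ y z, interior_mono (simplexSet_subset_closure hT) hy1⟩
    ⟨z, right_mem_segment ℝ y z, hz2⟩
  exact hw2 (interior_subset hw1)

end SimplicialMesh

/-! ### Integration of polynomials over the cells and faces of the mesh -/

lemma integrable_simplex {n : ℕ} (v : Fin (n + 1) → E3) {f : E3 → ℝ} (hf : Continuous f) :
    Integrable f ((μHE[n] : Measure E3).restrict (convexHull ℝ (Set.range v))) := by
  rw [restrict_simplex_eq]
  refine Integrable.smul_measure ?_ ENNReal.ofReal_ne_top
  rw [integrable_map_measure hf.aestronglyMeasurable (continuous_simplexParam v).aemeasurable]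
  exact (hf.comp (continuous_simplexParam v)).continuousOn.integrableOn_compact
    (isCompact_refSimplex n)

lemma exists_enum_three {F : Finset E3} (h3 : F.card = 3) :
    ∃ a b c : E3, F = {a, b, c} ∧ Set.range ![a, b, c] = (F : Set E3) ∧
      a ≠ b ∧ a ≠ c ∧ b ≠ c := by
  obtain ⟨a, b, c, hab, hac, hbc, rfl⟩ := Finset.card_eq_three.1 h3
  refine ⟨a, b, c, rfl, ?_, hab, hac, hbc⟩
  rw [Matrix.range_cons, Matrix.range_cons, Matrix.range_cons, Matrix.range_empty]
  ext x
  simp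
  tauto

lemma faceMeasure_eq {F : Finset E3} {v : Fin 3 → E3} (hv : Set.range v = (F : Set E3)) :
    faceMeasure F = (μHE[2] : Measure E3).restrict (convexHull ℝ (Set.range v)) := by
  rw [faceMeasure, simplexSet, hv]

lemma integrable_faceMeasure {F : Finset E3} (h3 : F.card = 3) {f : E3 → ℝ} (hf : Continuous f) :
    Integrable f (faceMeasure F) := by
  obtain ⟨a, b, c, -, hv, -⟩ := exists_enum_three h3
  rw [faceMeasure_eq hv]
  exact integrable_simplex _ hf

lemma isFiniteMeasure_faceMeasure {F : Finset E3} (h3 : F.card = 3) :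
    IsFiniteMeasure (faceMeasure F) := by
  have := integrable_faceMeasure h3 (f := fun _ => (1 : ℝ)) continuous_const
  exact (integrable_const_iff.1 this).resolve_left one_ne_zero

lemma ae_mem_simplexSet (F : Finset E3) : ∀ᵐ x ∂(faceMeasure F), x ∈ simplexSet F :=
  ae_restrict_mem (isClosed_simplexSet F).measurableSet

lemma pval_add (p q : Poly3) (x : E3) : pval (p + q) x = pval p x + pval q x := by simp [pval]
lemma pval_mul (p q : Poly3) (x : E3) : pval (p * q) x = pval p x * pval q x := by simp [pval]
lemma pval_sub (p q : Poly3) (x : E3) : pval (p - q) x = pval p x - pval q x := by simp [pval]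
lemma pval_zero (x : E3) : pval 0 x = 0 := by simp [pval]
lemma pval_C (c : ℝ) (x : E3) : pval (MvPolynomial.C c) x = c := by simp [pval]
lemma pval_smul (c : ℝ) (p : Poly3) (x : E3) : pval (c • p) x = c * pval p x := by simp [pval]

namespace SimplicialMesh

variable {Ω : Set E3} {M : SimplicialMesh Ω}

/-- Integration of polynomials over a face. -/
def faceInt (F : M.faces) : Poly3 →ₗ[ℝ] ℝ where
  toFun p := ∫ x, pval p x ∂(faceMeasure F.1)
  map_add' p q := by
    simp only [pval_add]
    exact integral_add (integrable_faceMeasure (M.mem_faces.1 F.2).2 (continuous_pval p))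
      (integrable_faceMeasure (M.mem_faces.1 F.2).2 (continuous_pval q))
  map_smul' c p := by
    simp only [pval_smul]
    exact integral_const_mul c _

lemma faceInt_apply (F : M.faces) (p : Poly3) :
    faceInt F p = ∫ x, pval p x ∂(faceMeasure F.1) := rfl

lemma integrable_cell (T : Finset E3) {f : E3 → ℝ} (hf : Continuous f) :
    Integrable f (volume.restrict (simplexSet T)) :=
  hf.continuousOn.integrableOn_compact (isCompact_simplexSet T)

/-- Integration of polynomials over a tetrahedron. -/
def cellInt (T : M.cells) : Poly3 →ₗ[ℝ] ℝ where
  toFun p := ∫ x in simplexSet T.1, pval p x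
  map_add' p q := by
    simp only [pval_add]
    exact integral_add (integrable_cell T.1 (continuous_pval p))
      (integrable_cell T.1 (continuous_pval q))
  map_smul' c p := by
    simp only [pval_smul]
    exact integral_const_mul c _

lemma cellInt_apply (T : M.cells) (p : Poly3) :
    cellInt T p = ∫ x in simplexSet T.1, pval p x := rfl

lemma affineIndependent_of_range {S : Finset E3} (hS : AffineIndependent ℝ (fun x : S => (x : E3)))
    {n : ℕ} {v : Fin n → E3} (hinj : Function.Injective v) (hv : Set.range v = (S : Set E3)) :
    AffineIndependent ℝ v := by
  have hmem : ∀ i, v i ∈ S := fun i => by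
    have : v i ∈ (S : Set E3) := hv ▸ ⟨i, rfl⟩
    exact this
  have := hS.comp_embedding ⟨fun i => (⟨v i, hmem i⟩ : S), fun i j h => hinj (congrArg Subtype.val h)⟩
  exact this

lemma injective_three {a b c : E3} (hab : a ≠ b) (hac : a ≠ c) (hbc : b ≠ c) :
    Function.Injective ![a, b, c] := by
  intro i j h
  fin_cases i <;> fin_cases j <;> simp_all

lemma faceInt_nonneg_eq_zero (F : M.faces) {p : Poly3} (h0 : ∀ x ∈ simplexSet F.1, 0 ≤ pval p x)
    (h : faceInt F p = 0) : ∀ x ∈ simplexSet F.1, pval p x = 0 := by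
  obtain ⟨a, b, c, -, hv, hab, hac, hbc⟩ := exists_enum_three (M.mem_faces.1 F.2).2
  have hJ := simplexJac_pos (affineIndependent_of_range (indep_face F.2)
    (injective_three hab hac hbc) hv)
  rw [faceInt_apply, faceMeasure_eq hv, integral_simplex] at h
  have himg : simplexSet F.1 = simplexParam ![a, b, c] '' refSimplex 2 := by
    rw [image_simplexParam, simplexSet, hv]
  have h1 := eq_zero_of_simplexInt_eq_zero (fun y hy => ?_) ((mul_eq_zero.1 h).resolve_left hJ.ne')
  · rw [himg]
    rintro _ ⟨y, -, rfl⟩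
    rw [← eval_pullback, h1, map_zero]
  · rw [eval_pullback]
    exact h0 _ (by rw [himg]; exact ⟨y, hy, rfl⟩)

lemma eq_zero_of_eqOn_cell (T : M.cells) {p : Poly3} (h : ∀ x ∈ simplexSet T.1, pval p x = 0) :
    p = 0 := by
  have hint : (interior (simplexSet T.1)).Nonempty := by
    have h4 := (M.mem_cells.1 T.2).2
    obtain ⟨y, hy, -⟩ := nonempty_interior_inter (indep_cell T.2) h4
      (Finset.centroid_mem_convexHull (R := ℝ) T.1 (Finset.card_pos.1 (by omega))) univ_mem
    exact ⟨y, hy⟩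
  obtain ⟨y, hy⟩ := hint
  have hopen : IsOpen ((WithLp.toLp 2 : Vec → E3) ⁻¹' interior (simplexSet T.1)) :=
    isOpen_interior.preimage (PiLp.continuous_toLp 2 _)
  obtain ⟨ε, hε, hball⟩ := Metric.isOpen_iff.1 hopen y.ofLp hy
  refine MvPolynomial.funext_set (fun i => Metric.ball (y i) ε) (fun i => ?_) fun x hx => ?_
  · rw [Real.ball_eq_Ioo]
    exact Set.Ioo_infinite (by linarith)
  · rw [map_zero]
    have hx' : x ∈ Metric.ball y.ofLp ε := by
      rw [ball_pi _ hε]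
      exact hx
    exact h (WithLp.toLp 2 x) (interior_subset (hball hx'))

lemma cellInt_nonneg_eq_zero (T : M.cells) {p : Poly3} (h0 : ∀ x, 0 ≤ pval p x)
    (h : cellInt T p = 0) : p = 0 := by
  have h1 := (setIntegral_eq_zero_iff_of_nonneg_ae (ae_of_all _ h0)
    (integrable_cell T.1 (continuous_pval p))).1 h
  have h2 : Set.EqOn (pval p) (fun _ => 0) (interior (simplexSet T.1)) :=
    Measure.eqOn_open_of_ae_eq (ae_restrict_of_ae_restrict_of_subset interior_subset h1)
      isOpen_interior (continuous_pval p).continuousOn continuousOn_const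
  refine eq_zero_of_eqOn_cell T fun x hx => ?_
  have hcl : x ∈ closure (interior (simplexSet T.1)) := by
    rw [mem_closure_iff_nhds]
    intro V hV
    rw [Set.inter_comm]
    exact nonempty_interior_inter (indep_cell T.2) (M.mem_cells.1 T.2).2 hx hV
  exact h2.closure (continuous_pval p) continuous_const hcl

lemma dirDeriv_add (w w' : E3) (p : Poly3) : dirDeriv (w + w') p = dirDeriv w p + dirDeriv w' p := by
  simp [dirDeriv, add_mul, Finset.sum_add_distrib]

lemma dirDeriv_smul (c : ℝ) (w : E3) (p : Poly3) : dirDeriv (c • w) p = c • dirDeriv w p := by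
  simp [dirDeriv, Finset.smul_sum, MvPolynomial.smul_eq_C_mul, mul_assoc]

open scoped Classical in
/-- The divergence theorem on a tetrahedron of the mesh. -/
lemma cellInt_dirDeriv (T : M.cells) (w : E3) (p : Poly3) :
    cellInt T (dirDeriv w p) =
      ∑ F : M.faces with F.1 ⊆ T.1, (outwardNormal T.1 F.1 ⬝ᵥ w.ofLp) * faceInt F p := by
  have h4 := (M.mem_cells.1 T.2).2
  have htop : w ∈ vectorSpan ℝ (T.1 : Set E3) := by
    have h := ((indep_cell T.2).affineSpan_eq_top_iff_card_eq_finrank_add_one).2 (by simp [h4])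
    rw [← direction_affineSpan]
    rw [Subtype.range_coe_subtype] at h
    have h' : affineSpan ℝ (T.1 : Set E3) = ⊤ := h
    rw [h', AffineSubspace.direction_top]
    trivial
  -- Both sides are linear in w and the differences of vertices span the space, so w may be taken
  -- along an edge.
  rw [vectorSpan] at htop
  induction htop using Submodule.span_induction with
  | mem w hw =>
    obtain ⟨b, hb, a, ha, rfl⟩ := Set.mem_vsub.1 hw
    rw [vsub_eq_sub]
    by_cases hab : a = b
    · subst hab
      simp [dirDeriv]
    have h2 : ((T.1.erase a).erase b).card = 2 := by
      rw [Finset.card_erase_of_mem (Finset.mem_erase.2 ⟨Ne.symm hab, hb⟩),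
        Finset.card_erase_of_mem ha, h4]
    obtain ⟨c, d, hcd, hcd'⟩ := Finset.card_eq_two.1 h2
    have ha' : T.1.erase a = {b, c, d} := by
      rw [← hcd', Finset.insert_erase (Finset.mem_erase.2 ⟨Ne.symm hab, hb⟩)]
    have hb' : T.1.erase b = {a, c, d} := by
      rw [← hcd', Finset.erase_right_comm, Finset.insert_erase (Finset.mem_erase.2 ⟨hab, ha⟩)]
    have hT' : T.1 = {a, b, c, d} := by rw [← ha', Finset.insert_erase ha]
    have hcT : c ∈ T.1.erase a ∧ c ∈ T.1.erase b := by rw [ha', hb']; simp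
    have hdT : d ∈ T.1.erase a ∧ d ∈ T.1.erase b := by rw [ha', hb']; simp
    have hface : ∀ v ∈ T.1, T.1.erase v ∈ M.faces := fun v hv => M.mem_faces.2
      ⟨M.complex.down_closed (M.mem_cells.1 T.2).1 (Finset.erase_subset _ _)
        (Finset.card_pos.1 (by rw [Finset.card_erase_of_mem hv, h4]; norm_num)),
        by rw [Finset.card_erase_of_mem hv, h4]⟩
    have rT : convexHull ℝ (Set.range ![a, b, c, d]) = simplexSet T.1 := by
      rw [simplexSet, hT', Matrix.range_cons, Matrix.range_cons, Matrix.range_cons,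
        Matrix.range_cons, Matrix.range_empty]
      congr 1; ext x; simp; tauto
    have rF : ∀ x y z : E3, convexHull ℝ (Set.range ![x, y, z]) = simplexSet {x, y, z} := by
      intro x y z
      rw [simplexSet, Matrix.range_cons, Matrix.range_cons, Matrix.range_cons, Matrix.range_empty]
      congr 1; ext x; simp; tauto
    have hvs : ∀ {F : Finset E3} {x y : E3}, x ∈ F → y ∈ F →
        outwardNormal T.1 F ⬝ᵥ (x - y).ofLp = 0 := fun hx hy =>
      outwardNormal_dot (sub_mem_vectorSpan (subset_convexHull ℝ _ hx) (subset_convexHull ℝ _ hy))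
    have fa := normal_facts (indep_cell T.2) (Finset.erase_subset a T.1)
      (face_nonempty (hface a ha)) (by rw [Finset.card_erase_of_mem ha, h4])
    have fb := normal_facts (indep_cell T.2) (Finset.erase_subset b T.1)
      (face_nonempty (hface b hb)) (by rw [Finset.card_erase_of_mem hb, h4])
    have hbE : b ∈ T.1.erase a := Finset.mem_erase.2 ⟨Ne.symm hab, hb⟩
    have haE : a ∈ T.1.erase b := Finset.mem_erase.2 ⟨hab, ha⟩
    have main := integral_dirDeriv_tetra fa.1 (hvs hcT.1 hbE) (hvs hdT.1 hbE)
      (fa.2 a ha (Finset.notMem_erase _ _) b hbE) fb.1 (hvs hcT.2 haE) (hvs hdT.2 haE)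
      (fb.2 b hb (Finset.notMem_erase _ _) a haE) p
    rw [rT, rF, rF, ← ha', ← hb'] at main
    rw [Finset.sum_eq_add ⟨T.1.erase a, hface a ha⟩ ⟨T.1.erase b, hface b hb⟩]
    · exact main
    · intro h
      have h' : T.1.erase a = T.1.erase b := congrArg Subtype.val h
      rw [← h'] at haE
      simp at haE
    -- Any other face contains both endpoints of the edge, so its normal is orthogonal to w.
    · intro F hF hne
      have hFT := (Finset.mem_filter.1 hF).2
      have h3 := (M.mem_faces.1 F.2).2
      have hin : ∀ v (hv : v ∈ T.1), F ≠ ⟨T.1.erase v, hface v hv⟩ → v ∈ F.1 := by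
        intro v hv hne
        by_contra hvF
        refine hne (Subtype.ext (Finset.eq_of_subset_of_card_le (fun x hx =>
          Finset.mem_erase.2 ⟨fun h => hvF (h ▸ hx), hFT hx⟩) ?_))
        change (T.1.erase v).card ≤ _
        rw [Finset.card_erase_of_mem hv, h4, h3]
      rw [hvs (hin b hb hne.2) (hin a ha hne.1), zero_mul]
    · exact fun h => (h (by simp [Finset.erase_subset])).elim
    · exact fun h => (h (by simp [Finset.erase_subset])).elim
  | zero => simp [dirDeriv]
  | add w w' _ _ h h' =>
    rw [dirDeriv_add, map_add, h, h', ← Finset.sum_add_distrib]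
    refine Finset.sum_congr rfl fun F _ => ?_
    rw [WithLp.ofLp_add, dotProduct_add, add_mul]
  | smul c w _ h =>
    rw [dirDeriv_smul, map_smul, h, Finset.smul_sum]
    refine Finset.sum_congr rfl fun F _ => ?_
    rw [WithLp.ofLp_smul, dotProduct_smul, smul_eq_mul, smul_eq_mul, mul_assoc]

open scoped Classical in
-- The normal of a third cell would be opposite to two vectors that are already opposite to each
-- other.
lemma cells_of_face {T T' : M.cells} {F : M.faces} (hne : T ≠ T') (h : F.1 ⊆ T.1)
    (h' : F.1 ⊆ T'.1) :
    (Finset.univ.filter fun S : M.cells => F.1 ⊆ S.1) = {T, T'} := by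
  ext S
  simp only [Finset.mem_filter, Finset.mem_univ, true_and, Finset.mem_insert, Finset.mem_singleton]
  constructor
  · intro hS
    by_contra! hc
    have e1 := normal_eq_neg T.2 T'.2 F.2 (fun h => hne (Subtype.ext h)) h h'
    have e2 := normal_eq_neg T.2 S.2 F.2 (fun h => hc.1 (Subtype.ext h.symm)) h hS
    have e3 := normal_eq_neg T'.2 S.2 F.2 (fun h => hc.2 (Subtype.ext h.symm)) h' hS
    have e4 := normal_unit S.2 F.2 hS
    rw [e1, neg_neg, ← neg_eq_iff_eq_neg.2 e2] at e3
    nth_rewrite 2 [e3] at e4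
    rw [dotProduct_neg, normal_unit S.2 F.2 hS] at e4
    norm_num at e4
  · rintro (rfl | rfl)
    · exact h
    · exact h'

open scoped Classical in
/-- Terms that are odd in the normal cancel over the interior faces. -/
lemma sum_odd_eq_zero (hΩ : IsAdmissibleDomain Ω) (G : M.faces → Vec → ℝ)
    (hodd : ∀ F n, G F (-n) = -G F n) (hb : ∀ F, M.IsBoundaryFace F → ∀ n, G F n = 0) :
    ∑ T : M.cells, ∑ F : M.faces with F.1 ⊆ T.1, G F (outwardNormal T.1 F.1) = 0 := by
  rw [Finset.sum_comm' (t' := Finset.univ)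
    (s' := fun F => Finset.univ.filter fun T : M.cells => F.1 ⊆ T.1) (by simp)]
  refine Finset.sum_eq_zero fun F _ => ?_
  by_cases hF : M.IsBoundaryFace F
  · exact Finset.sum_eq_zero fun T _ => hb F hF _
  · obtain ⟨T, hT, hFT⟩ := exists_cell_of_face (M.mem_faces.1 F.2).1
    obtain ⟨T', hT', hne, hFT'⟩ := exists_other_cell hΩ.isOpen hT hF hFT
    have hne' : (⟨T, hT⟩ : M.cells) ≠ ⟨T', hT'⟩ := fun h => hne (congrArg Subtype.val h).symm
    rw [cells_of_face hne' hFT hFT', Finset.sum_pair hne',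
      normal_eq_neg hT hT' F.2 hne.symm hFT hFT', hodd]
    ring

end SimplicialMesh

/-! ### Vector algebra on a plane with unit normal `n` -/

section Plane

variable {n t₁ t₂ : Vec}

lemma cross_eq_smul_normal (hn : n ⬝ᵥ n = 1) (h₁ : n ⬝ᵥ t₁ = 0) (h₂ : n ⬝ᵥ t₂ = 0) :
    crossProduct t₁ t₂ = (n ⬝ᵥ crossProduct t₁ t₂) • n := by
  have h : ∀ z : Vec, (n ⬝ᵥ n) • z = (n ⬝ᵥ z) • n - crossProduct n (crossProduct n z) := by
    intro z
    ext i
    fin_cases i <;> simp [cross_apply, dot_fin_three] <;> ring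
  have h' : crossProduct n (crossProduct t₁ t₂) = (n ⬝ᵥ t₂) • t₁ - (n ⬝ᵥ t₁) • t₂ := by
    ext i
    fin_cases i <;> simp [cross_apply, dot_fin_three] <;> ring
  have := h (crossProduct t₁ t₂)
  rwa [h', h₁, h₂, hn, one_smul, zero_smul, zero_smul, sub_zero, map_zero, sub_zero] at this

lemma normal_dot_cross_ne_zero (hn : n ⬝ᵥ n = 1) (h₁ : n ⬝ᵥ t₁ = 0) (h₂ : n ⬝ᵥ t₂ = 0)
    (hne : crossProduct t₁ t₂ ≠ 0) : n ⬝ᵥ crossProduct t₁ t₂ ≠ 0 := by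
  intro h
  rw [cross_eq_smul_normal hn h₁ h₂, h, zero_smul] at hne
  exact hne rfl

/-- The dual vectors are t₂ × n and n × t₁ divided by the determinant n · (t₁ × t₂). -/
lemma exists_dual_basis (hn : n ⬝ᵥ n = 1) (h₁ : n ⬝ᵥ t₁ = 0) (h₂ : n ⬝ᵥ t₂ = 0)
    (hne : crossProduct t₁ t₂ ≠ 0) :
    ∃ e₁ e₂ : Vec, e₁ ⬝ᵥ t₁ = 1 ∧ e₁ ⬝ᵥ t₂ = 0 ∧ e₂ ⬝ᵥ t₁ = 0 ∧ e₂ ⬝ᵥ t₂ = 1 ∧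
      ∀ a : Vec, n ⬝ᵥ a = 0 → a = (e₁ ⬝ᵥ a) • t₁ + (e₂ ⬝ᵥ a) • t₂ := by
  have hJ := normal_dot_cross_ne_zero hn h₁ h₂ hne
  have hz := cross_eq_smul_normal hn h₁ h₂
  set J := n ⬝ᵥ crossProduct t₁ t₂ with hJd
  have hJ' : J = crossProduct t₂ n ⬝ᵥ t₁ := by
    rw [hJd]; simp only [cross_apply, dot_fin_three]; dsimp only [Matrix.cons_val]; ring
  have hJ'' : J = crossProduct n t₁ ⬝ᵥ t₂ := by
    rw [hJd]; simp only [cross_apply, dot_fin_three]; dsimp only [Matrix.cons_val]; ring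
  refine ⟨J⁻¹ • crossProduct t₂ n, J⁻¹ • crossProduct n t₁, ?_, ?_, ?_, ?_, fun a ha => ?_⟩
  · rw [smul_dotProduct, ← hJ', smul_eq_mul, inv_mul_cancel₀ hJ]
  · rw [smul_dotProduct, dotProduct_comm, dot_self_cross, smul_zero]
  · rw [smul_dotProduct, dotProduct_comm, dot_cross_self, smul_zero]
  · rw [smul_dotProduct, ← hJ'', smul_eq_mul, inv_mul_cancel₀ hJ]
  · have h : J • a = (crossProduct t₂ n ⬝ᵥ a) • t₁ + (crossProduct n t₁ ⬝ᵥ a) • t₂ +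
        (crossProduct t₁ t₂ ⬝ᵥ a) • n := by
      rw [hJd]
      ext i
      simp only [cross_apply, dot_fin_three, Pi.add_apply, Pi.smul_apply, smul_eq_mul]
      fin_cases i <;> dsimp only [Matrix.cons_val] <;> simp <;> ring
    rw [hz, smul_dotProduct, ha, smul_zero, zero_smul, add_zero] at h
    rw [smul_dotProduct, smul_dotProduct, smul_assoc, smul_assoc, ← smul_add, ← h, smul_smul,
      inv_mul_cancel₀ hJ, one_smul]

lemma cross_cross_normal (hn : n ⬝ᵥ n = 1) {a : Vec} (ha : n ⬝ᵥ a = 0) :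
    crossProduct n (crossProduct n a) = -a := by
  have h : ∀ z : Vec, crossProduct n (crossProduct n z) = (n ⬝ᵥ z) • n - (n ⬝ᵥ n) • z := by
    intro z
    ext i
    fin_cases i <;> simp [cross_apply, dot_fin_three] <;> ring
  rw [h, ha, hn, zero_smul, one_smul, zero_sub]

end Plane

/-- The direction of F is contained in the orthogonal complement of n, and both have dimension two.
-/
lemma isTangential_iff {F : Finset E3} (h3 : F.card = 3)
    (hF : AffineIndependent ℝ (fun x : F => (x : E3))) {n : Vec} (hn : n ⬝ᵥ n = 1)
    (hd : ∀ w ∈ vectorSpan ℝ (F : Set E3), n ⬝ᵥ w.ofLp = 0) (a : Vec) :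
    IsTangential F a ↔ n ⬝ᵥ a = 0 := by
  refine ⟨fun h => hd _ h, fun h => ?_⟩
  set N : E3 := WithLp.toLp 2 n with hN
  have hN0 : N ≠ 0 := by
    intro h0
    have : n = 0 := congrArg WithLp.ofLp h0
    rw [this] at hn
    simp at hn
  have hle : vectorSpan ℝ (F : Set E3) ≤ (ℝ ∙ N)ᗮ := by
    intro w hw
    rw [Submodule.mem_orthogonal_singleton_iff_inner_right, inner_eq_dot]
    exact hd w hw
  have hr := hF.finrank_vectorSpan (n := 2) (by simp [h3])
  have : Fact (Module.finrank ℝ E3 = 2 + 1) := ⟨by simp⟩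
  have hr' := Submodule.finrank_orthogonal_span_singleton (𝕜 := ℝ) (n := 2) hN0
  have hrange : Set.range (fun x : F => (x : E3)) = (F : Set E3) := Subtype.range_coe
  rw [hrange] at hr
  have heq := Submodule.eq_of_le_of_finrank_eq hle (hr.trans hr'.symm)
  rw [IsTangential, heq, Submodule.mem_orthogonal_singleton_iff_inner_right, inner_eq_dot]
  exact h

/-! ### Edge moments -/

lemma HasEdgeMoment.unique {F e : Finset E3} {g : E3 → Vec} {w : Poly3} {m m' : ℝ}
    (h : HasEdgeMoment F e g w m) (h' : HasEdgeMoment F e g w m') : m = m' :=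
  tendsto_nhds_unique h h'

lemma memLp_dot {F : Finset E3} (h3 : F.card = 3) {g : E3 → Vec}
    (hg : MemLp g 2 (faceMeasure F)) (i : Fin 3) : Integrable (fun x => g x i) (faceMeasure F) := by
  have := isFiniteMeasure_faceMeasure h3
  have h1 : Integrable g (faceMeasure F) := hg.integrable (by norm_num)
  exact h1.eval i

lemma integrable_mul_of_continuous {F : Finset E3} {h f : E3 → ℝ}
    (hh : Integrable h (faceMeasure F)) (hf : Continuous f) :
    Integrable (fun x => h x * f x) (faceMeasure F) := by
  obtain ⟨C, hC⟩ := (isCompact_simplexSet F).exists_bound_of_continuousOn hf.continuousOn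
  refine hh.mul_bdd (c := C) hf.aestronglyMeasurable ?_
  filter_upwards [ae_mem_simplexSet F] with x hx using hC x hx

lemma integrable_dot {F : Finset E3} (h3 : F.card = 3) {g : E3 → Vec}
    (hg : MemLp g 2 (faceMeasure F)) {v : E3 → Vec} (hv : ∀ i, Continuous fun x => v x i) :
    Integrable (fun x => g x ⬝ᵥ v x) (faceMeasure F) :=
  integrable_finsetSum _ fun i _ => integrable_mul_of_continuous (memLp_dot h3 hg i) (hv i)

lemma HasEdgeMoment.add {F e : Finset E3} (h3 : F.card = 3) {g : E3 → Vec}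
    (hg : MemLp g 2 (faceMeasure F)) {w w' : Poly3} {m m' : ℝ}
    (h : HasEdgeMoment F e g w m) (h' : HasEdgeMoment F e g w' m') :
    HasEdgeMoment F e g (w + w') (m + m') := by
  unfold HasEdgeMoment at *
  have hi : ∀ p : Poly3, Integrable (fun x => (g x ⬝ᵥ outwardNormal F e) * pval p x)
      (faceMeasure F) := fun p =>
    integrable_mul_of_continuous (integrable_dot h3 hg fun i => continuous_const) (continuous_pval p)
  refine (Tendsto.add h h').congr fun t => ?_
  simp only [pval_add, mul_add]
  rw [integral_add (hi w).restrict (hi w').restrict, mul_add]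

lemma HasEdgeMoment.smul {F e : Finset E3} {g : E3 → Vec} {w : Poly3} {m : ℝ}
    (h : HasEdgeMoment F e g w m) (c : ℝ) : HasEdgeMoment F e g (c • w) (c * m) := by
  refine (Tendsto.const_mul c h).congr fun t => ?_
  rw [mul_left_comm, ← integral_const_mul]
  refine congrArg _ (integral_congr_ae (ae_of_all _ fun x => ?_))
  simp only [pval_smul]
  ring

lemma contDiff_pval (p : Poly3) : ContDiff ℝ 1 (pval p) := by
  unfold pval
  induction p using MvPolynomial.induction_on with
  | C a => simpa using contDiff_const
  | add p q hp hq => simpa using hp.add hq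
  | mul_X p i hp =>
    simp only [map_mul, MvPolynomial.eval_X]
    exact hp.mul (by fun_prop)

/-- The moment on the edge `e` depends only on the values of the polynomial on `e`. -/
lemma hasEdgeMoment_zero_of_vanish {F e : Finset E3} (h3 : F.card = 3) (he : e.Nonempty)
    {g : E3 → Vec} (hg : MemLp g 2 (faceMeasure F)) {w : Poly3}
    (hw : ∀ x ∈ affineSpan ℝ (e : Set E3), pval w x = 0) : HasEdgeMoment F e g w 0 := by
  set A : Set E3 := (affineSpan ℝ (e : Set E3) : Set E3) with hA
  have hAne : A.Nonempty := he.to_set.mono (subset_affineSpan ℝ _)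
  have hAc : IsClosed A := AffineSubspace.closed_of_finiteDimensional _
  obtain ⟨R, hR⟩ := (isCompact_simplexSet F).isBounded.subset_closedBall (0 : E3)
  obtain ⟨L, hL⟩ := (contDiff_pval w).locallyLipschitz.locallyLipschitzOn
    (s := Metric.closedBall (0 : E3) (R + 1)) |>.exists_lipschitzOnWith_of_compact
      (isCompact_closedBall _ _)
  -- The polynomial is Lipschitz on a bounded set and vanishes on the line of e, so in the strip of
  -- width t it is at most L t, which offsets the factor 1/t. The ball of radius R + 1 also holds
  -- the nearest points on the line.
  have key : ∀ x ∈ simplexSet F, Metric.infDist x A < 1 → |pval w x| ≤ L * Metric.infDist x A := by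
    intro x hx hd
    obtain ⟨y, hy, hxy⟩ := hAc.exists_infDist_eq_dist hAne x
    have h1 := hR hx
    rw [mem_closedBall_zero_iff] at h1
    have h2 : ‖y‖ ≤ R + 1 := by
      rw [hxy, dist_comm, dist_eq_norm] at hd
      linarith [norm_sub_norm_le y x]
    have := hL.dist_le_mul x (by rw [mem_closedBall_zero_iff]; linarith) y
      (by rwa [mem_closedBall_zero_iff])
    rwa [hw y hy, Real.dist_eq, sub_zero, ← hxy] at this
  have hh : Integrable (fun x => g x ⬝ᵥ outwardNormal F e) (faceMeasure F) :=
    integrable_dot h3 hg fun i => continuous_const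
  have hms : ∀ t : ℝ, MeasurableSet {x : E3 | Metric.infDist x A < t} := fun t =>
    (isOpen_lt (Metric.continuous_infDist_pt A) continuous_const).measurableSet
  -- Dominated convergence: the bound is independent of t. Off the line the strips eventually miss
  -- x, and on the line the polynomial is zero.
  have hlim : Tendsto (fun t : ℝ => ∫ x, t⁻¹ * {x : E3 | Metric.infDist x A < t}.indicator
      (fun x => (g x ⬝ᵥ outwardNormal F e) * pval w x) x ∂(faceMeasure F)) (𝓝[>] 0)
      (𝓝 (∫ x, (0 : ℝ) ∂(faceMeasure F))) := by
    refine tendsto_integral_filter_of_dominated_convergence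
      (fun x => |g x ⬝ᵥ outwardNormal F e| * L) ?_ ?_ ?_ ?_
    · exact Eventually.of_forall fun t => (((hh.aestronglyMeasurable.mul
        (continuous_pval w).aestronglyMeasurable).indicator (hms t)).const_mul _)
    · have hlt : ∀ᶠ t : ℝ in 𝓝[>] 0, t ∈ Set.Ioo (0 : ℝ) 1 := Ioo_mem_nhdsGT one_pos
      filter_upwards [hlt] with t ht
      filter_upwards [ae_mem_simplexSet F] with x hx
      by_cases hxt : Metric.infDist x A < t
      · rw [Set.indicator_of_mem (by exact hxt), Real.norm_eq_abs, abs_mul, abs_mul, abs_of_pos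
          (inv_pos.2 ht.1), mul_left_comm]
        refine mul_le_mul_of_nonneg_left ?_ (abs_nonneg _)
        rw [inv_mul_le_iff₀ ht.1, mul_comm t]
        exact (key x hx (hxt.trans ht.2)).trans (mul_le_mul_of_nonneg_left hxt.le L.2)
      · rw [Set.indicator_of_notMem (by exact hxt), mul_zero, norm_zero]
        exact mul_nonneg (abs_nonneg _) L.2
    · exact hh.abs.mul_const _
    · refine ae_of_all _ fun x => ?_
      by_cases hx : x ∈ A
      · have : pval w x = 0 := hw x hx
        refine tendsto_const_nhds.congr fun t => ?_
        by_cases hxt : x ∈ {x : E3 | Metric.infDist x A < t}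
        · rw [Set.indicator_of_mem hxt, this, mul_zero, mul_zero]
        · rw [Set.indicator_of_notMem hxt, mul_zero]
      · have hpos : 0 < Metric.infDist x A := (hAc.notMem_iff_infDist_pos hAne).1 hx
        refine tendsto_const_nhds.congr' ?_
        have hlt : ∀ᶠ t : ℝ in 𝓝[>] 0, t ∈ Set.Ioo (0 : ℝ) (Metric.infDist x A) := Ioo_mem_nhdsGT hpos
        filter_upwards [hlt] with t ht
        rw [Set.indicator_of_notMem (by simpa using ht.2.le), mul_zero]
  rw [integral_zero] at hlim
  refine hlim.congr fun t => ?_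
  rw [integral_const_mul, integral_indicator (hms t)]

lemma hasEdgeMoment_zero (F e : Finset E3) (w : Poly3) : HasEdgeMoment F e 0 w 0 := by
  refine tendsto_const_nhds.congr fun t => ?_
  simp

/-- A linear functional that vanishes on the right kernel of a bilinear form is represented. -/
lemma exists_representer {V W : Type*} [AddCommGroup V] [Module ℝ V] [AddCommGroup W] [Module ℝ W]
    [FiniteDimensional ℝ V] (Φ : V →ₗ[ℝ] W →ₗ[ℝ] ℝ) (l : W →ₗ[ℝ] ℝ)
    (h : ∀ w, (∀ v, Φ v w = 0) → l w = 0) : ∃ v, Φ v = l := by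
  let b := Module.finBasis ℝ V
  have hm : l ∈ Submodule.span ℝ (Set.range fun i => Φ (b i)) := by
    -- A functional that vanishes on the common kernel of finitely many functionals is a linear
    -- combination of them.
    refine mem_span_of_iInf_ker_le_ker fun w hw => ?_
    rw [LinearMap.mem_ker]
    refine h w fun v => ?_
    have hw' : ∀ i, Φ (b i) w = 0 := fun i => by
      simpa using (Submodule.mem_iInf _).1 hw i
    rw [← b.sum_repr v]
    simp only [map_sum, map_smul, LinearMap.sum_apply, LinearMap.smul_apply, hw', smul_zero,
      Finset.sum_const_zero]
  have hle : Submodule.span ℝ (Set.range fun i => Φ (b i)) ≤ LinearMap.range Φ :=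
    Submodule.span_le.2 (by rintro _ ⟨i, rfl⟩; exact ⟨_, rfl⟩)
  exact hle hm

/-- The scalar product of a polynomial field with a constant vector. -/
def constDot (m : Vec) (π : Fin 3 → Poly3) : Poly3 := ∑ i, MvPolynomial.C (m i) * π i

lemma pval_constDot (m : Vec) (π : Fin 3 → Poly3) (x : E3) :
    pval (constDot m π) x = m ⬝ᵥ vval π x := by
  simp [constDot, pval, vval, dotProduct]

lemma totalDegree_constDot_le {m : Vec} {π : Fin 3 → Poly3} {k : ℕ}
    (h : ∀ i, (π i).totalDegree ≤ k) : (constDot m π).totalDegree ≤ k :=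
  MvPolynomial.totalDegree_finsetSum_le fun i _ =>
    (totalDegree_mul_le_of_le (MvPolynomial.totalDegree_C _).le (h i)).trans (by simp)

lemma constDot_sub (m : Vec) (π π' : Fin 3 → Poly3) :
    constDot m (π - π') = constDot m π - constDot m π' := by
  simp [constDot, mul_sub]

lemma integral_edge {p q : E3} (f : Poly3) :
    ∫ x, pval f x ∂(edgeMeasure {p, q}) =
      simplexJac ![p, q] * simplexInt 1 (pullback ![p, q] f) := by
  rw [← integral_simplex, edgeMeasure, simplexSet]
  congr 4
  rw [Matrix.range_cons, Matrix.range_cons, Matrix.range_empty]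
  ext x
  simp [or_comm]

/-- An affine frame of a triangle with unit normal `n`. -/
structure FaceFrame (F : Finset E3) (n : Vec) where
  v : Fin 3 → E3
  eq : F = {v 0, v 1, v 2}
  range_eq : Set.range v = (F : Set E3)
  indep : AffineIndependent ℝ v
  card : F.card = 3
  indep' : AffineIndependent ℝ (fun x : F => (x : E3))
  unit : n ⬝ᵥ n = 1
  perp : ∀ a : Vec, IsTangential F a ↔ n ⬝ᵥ a = 0
  jac : n ⬝ᵥ crossProduct (v 1 - v 0).ofLp (v 2 - v 0).ofLp ≠ 0
  e₁ : Vec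
  e₂ : Vec
  e₁_fst : e₁ ⬝ᵥ (v 1 - v 0).ofLp = 1
  e₁_snd : e₁ ⬝ᵥ (v 2 - v 0).ofLp = 0
  e₂_fst : e₂ ⬝ᵥ (v 1 - v 0).ofLp = 0
  e₂_snd : e₂ ⬝ᵥ (v 2 - v 0).ofLp = 1
  expand : ∀ a : Vec, n ⬝ᵥ a = 0 →
    a = (e₁ ⬝ᵥ a) • (v 1 - v 0).ofLp + (e₂ ⬝ᵥ a) • (v 2 - v 0).ofLp

lemma exists_faceFrame {F : Finset E3} (h3 : F.card = 3)
    (hF : AffineIndependent ℝ (fun x : F => (x : E3))) {n : Vec} (hn : n ⬝ᵥ n = 1)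
    (hd : ∀ w ∈ vectorSpan ℝ (F : Set E3), n ⬝ᵥ w.ofLp = 0) : Nonempty (FaceFrame F n) := by
  obtain ⟨a, b, c, rfl, hv, hab, hac, hbc⟩ := exists_enum_three h3
  have hind := SimplicialMesh.affineIndependent_of_range hF (SimplicialMesh.injective_three hab hac hbc) hv
  have hmem : ∀ {x}, x ∈ ({a, b, c} : Finset E3) → x ∈ simplexSet {a, b, c} := fun hx =>
    subset_convexHull ℝ _ hx
  have h1 : n ⬝ᵥ (b - a).ofLp = 0 := hd _ (sub_mem_vectorSpan (hmem (by simp)) (hmem (by simp)))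
  have h2 : n ⬝ᵥ (c - a).ofLp = 0 := hd _ (sub_mem_vectorSpan (hmem (by simp)) (hmem (by simp)))
  have hne : crossProduct (b - a).ofLp (c - a).ofLp ≠ 0 := by
    rw [crossProduct_ne_zero_iff_linearIndependent]
    have h := (affineIndependent_iff_linearIndependent_vsub ℝ _ (0 : Fin 3)).1 hind
    have h' : LinearIndependent ℝ ![b - a, c - a] := by
      have e : (fun j : Fin 2 => ![a, b, c] j.succ -ᵥ ![a, b, c] 0) = ![b - a, c - a] := by
        funext j
        fin_cases j <;> simp
      rw [← e]
      exact h.comp (fun j : Fin 2 => ⟨j.succ, Fin.succ_ne_zero j⟩)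
        (fun a b h => by simpa using h)
    have e : ⇑(WithLp.linearEquiv 2 ℝ (Fin 3 → ℝ)).toLinearMap ∘ ![b - a, c - a] =
        ![(b - a).ofLp, (c - a).ofLp] := by
      funext j
      fin_cases j <;> simp
    have h'' := h'.map' (WithLp.linearEquiv 2 ℝ (Fin 3 → ℝ)).toLinearMap
      (LinearEquiv.ker _)
    rw [e] at h''
    exact h''
  obtain ⟨e₁, e₂, h11, h12, h21, h22, hex⟩ := exists_dual_basis hn h1 h2 hne
  exact ⟨⟨![a, b, c], rfl, hv, hind, h3, hF, hn, isTangential_iff h3 hF hn hd,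
    normal_dot_cross_ne_zero hn h1 h2 hne, e₁, e₂, h11, h12, h21, h22, hex⟩⟩

/-! ### Fields and moments on a face in reference coordinates. -/

namespace FaceFrame

variable {F : Finset E3} {n : Vec} (R : FaceFrame F n)

/-- The first edge vector. -/
def t₁ : Vec := (R.v 1 - R.v 0).ofLp

/-- The second edge vector. -/
def t₂ : Vec := (R.v 2 - R.v 0).ofLp

lemma simplexSet_eq : simplexSet F = simplexParam R.v '' refSimplex 2 := by
  rw [image_simplexParam, simplexSet, R.range_eq]

lemma integral_face (p : Poly3) :
    ∫ x, pval p x ∂(faceMeasure F) = simplexJac R.v * simplexInt 2 (pullback R.v p) := by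
  rw [faceMeasure_eq R.range_eq, integral_simplex]

/-- Polynomials in space matter only through their values on the face; the pullback is a normal form
for this equivalence. -/
lemma pullback_eq_zero_iff (p : Poly3) :
    pullback R.v p = 0 ↔ ∀ x ∈ simplexSet F, pval p x = 0 := by
  rw [R.simplexSet_eq]
  constructor
  · rintro h _ ⟨y, -, rfl⟩
    rw [← eval_pullback, h, map_zero]
  · intro h
    refine eq_zero_of_eval_refSimplex fun y hy hy' => ?_
    rw [eval_pullback]
    exact h _ ⟨y, ⟨fun i => (hy i).le, hy'.le⟩, rfl⟩

/-- Extension of polynomials from the plane of the triangle to space. -/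
def lift : MvPolynomial (Fin 2) ℝ →ₐ[ℝ] Poly3 :=
  MvPolynomial.aeval ![constDot R.e₁ fun i => MvPolynomial.X i - MvPolynomial.C (R.v 0 i),
    constDot R.e₂ fun i => MvPolynomial.X i - MvPolynomial.C (R.v 0 i)]

lemma totalDegree_lift_le (p : MvPolynomial (Fin 2) ℝ) :
    (R.lift p).totalDegree ≤ p.totalDegree := by
  have h : ∀ e : Vec, (constDot e fun i => MvPolynomial.X i - MvPolynomial.C (R.v 0 i) :
      Poly3).totalDegree ≤ 1 := fun e => totalDegree_constDot_le fun i =>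
    (MvPolynomial.totalDegree_sub _ _).trans (by simp)
  refine totalDegree_aeval_le (fun i => ?_) p
  fin_cases i
  · exact h _
  · exact h _

lemma pullback_constDot (e : Vec) :
    pullback R.v (constDot e fun i => MvPolynomial.X i - MvPolynomial.C (R.v 0 i)) =
      MvPolynomial.C (e ⬝ᵥ R.t₁) * MvPolynomial.X 0 +
        MvPolynomial.C (e ⬝ᵥ R.t₂) * MvPolynomial.X 1 := by
  have h : ∀ i, pullback R.v (MvPolynomial.X i - MvPolynomial.C (R.v 0 i)) =
      MvPolynomial.C (R.t₁ i) * MvPolynomial.X 0 + MvPolynomial.C (R.t₂ i) * MvPolynomial.X 1 := by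
    intro i
    rw [map_sub, pullback_X, Fin.sum_univ_two, MvPolynomial.algHom_C, MvPolynomial.algebraMap_eq,
      add_sub_cancel_left]
    rfl
  simp only [constDot, map_mul, h, Fin.sum_univ_three, MvPolynomial.algHom_C,
    MvPolynomial.algebraMap_eq, dot_fin_three, map_add]
  ring

@[simp] lemma pullback_lift (p : MvPolynomial (Fin 2) ℝ) : pullback R.v (R.lift p) = p := by
  have : (pullback R.v).comp R.lift = AlgHom.id ℝ _ := by
    refine MvPolynomial.algHom_ext fun i => ?_
    fin_cases i
    · simp only [lift, Fin.zero_eta, AlgHom.comp_apply, MvPolynomial.aeval_X, Matrix.cons_val_zero,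
        pullback_constDot, t₁, t₂, R.e₁_fst, R.e₁_snd]
      simp
    · simp only [lift, Fin.mk_one, AlgHom.comp_apply, MvPolynomial.aeval_X, Matrix.cons_val_one,
        Matrix.cons_val_zero, pullback_constDot, t₁, t₂, R.e₂_fst, R.e₂_snd]
      simp
  exact DFunLike.congr_fun this p

/-- The coefficient of a tangential field along the first edge vector. -/
def coefFst (π : Fin 3 → Poly3) : MvPolynomial (Fin 2) ℝ := pullback R.v (constDot R.e₁ π)

/-- The coefficient of a tangential field along the second edge vector. -/
def coefSnd (π : Fin 3 → Poly3) : MvPolynomial (Fin 2) ℝ := pullback R.v (constDot R.e₂ π)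

lemma pullback_constDot_of_tangential {π : Fin 3 → Poly3}
    (hπ : ∀ x ∈ simplexSet F, n ⬝ᵥ vval π x = 0) (m : Vec) : pullback R.v (constDot m π) =
      (m ⬝ᵥ R.t₁) • R.coefFst π + (m ⬝ᵥ R.t₂) • R.coefSnd π := by
  rw [← sub_eq_zero, coefFst, coefSnd, ← map_smul, ← map_smul, ← map_add, ← map_sub,
    R.pullback_eq_zero_iff]
  intro x hx
  rw [pval_sub, pval_add, pval_smul, pval_smul, pval_constDot, pval_constDot, pval_constDot]
  nth_rewrite 1 [R.expand _ (hπ x hx)]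
  rw [dotProduct_add, dotProduct_smul, dotProduct_smul]
  simp only [t₁, t₂, smul_eq_mul]
  ring

lemma eq_zero_of_coef {π : Fin 3 → Poly3} (hπ : ∀ x ∈ simplexSet F, n ⬝ᵥ vval π x = 0)
    (h₁ : R.coefFst π = 0) (h₂ : R.coefSnd π = 0) : ∀ x ∈ simplexSet F, vval π x = 0 := by
  intro x hx
  rw [R.expand _ (hπ x hx), ← pval_constDot, ← pval_constDot,
    (R.pullback_eq_zero_iff _).1 h₁ x hx, (R.pullback_eq_zero_iff _).1 h₂ x hx, zero_smul, zero_smul,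
    add_zero]

lemma pullback_edge_snd (p : Poly3) :
    pullback ![R.v 0, R.v 1] p = traceSnd (pullback R.v p) := by
  have : pullback ![R.v 0, R.v 1] = traceSnd.comp (pullback R.v) := by
    refine MvPolynomial.algHom_ext fun i => ?_
    rw [AlgHom.comp_apply, pullback_X, pullback_X]
    simp [Fin.sum_univ_two, MvPolynomial.algebraMap_eq]
  exact DFunLike.congr_fun this p

lemma pullback_edge_fst (p : Poly3) :
    pullback ![R.v 0, R.v 2] p = traceFst (pullback R.v p) := by
  have : pullback ![R.v 0, R.v 2] = traceFst.comp (pullback R.v) := by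
    refine MvPolynomial.algHom_ext fun i => ?_
    rw [AlgHom.comp_apply, pullback_X, pullback_X]
    simp [Fin.sum_univ_two, MvPolynomial.algebraMap_eq]
  exact DFunLike.congr_fun this p

lemma pullback_edge_slant (p : Poly3) :
    pullback ![R.v 1, R.v 2] p = traceSlant (pullback R.v p) := by
  have : pullback ![R.v 1, R.v 2] = traceSlant.comp (pullback R.v) := by
    refine MvPolynomial.algHom_ext fun i => ?_
    rw [AlgHom.comp_apply, pullback_X, pullback_X]
    simp [Fin.sum_univ_two, MvPolynomial.algebraMap_eq]
    ring
  exact DFunLike.congr_fun this p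

lemma integral_edge_eq {p q : E3} {tr : MvPolynomial (Fin 2) ℝ →ₐ[ℝ] MvPolynomial (Fin 1) ℝ}
    (htr : ∀ f, pullback ![p, q] f = tr (pullback R.v f)) {π : Fin 3 → Poly3}
    (hπ : ∀ x ∈ simplexSet F, n ⬝ᵥ vval π x = 0) (m : Vec) (w : Poly3) :
    ∫ x, (vval π x ⬝ᵥ m) * pval w x ∂(edgeMeasure {p, q}) = simplexJac ![p, q] *
      simplexInt 1 (tr ((m ⬝ᵥ R.t₁) • R.coefFst π + (m ⬝ᵥ R.t₂) • R.coefSnd π) *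
        tr (pullback R.v w)) := by
  rw [← map_mul, ← R.pullback_constDot_of_tangential hπ, ← map_mul, ← htr, ← integral_edge]
  refine integral_congr_ae (ae_of_all _ fun x => ?_)
  simp only [pval_mul, pval_constDot, dotProduct_comm m]

end FaceFrame

/-! ### Unisolvence of the divergence-conforming projection on a triangle -/

/-- The lower-order part of b, multiplied by x, has degree at most m and can be moved into a. So
every b of degree at most k - 2 is available in the test space, a condition that survives affine
pullback while homogeneity does not. -/
lemma exists_homogeneous_add {b : Poly3} {m : ℕ} (hb : b.totalDegree ≤ m) :
    ∃ h b' : Poly3, b = h + b' ∧ h.IsHomogeneous m ∧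
      ∀ i, (b' * MvPolynomial.X i).totalDegree ≤ m := by
  refine ⟨MvPolynomial.homogeneousComponent m b, b - MvPolynomial.homogeneousComponent m b,
    by ring, MvPolynomial.homogeneousComponent_isHomogeneous m b, fun i => ?_⟩
  refine Finset.sup_le fun s hs => ?_
  rw [MvPolynomial.support_mul_X] at hs
  obtain ⟨u, hu, rfl⟩ := Finset.mem_map.1 hs
  rw [MvPolynomial.mem_support_iff, MvPolynomial.coeff_sub,
    MvPolynomial.coeff_homogeneousComponent] at hu
  have hdeg : u.degree ≠ m := by
    intro h
    rw [if_pos h, sub_self] at hu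
    exact hu rfl
  rw [if_neg hdeg, sub_zero] at hu
  have h1 := (MvPolynomial.le_totalDegree (MvPolynomial.mem_support_iff.2 hu)).trans hb
  have h2 : (u.sum fun _ e => e) = u.degree := rfl
  change ((u + Finsupp.single i 1 : Fin 3 →₀ ℕ).sum fun _ e => e) ≤ m
  rw [Finsupp.sum_add_index' (fun _ => rfl) (fun _ _ _ => rfl),
    Finsupp.sum_single_index rfl, h2]
  rw [h2] at h1
  omega

namespace FaceFrame

variable {F : Finset E3} {n : Vec} (R : FaceFrame F n)

lemma normal_dot_t₁ : n ⬝ᵥ R.t₁ = 0 := by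
  refine (R.perp _).1 ?_
  have h : ∀ i, R.v i ∈ (F : Set E3) := fun i => R.range_eq ▸ ⟨i, rfl⟩
  exact sub_mem_vectorSpan (subset_convexHull ℝ _ (h 1)) (subset_convexHull ℝ _ (h 0))

lemma normal_dot_t₂ : n ⬝ᵥ R.t₂ = 0 := by
  refine (R.perp _).1 ?_
  have h : ∀ i, R.v i ∈ (F : Set E3) := fun i => R.range_eq ▸ ⟨i, rfl⟩
  exact sub_mem_vectorSpan (subset_convexHull ℝ _ (h 2)) (subset_convexHull ℝ _ (h 0))

lemma inj : Function.Injective R.v := R.indep.injective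

/-- This edge runs along t₂ and t₁ leads to the opposite vertex, so its normal trace sees only the
coefficient along t₁. -/
lemma edge_normal_fst : outwardNormal F {R.v 0, R.v 2} ⬝ᵥ R.t₂ = 0 ∧
    outwardNormal F {R.v 0, R.v 2} ⬝ᵥ R.t₁ ≠ 0 := by
  have hF : F = insert (R.v 1) {R.v 0, R.v 2} := 
    R.eq.trans (Finset.insert_comm _ _ _)
  have hS := R.indep'
  rw [hF] at hS
  have h := (outwardNormal_facts (by simp [R.inj.eq_iff]) (by simp) hS).2 (R.v 0) (by simp)
  rw [← hF] at h
  refine ⟨outwardNormal_dot (sub_mem_vectorSpan (subset_convexHull ℝ _ (by simp))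
    (subset_convexHull ℝ _ (by simp))), fun h0 => ?_⟩
  have e : R.v 0 - R.v 1 = -(R.v 1 - R.v 0) := by abel
  rw [e, WithLp.ofLp_neg, dotProduct_neg] at h
  rw [t₁] at h0
  linarith

lemma edge_normal_snd : outwardNormal F {R.v 0, R.v 1} ⬝ᵥ R.t₁ = 0 ∧
    outwardNormal F {R.v 0, R.v 1} ⬝ᵥ R.t₂ ≠ 0 := by
  have hF : F = insert (R.v 2) {R.v 0, R.v 1} := 
    R.eq.trans (by ext x; simp; tauto)
  have hS := R.indep'
  rw [hF] at hS
  have h := (outwardNormal_facts (by simp [R.inj.eq_iff]) (by simp) hS).2 (R.v 0) (by simp)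
  rw [← hF] at h
  refine ⟨outwardNormal_dot (sub_mem_vectorSpan (subset_convexHull ℝ _ (by simp))
    (subset_convexHull ℝ _ (by simp))), fun h0 => ?_⟩
  have e : R.v 0 - R.v 2 = -(R.v 2 - R.v 0) := by abel
  rw [e, WithLp.ofLp_neg, dotProduct_neg] at h
  rw [t₂] at h0
  linarith

/-- This edge has direction t₂ - t₁, so its normal pairs equally with both frame vectors and its
normal trace sees the sum of the coefficients. -/
lemma edge_normal_slant :
    outwardNormal F {R.v 1, R.v 2} ⬝ᵥ R.t₂ = outwardNormal F {R.v 1, R.v 2} ⬝ᵥ R.t₁ ∧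
    outwardNormal F {R.v 1, R.v 2} ⬝ᵥ R.t₁ ≠ 0 := by
  have hF : F = insert (R.v 0) {R.v 1, R.v 2} := R.eq
  have hS := R.indep'
  rw [hF] at hS
  have h := (outwardNormal_facts (by simp [R.inj.eq_iff]) (by simp) hS).2 (R.v 1) (by simp)
  rw [← hF] at h
  have h' : outwardNormal F {R.v 1, R.v 2} ⬝ᵥ (R.v 2 - R.v 1).ofLp = 0 :=
    outwardNormal_dot (sub_mem_vectorSpan (subset_convexHull ℝ _ (by simp))
      (subset_convexHull ℝ _ (by simp)))
  refine ⟨?_, h.ne'⟩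
  have e : R.t₂ = R.t₁ + (R.v 2 - R.v 1).ofLp := by
    simp only [t₁, t₂, WithLp.ofLp_sub]; abel
  rw [e, dotProduct_add, h', add_zero]

lemma edge_cases {e : Finset E3} (he : e ⊆ F) (h2 : e.card = 2) :
    e = {R.v 0, R.v 2} ∨ e = {R.v 0, R.v 1} ∨ e = {R.v 1, R.v 2} := by
  have hc : (F \ e).card = 1 := by rw [Finset.card_sdiff_of_subset he, R.card, h2]
  obtain ⟨x, hx⟩ := Finset.card_eq_one.1 hc
  have hxe : e = F.erase x := by
    rw [← Finset.sdiff_singleton_eq_erase, ← hx, Finset.sdiff_sdiff_eq_self he]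
  have hxF : x ∈ F := (Finset.mem_sdiff.1 (hx ▸ Finset.mem_singleton_self x)).1
  have h01 : R.v 0 ≠ R.v 1 := fun h => absurd (R.inj h) (by decide)
  have h02 : R.v 0 ≠ R.v 2 := fun h => absurd (R.inj h) (by decide)
  have h12 : R.v 1 ≠ R.v 2 := fun h => absurd (R.inj h) (by decide)
  rw [hxe]
  have hm : ∀ y, y ∈ F ↔ y = R.v 0 ∨ y = R.v 1 ∨ y = R.v 2 := fun y => by
    have := R.eq
    rw [Finset.ext_iff] at this
    simpa using this y
  rcases (hm x).1 hxF with rfl | rfl | rfl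
  · right; right
    ext y; simp only [Finset.mem_erase, hm, Finset.mem_insert, Finset.mem_singleton]
    constructor
    · tauto
    · rintro (rfl | rfl) <;> simp [h01.symm, h02.symm]
  · left
    ext y; simp only [Finset.mem_erase, hm, Finset.mem_insert, Finset.mem_singleton]
    constructor
    · tauto
    · rintro (rfl | rfl) <;> simp [h01, h12.symm]
  · right; left
    ext y; simp only [Finset.mem_erase, hm, Finset.mem_insert, Finset.mem_singleton]
    constructor
    · tauto
    · rintro (rfl | rfl) <;> simp [h02, h12]

lemma edge_subset : ({R.v 0, R.v 2} : Finset E3) ⊆ F ∧ ({R.v 0, R.v 1} : Finset E3) ⊆ F ∧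
    ({R.v 1, R.v 2} : Finset E3) ⊆ F := by
  refine ⟨fun x hx => ?_, fun x hx => ?_, fun x hx => ?_⟩ <;>
  · rw [R.eq]
    simp only [Finset.mem_insert, Finset.mem_singleton] at hx ⊢
    tauto

lemma edge_card {i j : Fin 3} (h : i ≠ j) : ({R.v i, R.v j} : Finset E3).card = 2 :=
  Finset.card_pair fun h' => h (R.inj h')

lemma edge_jac_pos {i j : Fin 3} (h : i ≠ j) : 0 < simplexJac ![R.v i, R.v j] := by
  refine simplexJac_pos ?_
  exact affineIndependent_of_ne ℝ fun h' => h (R.inj h')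

/-- The three edge moments of a tangential field in terms of its coefficients. -/
lemma exists_edge_formula : ∃ κ₀ κ₁ κ₂ : ℝ, κ₀ ≠ 0 ∧ κ₁ ≠ 0 ∧ κ₂ ≠ 0 ∧
    ∀ π : Fin 3 → Poly3, (∀ x ∈ simplexSet F, n ⬝ᵥ vval π x = 0) → ∀ w : Poly3,
      ∫ x, (vval π x ⬝ᵥ outwardNormal F {R.v 0, R.v 2}) * pval w x
          ∂(edgeMeasure {R.v 0, R.v 2}) =
        κ₀ * simplexInt 1 (traceFst (R.coefFst π) * traceFst (pullback R.v w)) ∧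
      ∫ x, (vval π x ⬝ᵥ outwardNormal F {R.v 0, R.v 1}) * pval w x
          ∂(edgeMeasure {R.v 0, R.v 1}) =
        κ₁ * simplexInt 1 (traceSnd (R.coefSnd π) * traceSnd (pullback R.v w)) ∧
      ∫ x, (vval π x ⬝ᵥ outwardNormal F {R.v 1, R.v 2}) * pval w x
          ∂(edgeMeasure {R.v 1, R.v 2}) =
        κ₂ * simplexInt 1 (traceSlant (R.coefFst π + R.coefSnd π) *
          traceSlant (pullback R.v w)) := by
  -- Each constant is the length of the edge times the pairing of its normal with a frame vector
  -- transversal to it.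
  refine ⟨_, _, _, mul_ne_zero (R.edge_jac_pos (i := 0) (j := 2) (by decide)).ne'
    R.edge_normal_fst.2, mul_ne_zero (R.edge_jac_pos (i := 0) (j := 1) (by decide)).ne'
    R.edge_normal_snd.2, mul_ne_zero (R.edge_jac_pos (i := 1) (j := 2) (by decide)).ne'
    R.edge_normal_slant.2, fun π hπ w => ⟨?_, ?_, ?_⟩⟩
  · rw [R.integral_edge_eq R.pullback_edge_fst hπ, R.edge_normal_fst.1, zero_smul, add_zero,
      map_smul, smul_mul_assoc, map_smul, smul_eq_mul, mul_assoc]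
  · rw [R.integral_edge_eq R.pullback_edge_snd hπ, R.edge_normal_snd.1, zero_smul, zero_add,
      map_smul, smul_mul_assoc, map_smul, smul_eq_mul, mul_assoc]
  · rw [R.integral_edge_eq R.pullback_edge_slant hπ, R.edge_normal_slant.1, ← smul_add,
      map_smul, smul_mul_assoc, map_smul, smul_eq_mul, mul_assoc]

/-- The first component of the test function `n × (a + b x)`. -/
def testFst (a : Fin 3 → Poly3) (b : Poly3) : MvPolynomial (Fin 2) ℝ :=
  pullback R.v (constDot (crossProduct R.t₁ n) fun i => a i + b * MvPolynomial.X i)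

/-- The second component of the test function `n × (a + b x)`. -/
def testSnd (a : Fin 3 → Poly3) (b : Poly3) : MvPolynomial (Fin 2) ℝ :=
  pullback R.v (constDot (crossProduct R.t₂ n) fun i => a i + b * MvPolynomial.X i)

lemma vval_test (a : Fin 3 → Poly3) (b : Poly3) (x : E3) :
    vval (fun i => a i + b * MvPolynomial.X i) x = vval a x + pval b x • x.ofLp := by
  funext i
  simp [vval, pval]

lemma dot_cross_eq (t z : Vec) : t ⬝ᵥ crossProduct n z = crossProduct t n ⬝ᵥ z := by
  simp only [cross_apply, dot_fin_three]
  dsimp only [Matrix.cons_val]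
  ring

lemma face_formula {π : Fin 3 → Poly3} (hπ : ∀ x ∈ simplexSet F, n ⬝ᵥ vval π x = 0)
    (a : Fin 3 → Poly3) (b : Poly3) :
    ∫ x, vval π x ⬝ᵥ crossProduct n (vval a x + pval b x • x.ofLp) ∂(faceMeasure F) =
      simplexJac R.v * simplexInt 2 (R.coefFst π * R.testFst a b + R.coefSnd π * R.testSnd a b) := by
  rw [coefFst, coefSnd, testFst, testSnd, ← map_mul, ← map_mul, ← map_add, ← R.integral_face]
  refine integral_congr_ae ?_
  filter_upwards [ae_mem_simplexSet F] with x hx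
  simp only [pval_add, pval_mul, pval_constDot, vval_test]
  nth_rewrite 1 [R.expand _ (hπ x hx)]
  rw [add_dotProduct, smul_dotProduct, smul_dotProduct, dot_cross_eq, dot_cross_eq]
  rfl

/-- The determinant of the frame. -/
def det : ℝ := n ⬝ᵥ crossProduct R.t₁ R.t₂

lemma pullback_constDot_X (m : Vec) : pullback R.v (constDot m fun i => MvPolynomial.X i) =
    MvPolynomial.C (m ⬝ᵥ (R.v 0).ofLp) + MvPolynomial.C (m ⬝ᵥ R.t₁) * MvPolynomial.X 0 +
      MvPolynomial.C (m ⬝ᵥ R.t₂) * MvPolynomial.X 1 := by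
  have h := R.pullback_constDot m
  have e : (constDot m fun i => MvPolynomial.X i - MvPolynomial.C (R.v 0 i)) =
      constDot m (fun i => MvPolynomial.X i) - MvPolynomial.C (m ⬝ᵥ (R.v 0).ofLp) := by
    simp [constDot, Fin.sum_univ_three, dot_fin_three]
    ring
  rw [e, map_sub, sub_eq_iff_eq_add, MvPolynomial.algHom_C, MvPolynomial.algebraMap_eq] at h
  rw [h]
  ring

lemma constDot_test (m : Vec) (a : Fin 3 → Poly3) (b : Poly3) :
    constDot m (fun i => a i + b * MvPolynomial.X i) =
      constDot m a + b * constDot m fun i => MvPolynomial.X i := by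
  simp only [constDot, mul_add, Finset.sum_add_distrib, Finset.mul_sum]
  congr 1
  exact Finset.sum_congr rfl fun i _ => by ring

/-- The field b x becomes a rotated radial field with weight det · b plus a multiple of b from the
base point v₀, which joins the part coming from a. This is the shape a₀ - X₁ q in
`bdm_dual_unisolvent`. -/
lemma testFst_eq (a : Fin 3 → Poly3) (b : Poly3) : R.testFst a b =
    (pullback R.v (constDot (crossProduct R.t₁ n) a) +
      (crossProduct R.t₁ n ⬝ᵥ (R.v 0).ofLp) • pullback R.v b) -
      MvPolynomial.X 1 * (R.det • pullback R.v b) := by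
  have h1 : crossProduct R.t₁ n ⬝ᵥ R.t₁ = 0 := by rw [dotProduct_comm, dot_self_cross]
  have h2 : crossProduct R.t₁ n ⬝ᵥ R.t₂ = -R.det := by
    simp only [det, cross_apply, dot_fin_three]
    dsimp only [Matrix.cons_val]
    ring
  rw [testFst, constDot_test, map_add, map_mul, R.pullback_constDot_X, h1, h2]
  simp only [MvPolynomial.smul_eq_C_mul, map_neg, map_zero]
  ring

lemma testSnd_eq (a : Fin 3 → Poly3) (b : Poly3) : R.testSnd a b =
    (pullback R.v (constDot (crossProduct R.t₂ n) a) +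
      (crossProduct R.t₂ n ⬝ᵥ (R.v 0).ofLp) • pullback R.v b) +
      MvPolynomial.X 0 * (R.det • pullback R.v b) := by
  have h1 : crossProduct R.t₂ n ⬝ᵥ R.t₂ = 0 := by rw [dotProduct_comm, dot_self_cross]
  have h2 : crossProduct R.t₂ n ⬝ᵥ R.t₁ = R.det := by
    simp only [det, cross_apply, dot_fin_three]
    dsimp only [Matrix.cons_val]
    ring
  rw [testSnd, constDot_test, map_add, map_mul, R.pullback_constDot_X, h1, h2]
  simp only [MvPolynomial.smul_eq_C_mul, map_zero]
  ring

/-- Already with b = 0 all pairs of components occur, because e₁ × n and e₂ × n are dual to t₁ × n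
and t₂ × n. -/
lemma exists_constant_test (c d : MvPolynomial (Fin 2) ℝ) {m : ℕ} (hc : c.totalDegree ≤ m)
    (hd : d.totalDegree ≤ m) : ∃ a : Fin 3 → Poly3, (∀ i, (a i).totalDegree ≤ m) ∧
      R.testFst a 0 = c ∧ R.testSnd a 0 = d := by
  set f₁ : Vec := crossProduct R.e₁ n
  set f₂ : Vec := crossProduct R.e₂ n
  have key : ∀ t e : Vec, n ⬝ᵥ t = 0 → crossProduct t n ⬝ᵥ crossProduct e n = e ⬝ᵥ t := by
    intro t e ht
    rw [cross_dot_cross, R.unit, mul_one, dotProduct_comm t n, ht, zero_mul, sub_zero,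
      dotProduct_comm]
  let a : Fin 3 → Poly3 := fun i =>
    MvPolynomial.C (f₁ i) * R.lift c + MvPolynomial.C (f₂ i) * R.lift d
  have ha : ∀ m : Vec, pullback R.v (constDot m a) = (m ⬝ᵥ f₁) • c + (m ⬝ᵥ f₂) • d := by
    intro m
    have : constDot m a = (m ⬝ᵥ f₁) • R.lift c + (m ⬝ᵥ f₂) • R.lift d := by
      simp only [constDot, a, Fin.sum_univ_three, dot_fin_three, MvPolynomial.smul_eq_C_mul,
        map_add, map_mul]
      ring
    rw [this, map_add, map_smul, map_smul, R.pullback_lift, R.pullback_lift]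
  refine ⟨a, fun i => ?_, ?_, ?_⟩
  · refine (MvPolynomial.totalDegree_add _ _).trans (max_le ?_ ?_)
    · exact (totalDegree_mul_le_of_le (MvPolynomial.totalDegree_C _).le
        ((R.totalDegree_lift_le c).trans hc)).trans (by simp)
    · exact (totalDegree_mul_le_of_le (MvPolynomial.totalDegree_C _).le
        ((R.totalDegree_lift_le d).trans hd)).trans (by simp)
  · rw [testFst_eq, map_zero, ha, key _ _ R.normal_dot_t₁, key _ _ R.normal_dot_t₁]
    simp [t₁, R.e₁_fst, R.e₂_fst, -WithLp.ofLp_sub]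
  · rw [testSnd_eq, map_zero, ha, key _ _ R.normal_dot_t₂, key _ _ R.normal_dot_t₂]
    simp [t₂, R.e₁_snd, R.e₂_snd, -WithLp.ofLp_sub]

lemma test_eq_of_decomp {a : Fin 3 → Poly3} {b h b' : Poly3} (hb : b = h + b') (x : E3) :
    vval a x + pval b x • x.ofLp =
      vval (fun i => a i + b' * MvPolynomial.X i) x + pval h x • x.ofLp := by
  rw [vval_test, hb, pval_add, add_smul]
  abel

/-- A tangential field with vanishing moments vanishes. -/
lemma eq_zero_of_moments (R : FaceFrame F n) {k : ℕ} (hk : 1 ≤ k) {π : Fin 3 → Poly3}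
    (hdeg : ∀ i, (π i).totalDegree ≤ k) (hπ : ∀ x ∈ simplexSet F, n ⬝ᵥ vval π x = 0)
    (hE : ∀ e : Finset E3, e ⊆ F → e.card = 2 → ∀ w : Poly3, w.totalDegree ≤ k →
      ∫ x, (vval π x ⬝ᵥ outwardNormal F e) * pval w x ∂(edgeMeasure e) = 0)
    (hI : 2 ≤ k → ∀ (a : Fin 3 → Poly3) (b : Poly3),
      (∀ i, (a i).totalDegree ≤ k - 2) → b.IsHomogeneous (k - 2) →
      ∫ x, vval π x ⬝ᵥ crossProduct n (vval a x + pval b x • x.ofLp) ∂(faceMeasure F) = 0) :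
    ∀ x ∈ simplexSet F, vval π x = 0 := by
  obtain ⟨κ₀, κ₁, κ₂, h0, h1, h2, hform⟩ := R.exists_edge_formula
  have hα : (R.coefFst π).totalDegree ≤ k :=
    (totalDegree_pullback_le _ _).trans (totalDegree_constDot_le hdeg)
  have hβ : (R.coefSnd π).totalDegree ≤ k :=
    (totalDegree_pullback_le _ _).trans (totalDegree_constDot_le hdeg)
  have hI' : 2 ≤ k → ∀ (a : Fin 3 → Poly3) (b : Poly3), (∀ i, (a i).totalDegree ≤ k - 2) →
      b.totalDegree ≤ k - 2 →
      simplexInt 2 (R.coefFst π * R.testFst a b + R.coefSnd π * R.testSnd a b) = 0 := by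
    intro h2k a b ha hb
    obtain ⟨h, b', hbb, hh, hb'⟩ := exists_homogeneous_add hb
    have := hI h2k (fun i => a i + b' * MvPolynomial.X i) h (fun i =>
      (MvPolynomial.totalDegree_add _ _).trans (max_le (ha i) (hb' i))) hh
    simp only [← test_eq_of_decomp hbb] at this
    rw [R.face_formula hπ] at this
    exact (mul_eq_zero.1 this).resolve_left (simplexJac_pos R.indep).ne'
  have hI0 : 2 ≤ k → ∀ c d : MvPolynomial (Fin 2) ℝ, c.totalDegree ≤ k - 2 →
      d.totalDegree ≤ k - 2 → simplexInt 2 (R.coefFst π * c + R.coefSnd π * d) = 0 := by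
    intro h2k c d hc hd
    obtain ⟨a, ha, rfl, rfl⟩ := R.exists_constant_test c d hc hd
    exact hI' h2k a 0 ha (by simp)
  have hαβ : R.coefFst π = 0 ∧ R.coefSnd π = 0 := by
    refine bdm_unisolvent hk hα hβ ?_ ?_ ?_ hI0 ?_
    · have := hE _ R.edge_subset.1 (R.edge_card (by decide)) (R.lift (R.coefFst π))
        ((R.totalDegree_lift_le _).trans hα)
      rw [(hform π hπ _).1, R.pullback_lift] at this
      exact eq_zero_of_simplexInt_mul_self ((mul_eq_zero.1 this).resolve_left h0)
    · have := hE _ R.edge_subset.2.1 (R.edge_card (by decide)) (R.lift (R.coefSnd π))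
        ((R.totalDegree_lift_le _).trans hβ)
      rw [(hform π hπ _).2.1, R.pullback_lift] at this
      exact eq_zero_of_simplexInt_mul_self ((mul_eq_zero.1 this).resolve_left h1)
    · have := hE _ R.edge_subset.2.2 (R.edge_card (by decide))
        (R.lift (R.coefFst π + R.coefSnd π)) ((R.totalDegree_lift_le _).trans
          ((MvPolynomial.totalDegree_add _ _).trans (max_le hα hβ)))
      rw [(hform π hπ _).2.2, R.pullback_lift] at this
      exact eq_zero_of_simplexInt_mul_self ((mul_eq_zero.1 this).resolve_left h2)
    · intro h2k q hq
      -- The choice b = q / det yields the rotated radial field plus multiples of q caused by v₀;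
      -- the latter are removed with `hI0`.
      have hb : (R.det⁻¹ • R.lift q).totalDegree ≤ k - 2 :=
        (MvPolynomial.totalDegree_smul_le _ _).trans ((R.totalDegree_lift_le q).trans hq)
      have h := hI' h2k 0 (R.det⁻¹ • R.lift q) (fun i => by simp) hb
      have h' := hI0 h2k ((crossProduct R.t₁ n ⬝ᵥ (R.v 0).ofLp) • R.det⁻¹ • q)
        ((crossProduct R.t₂ n ⬝ᵥ (R.v 0).ofLp) • R.det⁻¹ • q)
        ((MvPolynomial.totalDegree_smul_le _ _).trans
          ((MvPolynomial.totalDegree_smul_le _ _).trans hq))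
        ((MvPolynomial.totalDegree_smul_le _ _).trans
          ((MvPolynomial.totalDegree_smul_le _ _).trans hq))
      have hc0 : ∀ m : Vec, constDot m 0 = 0 := fun m => by simp [constDot]
      rw [testFst_eq, testSnd_eq, map_smul, R.pullback_lift, smul_smul R.det,
        mul_inv_cancel₀ (show R.det ≠ 0 from R.jac), one_smul, hc0, hc0, map_zero, zero_add,
        zero_add] at h
      rw [← sub_zero (0 : ℝ)]
      nth_rewrite 1 [← h]
      rw [← h', ← map_sub]
      congr 1
      ring
  exact R.eq_zero_of_coef hπ hαβ.1 hαβ.2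

end FaceFrame

/-- The field on a face given by a polynomial field, extended by zero. -/
def faceField (F : Finset E3) (P : Fin 3 → Poly3) : E3 → Vec :=
  fun x i => (simplexSet F).indicator (pval (P i)) x

lemma faceField_of_mem {F : Finset E3} (P : Fin 3 → Poly3) {x : E3} (hx : x ∈ simplexSet F) :
    faceField F P x = vval P x := by
  funext i
  rw [faceField, Set.indicator_of_mem hx]
  rfl

lemma faceField_of_notMem {F : Finset E3} (P : Fin 3 → Poly3) {x : E3} (hx : x ∉ simplexSet F) :
    faceField F P x = 0 := by
  funext i
  rw [faceField, Set.indicator_of_notMem hx]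
  rfl

lemma mem_tangentialFacePoly_iff {j : ℕ} {F : Finset E3} {v : E3 → Vec} :
    v ∈ tangentialFacePoly j F ↔ ∃ P : Fin 3 → Poly3, (∀ i, (P i).totalDegree ≤ j) ∧
      (∀ x ∈ simplexSet F, IsTangential F (vval P x)) ∧ v = faceField F P := by
  constructor
  · rintro ⟨h, ht⟩
    choose P hP hv using h
    have hv' : v = faceField F P := by
      funext x i
      exact congrFun (hv i) x
    refine ⟨P, hP, fun x hx => ?_, hv'⟩
    rw [← faceField_of_mem P hx, ← hv']
    exact ht x hx
  · rintro ⟨P, hP, ht, rfl⟩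
    refine ⟨fun i => ⟨P i, hP i, rfl⟩, fun x hx => ?_⟩
    rw [faceField_of_mem P hx]
    exact ht x hx

/-- The cross product of a constant vector with a polynomial field. -/
def constCross (n : Vec) (P : Fin 3 → Poly3) : Fin 3 → Poly3 :=
  crossProduct (fun i => MvPolynomial.C (n i)) P

lemma vval_constCross (n : Vec) (P : Fin 3 → Poly3) (x : E3) :
    vval (constCross n P) x = crossProduct n (vval P x) := by
  funext i
  fin_cases i <;> simp [constCross, vval, cross_apply, pval]

lemma vval_sub (P Q : Fin 3 → Poly3) (x : E3) : vval (P - Q) x = vval P x - vval Q x := by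
  funext i; simp [vval, pval_sub]

lemma totalDegree_constCross_le {n : Vec} {P : Fin 3 → Poly3} {k : ℕ}
    (h : ∀ i, (P i).totalDegree ≤ k) (i : Fin 3) : (constCross n P i).totalDegree ≤ k := by
  have key : ∀ a b : Fin 3, (MvPolynomial.C (n a) * P b).totalDegree ≤ k := fun a b =>
    (totalDegree_mul_le_of_le (MvPolynomial.totalDegree_C _).le (h b)).trans (by simp)
  fin_cases i <;>
  exact (MvPolynomial.totalDegree_sub _ _).trans (max_le (key _ _) (key _ _))

lemma ae_edge_mem {F e : Finset E3} (he : e ⊆ F) : ∀ᵐ x ∂(edgeMeasure e), x ∈ simplexSet F := by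
  filter_upwards [ae_restrict_mem (isClosed_simplexSet e).measurableSet] with x hx
  exact convexHull_mono (Finset.coe_subset.2 he) hx

lemma isDivFaceProjection_congr {k : ℕ} {F : Finset E3} {n : Vec} {g π π' : E3 → Vec}
    (h : ∀ x ∈ simplexSet F, π x = π' x) (hπ : IsDivFaceProjection k F n g π) :
    IsDivFaceProjection k F n g π' := by
  refine ⟨fun e he h2 w hw => ?_, fun h2k a b ha hb => ?_⟩
  · have h1 := hπ.1 e he h2 w hw
    rwa [integral_congr_ae (g := fun x => (π' x ⬝ᵥ outwardNormal F e) * pval w x)] at h1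
    filter_upwards [ae_edge_mem he] with x hx
    rw [h x hx]
  · rw [← hπ.2 h2k a b ha hb]
    refine integral_congr_ae ?_
    filter_upwards [ae_mem_simplexSet F] with x hx
    rw [h x hx]

lemma dot_constCross (n : Vec) (P : Fin 3 → Poly3) (x : E3) :
    n ⬝ᵥ vval (constCross n P) x = 0 := by
  rw [vval_constCross, dot_self_cross]

namespace FaceFrame

variable {F : Finset E3} {n : Vec}

lemma continuous_vval_apply (P : Fin 3 → Poly3) (i : Fin 3) : Continuous fun x => vval P x i :=
  continuous_pval _

lemma continuous_test (a : Fin 3 → Poly3) (b : Poly3) (i : Fin 3) :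
    Continuous fun x : E3 => crossProduct n (vval a x + pval b x • x.ofLp) i := by
  have h := continuous_vval_apply (constCross n fun i => a i + b * MvPolynomial.X i) i
  simpa only [vval_constCross, vval_test] using h

/-- Limits are unique, so n × (P - P') has vanishing moments and is zero; n × is injective on
tangential fields. -/
lemma div_unique (R : FaceFrame F n) {k : ℕ} (hk : 1 ≤ k) {g : E3 → Vec} {P P' : Fin 3 → Poly3}
    (hdeg : ∀ i, (P i).totalDegree ≤ k) (hdeg' : ∀ i, (P' i).totalDegree ≤ k)
    (ht : ∀ x ∈ simplexSet F, IsTangential F (vval P x))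
    (ht' : ∀ x ∈ simplexSet F, IsTangential F (vval P' x))
    (h : IsDivFaceProjection k F n g fun x => crossProduct n (faceField F P x))
    (h' : IsDivFaceProjection k F n g fun x => crossProduct n (faceField F P' x)) :
    ∀ x ∈ simplexSet F, vval P x = vval P' x := by
  have hc : ∀ Q : Fin 3 → Poly3, ∀ x ∈ simplexSet F,
      crossProduct n (faceField F Q x) = vval (constCross n Q) x := fun Q x hx => by
    rw [faceField_of_mem Q hx, vval_constCross]
  replace h := isDivFaceProjection_congr (hc P) h
  replace h' := isDivFaceProjection_congr (hc P') h'
  have hsub : ∀ x, vval (constCross n (P - P')) x =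
      vval (constCross n P) x - vval (constCross n P') x := by
    intro x
    rw [vval_constCross, vval_constCross, vval_constCross, vval_sub, map_sub]
  obtain ⟨κ₀, κ₁, κ₂, -, -, -, hform⟩ := R.exists_edge_formula
  have hz := R.eq_zero_of_moments hk (π := constCross n (P - P'))
    (totalDegree_constCross_le fun i => (MvPolynomial.totalDegree_sub _ _).trans
      (max_le (hdeg i) (hdeg' i))) (fun x _ => dot_constCross n _ x) ?_ ?_
  · intro x hx
    have h0 := hz x hx
    rw [vval_constCross] at h0
    have h1 : n ⬝ᵥ vval (P - P') x = 0 := by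
      rw [vval_sub, dotProduct_sub, (R.perp _).1 (ht x hx), (R.perp _).1 (ht' x hx), sub_zero]
    have h2 := cross_cross_normal R.unit h1
    rw [h0, map_zero, vval_sub, eq_comm, neg_eq_zero, sub_eq_zero] at h2
    exact h2
  · intro e he h2 w hw
    have e1 := (h.1 e he h2 w hw).unique (h'.1 e he h2 w hw)
    have hi : ∀ f : Poly3, Integrable (pval f) (edgeMeasure e) := by
      intro f
      obtain ⟨p, q, -, rfl⟩ := Finset.card_eq_two.1 h2
      have := integrable_simplex ![p, q] (continuous_pval f)
      rw [edgeMeasure, simplexSet]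
      convert this using 3
      rw [Matrix.range_cons, Matrix.range_cons, Matrix.range_empty]
      ext x
      simp [or_comm]
    have hi' : ∀ Q : Fin 3 → Poly3, Integrable
        (fun x => (vval Q x ⬝ᵥ outwardNormal F e) * pval w x) (edgeMeasure e) := fun Q => by
      have := hi (constDot (outwardNormal F e) Q * w)
      refine this.congr (ae_of_all _ fun x => ?_)
      simp only [pval_mul, pval_constDot, dotProduct_comm]
    simp only [hsub, sub_dotProduct, sub_mul]
    rw [integral_sub (hi' _) (hi' _), e1, sub_self]
  · intro h2k a b ha hb
    have e1 := (h.2 h2k a b ha hb).trans (h'.2 h2k a b ha hb).symm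
    have hi' : ∀ Q : Fin 3 → Poly3, Integrable (fun x => vval Q x ⬝ᵥ
        crossProduct n (vval a x + pval b x • x.ofLp)) (faceMeasure F) := fun Q =>
      integrable_faceMeasure R.card (by
        simp only [dotProduct]
        exact continuous_finsetSum _ fun i _ =>
          (continuous_vval_apply Q i).mul (continuous_test a b i))
    simp only [hsub, sub_dotProduct]
    rw [integral_sub (hi' _) (hi' _), e1, sub_self]

end FaceFrame

/-- Polynomials of degree at most `k`. -/
abbrev PolyLE (m k : ℕ) : Type := MvPolynomial.restrictTotalDegree (Fin m) ℝ k

lemma PolyLE.deg {m k : ℕ} (p : PolyLE m k) : (p : MvPolynomial (Fin m) ℝ).totalDegree ≤ k :=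
  (MvPolynomial.mem_restrictTotalDegree _ _ _).1 p.2

/-- A polynomial with a degree bound. -/
def PolyLE.mk {m k : ℕ} (p : MvPolynomial (Fin m) ℝ) (h : p.totalDegree ≤ k) : PolyLE m k :=
  ⟨p, (MvPolynomial.mem_restrictTotalDegree _ _ _).2 h⟩

instance (m k : ℕ) : FiniteDimensional ℝ (PolyLE m k) := by
  unfold PolyLE
  infer_instance

/-- Uniqueness of limits makes the chosen moments linear in the test polynomial. -/
lemma exists_edgeMoment_linear {k : ℕ} {F e : Finset E3} (h3 : F.card = 3) {g : E3 → Vec}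
    (hg : MemLp g 2 (faceMeasure F))
    (h : ∀ w : Poly3, w.totalDegree ≤ k → ∃ m : ℝ, HasEdgeMoment F e g w m) :
    ∃ L : PolyLE 3 k →ₗ[ℝ] ℝ, ∀ w : PolyLE 3 k, HasEdgeMoment F e g w (L w) := by
  choose m hm using fun w : PolyLE 3 k => h w w.deg
  refine ⟨{ toFun := m, map_add' := fun w w' => ?_, map_smul' := fun c w => ?_ }, hm⟩
  · exact (hm (w + w')).unique ((hm w).add h3 hg (hm w'))
  · exact (hm (c • w)).unique ((hm w).smul c)

/-! ### Existence of the divergence-conforming projection by duality. -/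

namespace FaceFrame

variable {F : Finset E3} {n : Vec} (R : FaceFrame F n)

/-- The test functions `n × (a + b x)` of the interior moments. -/
abbrev TestSpace (j : ℕ) : Type := (Fin 3 → PolyLE 3 j) × PolyLE 3 j

/-- `testFst` as a linear map. -/
def testFstₗ (j : ℕ) : TestSpace j →ₗ[ℝ] MvPolynomial (Fin 2) ℝ where
  toFun w := R.testFst (fun i => w.1 i) w.2
  map_add' w w' := by
    simp only [testFst, constDot, ← map_add, ← Finset.sum_add_distrib]
    congr 1
    refine Finset.sum_congr rfl fun i _ => ?_
    simp only [Prod.fst_add, Prod.snd_add, Pi.add_apply, Submodule.coe_add]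
    ring
  map_smul' c w := by
    simp only [testFst, constDot, RingHom.id_apply, ← map_smul, Finset.smul_sum]
    congr 1
    refine Finset.sum_congr rfl fun i _ => ?_
    simp only [Prod.smul_fst, Prod.smul_snd, Pi.smul_apply, Submodule.coe_smul,
      MvPolynomial.smul_eq_C_mul]
    ring

/-- `testSnd` as a linear map. -/
def testSndₗ (j : ℕ) : TestSpace j →ₗ[ℝ] MvPolynomial (Fin 2) ℝ where
  toFun w := R.testSnd (fun i => w.1 i) w.2
  map_add' w w' := by
    simp only [testSnd, constDot, ← map_add, ← Finset.sum_add_distrib]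
    congr 1
    refine Finset.sum_congr rfl fun i _ => ?_
    simp only [Prod.fst_add, Prod.snd_add, Pi.add_apply, Submodule.coe_add]
    ring
  map_smul' c w := by
    simp only [testSnd, constDot, RingHom.id_apply, ← map_smul, Finset.smul_sum]
    congr 1
    refine Finset.sum_congr rfl fun i _ => ?_
    simp only [Prod.smul_fst, Prod.smul_snd, Pi.smul_apply, Submodule.coe_smul,
      MvPolynomial.smul_eq_C_mul]
    ring

/-- The interior moments of a square integrable field. -/
lemma exists_interiorMoment_linear (R : FaceFrame F n) {g : E3 → Vec} (hg : MemLp g 2 (faceMeasure F)) (j : ℕ) :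
    ∃ L : TestSpace j →ₗ[ℝ] ℝ, ∀ w, L w = ∫ x, g x ⬝ᵥ crossProduct n
      (vval (fun i => (w.1 i : Poly3)) x + pval (w.2 : Poly3) x • x.ofLp) ∂(faceMeasure F) := by
  have hi : ∀ w : TestSpace j, Integrable (fun x => g x ⬝ᵥ crossProduct n
      (vval (fun i => (w.1 i : Poly3)) x + pval (w.2 : Poly3) x • x.ofLp)) (faceMeasure F) :=
    fun w => integrable_dot R.card hg (continuous_test _ _)
  refine ⟨{ toFun := _, map_add' := fun w w' => ?_, map_smul' := fun c w => ?_ }, fun w => rfl⟩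
  · rw [← integral_add (hi w) (hi w')]
    refine integral_congr_ae (ae_of_all _ fun x => ?_)
    simp only
    rw [← dotProduct_add, ← map_add]
    congr 2
    funext i
    simp only [vval, Pi.add_apply, Pi.smul_apply, smul_eq_mul, Prod.fst_add, Prod.snd_add,
      Submodule.coe_add, pval_add]
    ring
  · rw [RingHom.id_apply, smul_eq_mul, ← integral_const_mul]
    refine integral_congr_ae (ae_of_all _ fun x => ?_)
    simp only
    rw [← smul_eq_mul, ← dotProduct_smul, ← map_smul]
    congr 2
    funext i
    simp only [vval, Pi.add_apply, Pi.smul_apply, smul_eq_mul, Prod.smul_fst, Prod.smul_snd,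
      Submodule.coe_smul, pval_smul]
    ring

lemma pval_eq_zero_of_pullback_edge {p q : E3} {w : Poly3} (h : pullback ![p, q] w = 0) :
    ∀ x ∈ affineSpan ℝ (({p, q} : Finset E3) : Set E3), pval w x = 0 := by
  intro x hx
  rw [Finset.coe_pair, mem_affineSpan_pair_iff_exists_lineMap_eq] at hx
  obtain ⟨t, rfl⟩ := hx
  have : AffineMap.lineMap p q t = simplexParam ![p, q] (fun _ => t) := by
    simp [simplexParam, AffineMap.lineMap_apply, add_comm]
  rw [this, ← eval_pullback, h, map_zero]

/-- The field with given coefficients with respect to the frame. -/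
def ofCoef (α β : MvPolynomial (Fin 2) ℝ) : Fin 3 → Poly3 := fun i =>
  MvPolynomial.C (R.t₁ i) * R.lift α + MvPolynomial.C (R.t₂ i) * R.lift β

lemma constDot_ofCoef (m : Vec) (α β : MvPolynomial (Fin 2) ℝ) :
    constDot m (R.ofCoef α β) = (m ⬝ᵥ R.t₁) • R.lift α + (m ⬝ᵥ R.t₂) • R.lift β := by
  simp only [constDot, ofCoef, Fin.sum_univ_three, dot_fin_three, MvPolynomial.smul_eq_C_mul,
    map_add, map_mul]
  ring

lemma dot_ofCoef (α β : MvPolynomial (Fin 2) ℝ) (x : E3) :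
    n ⬝ᵥ vval (R.ofCoef α β) x = 0 := by
  rw [← pval_constDot, constDot_ofCoef, normal_dot_t₁, normal_dot_t₂, zero_smul, zero_smul,
    add_zero, pval_zero]

lemma coefFst_ofCoef (α β : MvPolynomial (Fin 2) ℝ) : R.coefFst (R.ofCoef α β) = α := by
  rw [coefFst, constDot_ofCoef, t₁, t₂, R.e₁_fst, R.e₁_snd, one_smul, zero_smul, add_zero,
    pullback_lift]

lemma coefSnd_ofCoef (α β : MvPolynomial (Fin 2) ℝ) : R.coefSnd (R.ofCoef α β) = β := by
  rw [coefSnd, constDot_ofCoef, t₁, t₂, R.e₂_fst, R.e₂_snd, one_smul, zero_smul, zero_add,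
    pullback_lift]

lemma totalDegree_ofCoef_le {α β : MvPolynomial (Fin 2) ℝ} {k : ℕ} (hα : α.totalDegree ≤ k)
    (hβ : β.totalDegree ≤ k) (i : Fin 3) : (R.ofCoef α β i).totalDegree ≤ k := by
  refine (MvPolynomial.totalDegree_add _ _).trans (max_le ?_ ?_)
  · exact (totalDegree_mul_le_of_le (MvPolynomial.totalDegree_C _).le
      ((R.totalDegree_lift_le α).trans hα)).trans (by simp)
  · exact (totalDegree_mul_le_of_le (MvPolynomial.totalDegree_C _).le
      ((R.totalDegree_lift_le β).trans hβ)).trans (by simp)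

/-- The moments of tangential fields as a bilinear form. -/
def momentForm (k : ℕ) (κ₀ κ₁ κ₂ κ : ℝ) : PolyLE 2 k × PolyLE 2 k →ₗ[ℝ]
    (PolyLE 3 k × PolyLE 3 k × PolyLE 3 k) × TestSpace (k - 2) →ₗ[ℝ] ℝ :=
  LinearMap.mk₂ ℝ (fun v w =>
      κ₀ * simplexInt 1 (traceFst v.1.1 * traceFst (pullback R.v w.1.1)) +
      κ₁ * simplexInt 1 (traceSnd v.2.1 * traceSnd (pullback R.v w.1.2.1)) +
      κ₂ * simplexInt 1 (traceSlant (v.1.1 + v.2.1) * traceSlant (pullback R.v w.1.2.2)) +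
      κ * simplexInt 2 (v.1.1 * R.testFstₗ _ w.2 + v.2.1 * R.testSndₗ _ w.2))
    (fun v v' w => by
      simp only [Prod.fst_add, Prod.snd_add, Submodule.coe_add, map_add, add_mul]
      ring)
    (fun c v w => by
      simp only [Prod.smul_fst, Prod.smul_snd, Submodule.coe_smul, map_add, map_smul, add_mul,
        smul_mul_assoc, smul_eq_mul]
      ring)
    (fun v w w' => by
      simp only [Prod.fst_add, Prod.snd_add, Submodule.coe_add, map_add, mul_add]
      ring)
    (fun c v w => by
      simp only [Prod.smul_fst, Prod.smul_snd, Submodule.coe_smul, map_add, map_smul, mul_add,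
        mul_smul_comm, smul_eq_mul]
      ring)

lemma momentForm_apply (k : ℕ) (κ₀ κ₁ κ₂ κ : ℝ) (v : PolyLE 2 k × PolyLE 2 k)
    (w : (PolyLE 3 k × PolyLE 3 k × PolyLE 3 k) × TestSpace (k - 2)) :
    R.momentForm k κ₀ κ₁ κ₂ κ v w =
      κ₀ * simplexInt 1 (traceFst v.1.1 * traceFst (pullback R.v w.1.1)) +
      κ₁ * simplexInt 1 (traceSnd v.2.1 * traceSnd (pullback R.v w.1.2.1)) +
      κ₂ * simplexInt 1 (traceSlant (v.1.1 + v.2.1) * traceSlant (pullback R.v w.1.2.2)) +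
      κ * simplexInt 2 (v.1.1 * R.testFstₗ _ w.2 + v.2.1 * R.testSndₗ _ w.2) := rfl

/-- This is `bdm_dual_unisolvent` with weights. The test parameters themselves need not vanish, only
what they induce on the edges and the face, since polynomials in space are redundant there. -/
lemma momentForm_kernel {k : ℕ} (hk : 1 ≤ k) {κ₀ κ₁ κ₂ κ : ℝ} (h0 : κ₀ ≠ 0) (h1 : κ₁ ≠ 0)
    (h2 : κ₂ ≠ 0) (hκ : 2 ≤ k ∨ κ = 0)
    {w : (PolyLE 3 k × PolyLE 3 k × PolyLE 3 k) × TestSpace (k - 2)}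
    (h : ∀ v, R.momentForm k κ₀ κ₁ κ₂ κ v w = 0) :
    traceFst (pullback R.v w.1.1) = 0 ∧ traceSnd (pullback R.v w.1.2.1) = 0 ∧
      traceSlant (pullback R.v w.1.2.2) = 0 ∧ κ • R.testFstₗ _ w.2 = 0 ∧
      κ • R.testSndₗ _ w.2 = 0 := by
  have hpb : ∀ (p : PolyLE 3 k) (tr : MvPolynomial (Fin 2) ℝ →ₐ[ℝ] MvPolynomial (Fin 1) ℝ)
      (a b : E3) (_ : ∀ f, pullback ![a, b] f = tr (pullback R.v f)) (c : ℝ),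
      (c • tr (pullback R.v p)).totalDegree ≤ k := fun p tr a b htr c => by
    refine (MvPolynomial.totalDegree_smul_le _ _).trans ?_
    rw [← htr]
    exact (totalDegree_pullback_le _ _).trans p.deg
  have hc0 : ∀ (m : Vec), (κ • (pullback R.v (constDot m fun i => (w.2.1 i : Poly3)) +
      (m ⬝ᵥ (R.v 0).ofLp) • pullback R.v (w.2.2 : Poly3))).totalDegree ≤ k - 2 := fun m =>
    (MvPolynomial.totalDegree_smul_le _ _).trans ((MvPolynomial.totalDegree_add _ _).trans
      (max_le ((totalDegree_pullback_le _ _).trans (totalDegree_constDot_le fun i => (w.2.1 i).deg))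
        ((MvPolynomial.totalDegree_smul_le _ _).trans
          ((totalDegree_pullback_le _ _).trans w.2.2.deg))))
  have hq : (κ • R.det • pullback R.v (w.2.2 : Poly3)).totalDegree ≤ k - 2 :=
    (MvPolynomial.totalDegree_smul_le _ _).trans ((MvPolynomial.totalDegree_smul_le _ _).trans
      ((totalDegree_pullback_le _ _).trans w.2.2.deg))
  have main := bdm_dual_unisolvent hk (hpb w.1.1 traceFst _ _ R.pullback_edge_fst κ₀)
    (hpb w.1.2.1 traceSnd _ _ R.pullback_edge_snd κ₁)
    (hpb w.1.2.2 traceSlant _ _ R.pullback_edge_slant κ₂)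
    (c := κ • R.testFstₗ _ w.2) (d := κ • R.testSndₗ _ w.2)
    (hc0 (crossProduct R.t₁ n)) (hc0 (crossProduct R.t₂ n)) hq
    (by
      change κ • R.testFst _ _ = _
      rw [testFst_eq, smul_sub, mul_smul_comm κ])
    (by
      change κ • R.testSnd _ _ = _
      rw [testSnd_eq, smul_add, mul_smul_comm κ])
    (hκ.imp_right fun h => by simp [h])
    (fun α β hα hβ => by
      have := h (PolyLE.mk α hα, PolyLE.mk β hβ)
      rw [momentForm_apply] at this
      simp only [PolyLE.mk] at this
      rw [← this]
      simp only [mul_smul_comm, ← smul_add, map_smul, smul_eq_mul])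
  exact ⟨(smul_eq_zero.1 main.1).resolve_left h0, (smul_eq_zero.1 main.2.1).resolve_left h1,
    (smul_eq_zero.1 main.2.2.1).resolve_left h2, main.2.2.2⟩

/-- A linear functional on the moments that vanishes where the moments vanish is attained. -/
lemma exists_momentForm_eq {k : ℕ} {κ₀ κ₁ κ₂ κ δ : ℝ} (L₀ L₁ L₂ : PolyLE 3 k →ₗ[ℝ] ℝ)
    (L : TestSpace (k - 2) →ₗ[ℝ] ℝ)
    (h : ∀ w : (PolyLE 3 k × PolyLE 3 k × PolyLE 3 k) × TestSpace (k - 2),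
      (∀ v, R.momentForm k κ₀ κ₁ κ₂ κ v w = 0) →
        L₀ w.1.1 = 0 ∧ L₁ w.1.2.1 = 0 ∧ L₂ w.1.2.2 = 0 ∧ δ * L w.2 = 0) :
    ∃ α β : PolyLE 2 k,
      (∀ w : PolyLE 3 k, κ₀ * simplexInt 1 (traceFst α.1 * traceFst (pullback R.v w)) = L₀ w) ∧
      (∀ w : PolyLE 3 k, κ₁ * simplexInt 1 (traceSnd β.1 * traceSnd (pullback R.v w)) = L₁ w) ∧
      (∀ w : PolyLE 3 k, κ₂ * simplexInt 1 (traceSlant (α.1 + β.1) * traceSlant (pullback R.v w)) =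
        L₂ w) ∧
      ∀ w : TestSpace (k - 2),
        κ * simplexInt 2 (α.1 * R.testFstₗ _ w + β.1 * R.testSndₗ _ w) = δ * L w := by
  let l : (PolyLE 3 k × PolyLE 3 k × PolyLE 3 k) × TestSpace (k - 2) →ₗ[ℝ] ℝ :=
    (L₀.coprod (L₁.coprod L₂)).coprod (δ • L)
  have hl : ∀ w, l w = L₀ w.1.1 + (L₁ w.1.2.1 + L₂ w.1.2.2) + δ * L w.2 := fun w => rfl
  obtain ⟨v, hv⟩ := exists_representer (R.momentForm k κ₀ κ₁ κ₂ κ) l (fun w hw => by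
    obtain ⟨a, b, c, d⟩ := h w hw
    rw [hl, a, b, c, d]
    norm_num)
  have hv' : ∀ w, R.momentForm k κ₀ κ₁ κ₂ κ v w =
      L₀ w.1.1 + (L₁ w.1.2.1 + L₂ w.1.2.2) + δ * L w.2 := fun w => by rw [hv, hl]
  simp only [momentForm_apply] at hv'
  refine ⟨v.1, v.2, fun w => ?_, fun w => ?_, fun w => ?_, fun w => ?_⟩
  · simpa only [Submodule.coe_zero, map_zero, mul_zero, add_zero] using hv' ((w, 0, 0), 0)
  · simpa only [Submodule.coe_zero, map_zero, mul_zero, add_zero, zero_add] using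
      hv' ((0, w, 0), 0)
  · simpa only [Submodule.coe_zero, map_zero, mul_zero, add_zero, zero_add] using
      hv' ((0, 0, w), 0)
  · simpa only [Submodule.coe_zero, Prod.fst_zero, Prod.snd_zero, map_zero, mul_zero, add_zero,
      zero_add] using hv' (0, w)

/-- Existence of the divergence-conforming projection. -/
lemma div_exists (R : FaceFrame F n) {k : ℕ} (hk : 1 ≤ k) {g : E3 → Vec}
    (hg : MemLp g 2 (faceMeasure F)) (hgt : ∀ᵐ x ∂(faceMeasure F), IsTangential F (g x))
    (hE : ∀ e : Finset E3, e ⊆ F → e.card = 2 → ∀ w : Poly3, w.totalDegree ≤ k →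
      ∃ m : ℝ, HasEdgeMoment F e g w m) :
    ∃ P : Fin 3 → Poly3, (∀ i, (P i).totalDegree ≤ k) ∧
      (∀ x ∈ simplexSet F, IsTangential F (vval P x)) ∧
      IsDivFaceProjection k F n g fun x => crossProduct n (faceField F P x) := by
  obtain ⟨κ₀, κ₁, κ₂, h0, h1, h2, hform⟩ := R.exists_edge_formula
  obtain ⟨L₀, hL₀⟩ := exists_edgeMoment_linear R.card hg
    (hE _ R.edge_subset.1 (R.edge_card (by decide)))
  obtain ⟨L₁, hL₁⟩ := exists_edgeMoment_linear R.card hg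
    (hE _ R.edge_subset.2.1 (R.edge_card (by decide)))
  obtain ⟨L₂, hL₂⟩ := exists_edgeMoment_linear R.card hg
    (hE _ R.edge_subset.2.2 (R.edge_card (by decide)))
  obtain ⟨L, hL⟩ := R.exists_interiorMoment_linear hg (k - 2)
  -- For k = 1 no interior moments are prescribed, but the truncated k - 2 = 0 keeps constants in
  -- `TestSpace`; δ switches them off.
  obtain ⟨δ, hδ, hδ'⟩ : ∃ δ : ℝ, (2 ≤ k ∨ δ = 0) ∧ (2 ≤ k → δ = 1) := by
    by_cases h : 2 ≤ k
    · exact ⟨1, Or.inl h, fun _ => rfl⟩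
    · exact ⟨0, Or.inr rfl, fun h' => absurd h' h⟩
  have hJ := (simplexJac_pos R.indep).ne'
  -- A test polynomial in the kernel vanishes on the edge, hence so does its moment of g; the
  -- prescribed edge data are compatible.
  have hnull : ∀ {p q : E3} {w : Poly3} {m : ℝ}, pullback ![p, q] w = 0 →
      HasEdgeMoment F {p, q} g w m → m = 0 := fun hw hm =>
    hm.unique (hasEdgeMoment_zero_of_vanish R.card (by simp) hg (pval_eq_zero_of_pullback_edge hw))
  obtain ⟨α, β, hv₀, hv₁, hv₂, hv₃⟩ := R.exists_momentForm_eq (κ₀ := κ₀) (κ₁ := κ₁) (κ₂ := κ₂)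
    (κ := δ * simplexJac R.v) (δ := δ) L₀ L₁ L₂ L (by
    intro w hw
    obtain ⟨k0, k1, k2, k3, k4⟩ := R.momentForm_kernel hk h0 h1 h2
      (hδ.imp_right fun h => by rw [h, zero_mul]) hw
    have e0 := hnull (by rw [R.pullback_edge_fst]; exact k0) (hL₀ w.1.1)
    have e1 := hnull (by rw [R.pullback_edge_snd]; exact k1) (hL₁ w.1.2.1)
    have e2 := hnull (by rw [R.pullback_edge_slant]; exact k2) (hL₂ w.1.2.2)
    -- Both frame components of the test function vanish on F, and g is tangential almost
    -- everywhere, so the interior moment sees nothing else.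
    have e3 : δ * L w.2 = 0 := by
      rcases eq_or_ne δ 0 with hδ0 | hδ0
      · rw [hδ0, zero_mul]
      · have k3' := (R.pullback_eq_zero_iff _).1 ((smul_eq_zero.1 k3).resolve_left
          (mul_ne_zero hδ0 hJ))
        have k4' := (R.pullback_eq_zero_iff _).1 ((smul_eq_zero.1 k4).resolve_left
          (mul_ne_zero hδ0 hJ))
        rw [hL, integral_eq_zero_of_ae, mul_zero]
        filter_upwards [hgt, ae_mem_simplexSet F] with x hx hxF
        rw [Pi.zero_apply, R.expand _ ((R.perp _).1 hx), add_dotProduct, smul_dotProduct,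
          smul_dotProduct, dot_cross_eq, dot_cross_eq, ← vval_test, ← pval_constDot,
          ← pval_constDot]
        have a3 := k3' x hxF
        have a4 := k4' x hxF
        rw [t₁] at a3
        rw [t₂] at a4
        rw [a3, a4, smul_zero, smul_zero, add_zero]
    exact ⟨e0, e1, e2, e3⟩)
  set π := R.ofCoef α.1 β.1 with hπ
  have hπt : ∀ x, n ⬝ᵥ vval π x = 0 := R.dot_ofCoef _ _
  have hπd : ∀ i, (π i).totalDegree ≤ k := R.totalDegree_ofCoef_le α.deg β.deg
  have hdiv : IsDivFaceProjection k F n g (vval π) := by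
    refine ⟨fun e he he2 w hw => ?_, fun h2k a b ha hb => ?_⟩
    · have hf := hform π (fun x _ => hπt x) w
      rw [hπ, coefFst_ofCoef, coefSnd_ofCoef, ← hπ] at hf
      rcases R.edge_cases he he2 with rfl | rfl | rfl
      · have h1 := hL₀ (PolyLE.mk w hw)
        rw [← hv₀] at h1
        rw [hf.1]
        exact h1
      · have h1 := hL₁ (PolyLE.mk w hw)
        rw [← hv₁] at h1
        rw [hf.2.1]
        exact h1
      · have h1 := hL₂ (PolyLE.mk w hw)
        rw [← hv₂] at h1
        rw [hf.2.2]
        exact h1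
    · rw [R.face_formula (fun x _ => hπt x), hπ, coefFst_ofCoef, coefSnd_ofCoef]
      have := hv₃ (fun i => PolyLE.mk (a i) (ha i), PolyLE.mk b hb.totalDegree_le)
      rw [hδ' h2k, one_mul, one_mul, hL] at this
      exact this
  -- The projection is n × û. On tangential fields n × squares to minus the identity, so û is
  -- recovered as -n × π.
  have hcc : ∀ x, crossProduct n (vval (constCross (-n) π) x) = vval π x := by
    intro x
    rw [vval_constCross, map_neg, LinearMap.neg_apply, map_neg,
      cross_cross_normal R.unit (hπt x), neg_neg]
  refine ⟨constCross (-n) π, totalDegree_constCross_le hπd, fun x _ => (R.perp _).2 ?_,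
    isDivFaceProjection_congr (fun x hx => ?_) hdiv⟩
  · rw [vval_constCross, map_neg, LinearMap.neg_apply, dotProduct_neg, dot_self_cross, neg_zero]
  · rw [faceField_of_mem _ hx, hcc]

end FaceFrame

/-! ### The L²-projection of tangential fields on a face. -/

namespace FaceFrame

variable {F : Finset E3} {n : Vec}

lemma eq_zero_of_integral_mul_self (R : FaceFrame F n) {p : Poly3}
    (h : ∫ x, pval p x * pval p x ∂(faceMeasure F) = 0) : ∀ x ∈ simplexSet F, pval p x = 0 := by
  have h' : ∫ x, pval (p * p) x ∂(faceMeasure F) = 0 := by simpa only [pval_mul] using h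
  rw [R.integral_face, map_mul] at h'
  exact (R.pullback_eq_zero_iff p).1 (eq_zero_of_simplexInt_mul_self
    ((mul_eq_zero.1 h').resolve_left (simplexJac_pos R.indep).ne'))

/-- The L² form on a face is degenerate on polynomials in space, but its kernel consists of
polynomials vanishing on F, where the functional vanishes as well. -/
lemma exists_scalar_projection (R : FaceFrame F n) (j : ℕ) {h : E3 → ℝ}
    (hh : Integrable h (faceMeasure F)) : ∃ p : PolyLE 3 j, ∀ w : PolyLE 3 j,
      ∫ x, pval (p : Poly3) x * pval (w : Poly3) x ∂(faceMeasure F) =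
        ∫ x, h x * pval (w : Poly3) x ∂(faceMeasure F) := by
  let Φ : PolyLE 3 j →ₗ[ℝ] PolyLE 3 j →ₗ[ℝ] ℝ := LinearMap.mk₂ ℝ
    (fun v w => simplexJac R.v * simplexInt 2 (pullback R.v (v * w)))
    (fun v v' w => by simp only [Submodule.coe_add, add_mul, map_add, mul_add])
    (fun c v w => by
      simp only [Submodule.coe_smul, smul_mul_assoc, map_smul, smul_eq_mul]; ring)
    (fun v w w' => by simp only [Submodule.coe_add, mul_add, map_add])
    (fun c v w => by
      simp only [Submodule.coe_smul, mul_smul_comm, map_smul, smul_eq_mul]; ring)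
  have hΦ : ∀ v w : PolyLE 3 j, Φ v w =
      ∫ x, pval (v : Poly3) x * pval (w : Poly3) x ∂(faceMeasure F) := by
    intro v w
    simp only [← pval_mul]
    rw [R.integral_face]
    rfl
  have hi : ∀ w : Poly3, Integrable (fun x => h x * pval w x) (faceMeasure F) := fun w =>
    integrable_mul_of_continuous hh (continuous_pval w)
  let l : PolyLE 3 j →ₗ[ℝ] ℝ :=
    { toFun := fun w => ∫ x, h x * pval (w : Poly3) x ∂(faceMeasure F)
      map_add' := fun w w' => by
        rw [← integral_add (hi w) (hi w')]
        simp only [Submodule.coe_add, pval_add, mul_add]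
      map_smul' := fun c w => by
        rw [RingHom.id_apply, smul_eq_mul, ← integral_const_mul]
        simp only [Submodule.coe_smul, pval_smul, mul_left_comm] }
  obtain ⟨p, hp⟩ := exists_representer Φ l fun w hw => by
    have h0 := hw w
    rw [hΦ] at h0
    have hz := R.eq_zero_of_integral_mul_self h0
    refine integral_eq_zero_of_ae ?_
    filter_upwards [ae_mem_simplexSet F] with x hx
    rw [hz x hx, mul_zero, Pi.zero_apply]
  exact ⟨p, fun w => by rw [← hΦ, hp]; rfl⟩

lemma isL2FaceProjection_congr {j : ℕ} {g π π' : E3 → Vec}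
    (h : ∀ x ∈ simplexSet F, π x = π' x) (hπ : IsL2FaceProjection j F g π) :
    IsL2FaceProjection j F g π' := by
  intro w hw
  rw [← hπ w hw]
  refine integral_congr_ae ?_
  filter_upwards [ae_mem_simplexSet F] with x hx
  rw [h x hx]

lemma continuous_vval_dot (P Q : Fin 3 → Poly3) : Continuous fun x => vval P x ⬝ᵥ vval Q x := by
  simp only [dotProduct]
  exact continuous_finsetSum _ fun i _ =>
    (continuous_vval_apply P i).mul (continuous_vval_apply Q i)

/-- Existence of the tangential `L²`-projection. -/
lemma l2_exists (R : FaceFrame F n) (j : ℕ) {g : E3 → Vec}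
    (hg : MemLp g 2 (faceMeasure F)) (hgt : ∀ᵐ x ∂(faceMeasure F), IsTangential F (g x)) :
    ∃ P : Fin 3 → Poly3, (∀ i, (P i).totalDegree ≤ j) ∧
      (∀ x ∈ simplexSet F, IsTangential F (vval P x)) ∧
      IsL2FaceProjection j F g fun x => crossProduct n (faceField F P x) := by
  choose p hp using fun i => R.exists_scalar_projection j (memLp_dot R.card hg i)
  set π : Fin 3 → Poly3 := fun i => (p i : Poly3) with hπ
  have hπd : ∀ i, (π i).totalDegree ≤ j := fun i => (p i).deg
  have hπ2 : IsL2FaceProjection j F g (vval π) := by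
    intro w hw
    have hi : ∀ i, Integrable (fun x => g x i * vval w x i) (faceMeasure F) := fun i =>
      integrable_mul_of_continuous (memLp_dot R.card hg i) (continuous_pval _)
    have hi' : ∀ i, Integrable (fun x => vval π x i * vval w x i) (faceMeasure F) := fun i =>
      integrable_faceMeasure R.card ((continuous_vval_apply _ i).mul (continuous_vval_apply _ i))
    simp only [dotProduct]
    rw [integral_finsetSum _ fun i _ => hi i, integral_finsetSum _ fun i _ => hi' i]
    exact Finset.sum_congr rfl fun i _ => hp i (PolyLE.mk (w i) (hw i))
  -- Testing with (n · π) n gives ∫ (n · π)² = ∫ (n · π)(g · n) = 0, so the componentwise projection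
  -- of a tangential field is tangential.
  have hnπ : ∀ x ∈ simplexSet F, n ⬝ᵥ vval π x = 0 := by
    have hz := R.eq_zero_of_integral_mul_self (p := constDot n π) ?_
    · intro x hx
      rw [← pval_constDot]
      exact hz x hx
    · have h1 := hπ2 (fun i => MvPolynomial.C (n i) * constDot n π) fun i =>
        (totalDegree_mul_le_of_le (MvPolynomial.totalDegree_C _).le
          (totalDegree_constDot_le hπd)).trans (by simp)
      have hv : ∀ x, vval (fun i => MvPolynomial.C (n i) * constDot n π) x =
          pval (constDot n π) x • n := by
        intro x
        funext i
        simp only [vval, pval_mul, pval_C, Pi.smul_apply, smul_eq_mul, mul_comm]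
      simp only [hv, dotProduct_smul] at h1
      rw [integral_eq_zero_of_ae (f := fun x => pval (constDot n π) x • (g x ⬝ᵥ n))] at h1
      · rw [← h1]
        refine integral_congr_ae (ae_of_all _ fun x => ?_)
        simp only [smul_eq_mul]
        rw [dotProduct_comm, ← pval_constDot]
      · filter_upwards [hgt] with x hx
        rw [dotProduct_comm, (R.perp _).1 hx, smul_zero, Pi.zero_apply]
  have hcc : ∀ x ∈ simplexSet F, crossProduct n (vval (constCross (-n) π) x) = vval π x := by
    intro x hx
    rw [vval_constCross, map_neg, LinearMap.neg_apply, map_neg,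
      cross_cross_normal R.unit (hnπ x hx), neg_neg]
  refine ⟨constCross (-n) π, totalDegree_constCross_le hπd, fun x _ => (R.perp _).2 ?_,
    isL2FaceProjection_congr (fun x hx => ?_) hπ2⟩
  · rw [vval_constCross, map_neg, LinearMap.neg_apply, dotProduct_neg, dot_self_cross, neg_zero]
  · rw [faceField_of_mem _ hx, hcc x hx]

lemma eq_of_cross_eq (R : FaceFrame F n) {a b : Vec} (ha : IsTangential F a)
    (hb : IsTangential F b) (h : crossProduct n a = crossProduct n b) : a = b := by
  have h1 : n ⬝ᵥ (a - b) = 0 := by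
    rw [dotProduct_sub, (R.perp _).1 ha, (R.perp _).1 hb, sub_zero]
  have h2 := cross_cross_normal R.unit h1
  rw [map_sub, h, sub_self, map_zero, eq_comm, neg_eq_zero, sub_eq_zero] at h2
  exact h2

lemma l2_unique (R : FaceFrame F n) {j : ℕ} {g : E3 → Vec} {P P' : Fin 3 → Poly3}
    (hdeg : ∀ i, (P i).totalDegree ≤ j) (hdeg' : ∀ i, (P' i).totalDegree ≤ j)
    (ht : ∀ x ∈ simplexSet F, IsTangential F (vval P x))
    (ht' : ∀ x ∈ simplexSet F, IsTangential F (vval P' x))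
    (h : IsL2FaceProjection j F g fun x => crossProduct n (faceField F P x))
    (h' : IsL2FaceProjection j F g fun x => crossProduct n (faceField F P' x)) :
    ∀ x ∈ simplexSet F, vval P x = vval P' x := by
  have hc : ∀ Q : Fin 3 → Poly3, ∀ x ∈ simplexSet F,
      crossProduct n (faceField F Q x) = vval (constCross n Q) x := fun Q x hx => by
    rw [faceField_of_mem Q hx, vval_constCross]
  replace h := isL2FaceProjection_congr (hc P) h
  replace h' := isL2FaceProjection_congr (hc P') h'
  set D := constCross n P - constCross n P' with hD
  have hDd : ∀ i, (D i).totalDegree ≤ j := fun i => (MvPolynomial.totalDegree_sub _ _).trans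
    (max_le (totalDegree_constCross_le hdeg i) (totalDegree_constCross_le hdeg' i))
  have e := (h D hDd).trans (h' D hDd).symm
  have hI : ∀ Q Q' : Fin 3 → Poly3, Integrable (fun x => vval Q x ⬝ᵥ vval Q' x) (faceMeasure F) :=
    fun Q Q' => integrable_faceMeasure R.card (continuous_vval_dot Q Q')
  have e2 : ∫ x, vval D x ⬝ᵥ vval D x ∂(faceMeasure F) = 0 := by
    nth_rewrite 1 [hD]
    simp only [vval_sub, sub_dotProduct]
    rw [integral_sub (hI _ _) (hI _ _), e, sub_self]
  simp only [dotProduct] at e2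
  have hI' : ∀ i, Integrable (fun x => vval D x i * vval D x i) (faceMeasure F) := fun i =>
    integrable_faceMeasure R.card ((continuous_vval_apply _ i).mul (continuous_vval_apply _ i))
  rw [integral_finsetSum _ fun i _ => hI' i, Finset.sum_eq_zero_iff_of_nonneg
    fun i _ => integral_nonneg fun x => mul_self_nonneg _] at e2
  intro x hx
  refine R.eq_of_cross_eq (ht x hx) (ht' x hx) ?_
  rw [← vval_constCross, ← vval_constCross, ← sub_eq_zero, ← vval_sub]
  funext i
  exact R.eq_zero_of_integral_mul_self (e2 i (Finset.mem_univ i)) x hx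

end FaceFrame

/-! ### Polynomial representation of the scheme -/

lemma pval_dot (v w : Fin 3 → Poly3) (x : E3) : pval (v ⬝ᵥ w) x = vval v x ⬝ᵥ vval w x := by
  simp [dotProduct, pval, vval]

/-- A ball containing two distinct vertices has radius at least half their distance. -/
lemma faceDiam_pos {F : Finset E3} (h3 : F.card = 3) : 0 < faceDiam F := by
  obtain ⟨a, b, c, rfl, -, hab, -⟩ := exists_enum_three h3
  refine mul_pos two_pos (lt_of_lt_of_le (half_pos (dist_pos.2 hab)) (le_csInf ?_ ?_))
  · obtain ⟨R, hR⟩ := (isCompact_simplexSet {a, b, c}).isBounded.subset_closedBall (0 : E3)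
    exact ⟨max R 0, le_max_right _ _, 0, hR.trans (Metric.closedBall_subset_closedBall
      (le_max_left _ _))⟩
  · rintro ρ ⟨-, z, hz⟩
    have h1 : dist a z ≤ ρ := hz (subset_convexHull ℝ _ (by simp))
    have h2 : dist b z ≤ ρ := hz (subset_convexHull ℝ _ (by simp))
    linarith [dist_triangle_right a b z]

namespace SimplicialMesh

variable {Ω : Set E3} (M : SimplicialMesh Ω)

/-- Tuples of polynomials on the cells and faces. -/
abbrev PolyTuple : Type :=
  (M.cells → Fin 3 → Poly3) × (M.cells → Fin 3 → Poly3) × (M.faces → Fin 3 → Poly3) ×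
    (M.faces → Fin 3 → Poly3) × (M.cells → Poly3) × (M.faces → Poly3)

variable {M}

namespace PolyTuple

/-- The component `r`. -/
abbrev r (σ : M.PolyTuple) := σ.1
/-- The component `u`. -/
abbrev u (σ : M.PolyTuple) := σ.2.1
/-- The component `û`. -/
abbrev uHat (σ : M.PolyTuple) := σ.2.2.1
/-- The component `ĉ`. -/
abbrev cHat (σ : M.PolyTuple) := σ.2.2.2.1
/-- The component `p`. -/
abbrev p (σ : M.PolyTuple) := σ.2.2.2.2.1
/-- The component `p̂`. -/
abbrev pHat (σ : M.PolyTuple) := σ.2.2.2.2.2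

/-- The tuple of functions given by a tuple of polynomials. -/
def toTuple (σ : M.PolyTuple) : HDGTuple M where
  r := r σ
  u := u σ
  uHat F := faceField F.1 (uHat σ F)
  cHat F := faceField F.1 (cHat σ F)
  p := p σ
  pHat F := (simplexSet F.1).indicator (pval (pHat σ F))

end PolyTuple

open scoped Classical in
/-- The sum over all pairs of a cell and one of its faces. -/
def pairSum (φ : M.cells → M.faces → ℝ) : ℝ :=
  ∑ T : M.cells, ∑ F : M.faces with F.1 ⊆ T.1, φ T F

lemma pairSum_congr {φ ψ : M.cells → M.faces → ℝ} (h : ∀ T F, F.1 ⊆ T.1 → φ T F = ψ T F) :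
    pairSum φ = pairSum ψ :=
  Finset.sum_congr rfl fun T _ => Finset.sum_congr rfl fun F hF =>
    h T F (Finset.mem_filter.1 hF).2

lemma pairSum_add (φ ψ : M.cells → M.faces → ℝ) :
    pairSum (fun T F => φ T F + ψ T F) = pairSum φ + pairSum ψ := by
  simp only [pairSum, Finset.sum_add_distrib]

lemma pairSum_mul (c : ℝ) (φ : M.cells → M.faces → ℝ) :
    pairSum (fun T F => c * φ T F) = c * pairSum φ := by
  simp only [pairSum, Finset.mul_sum]

lemma pairSum_zero : pairSum (fun (_ : M.cells) (_ : M.faces) => (0 : ℝ)) = 0 := by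
  simp [pairSum]

lemma pairSum_nonneg {φ : M.cells → M.faces → ℝ} (h : ∀ T F, 0 ≤ φ T F) : 0 ≤ pairSum φ :=
  Finset.sum_nonneg fun T _ => Finset.sum_nonneg fun F _ => h T F

lemma eq_zero_of_pairSum {φ : M.cells → M.faces → ℝ} (h : ∀ T F, 0 ≤ φ T F)
    (h0 : pairSum φ = 0) {T : M.cells} {F : M.faces} (hFT : F.1 ⊆ T.1) : φ T F = 0 := by
  have h1 := (Finset.sum_eq_zero_iff_of_nonneg fun T _ => Finset.sum_nonneg fun F _ => h T F).1 h0
    T (Finset.mem_univ _)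
  exact (Finset.sum_eq_zero_iff_of_nonneg fun F _ => h T F).1 h1 F
    (Finset.mem_filter.2 ⟨Finset.mem_univ _, hFT⟩)

lemma cellSum_eq {φ : M.cells → E3 → ℝ} {Q : M.cells → Poly3} (h : ∀ T x, φ T x = pval (Q T) x) :
    M.cellSum φ = ∑ T, cellInt T (Q T) := by
  refine Finset.sum_congr rfl fun T _ => ?_
  simp only [cellInt_apply, h]

lemma boundarySum_eq {φ : M.cells → M.faces → E3 → ℝ} {Q : M.cells → M.faces → Poly3}
    (h : ∀ T F, ∀ x ∈ simplexSet F.1, φ T F x = pval (Q T F) x) :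
    M.boundarySum φ = pairSum fun T F => faceInt F (Q T F) := by
  refine Finset.sum_congr rfl fun T _ => Finset.sum_congr rfl fun F _ => ?_
  change _ = ∫ x, pval (Q T F) x ∂(faceMeasure F.1)
  refine integral_congr_ae ?_
  filter_upwards [ae_mem_simplexSet F.1] with x hx using h T F x hx

/-- `a_h` on polynomials. -/
def aPoly (r s : M.cells → Fin 3 → Poly3) : ℝ := ∑ T, cellInt T (r T ⬝ᵥ s T)

/-- `b_h` on polynomials. -/
def bPoly (u : M.cells → Fin 3 → Poly3) (uHat cHat : M.faces → Fin 3 → Poly3)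
    (s : M.cells → Fin 3 → Poly3) : ℝ :=
  - ∑ T, cellInt T (u T ⬝ᵥ polyCurl (polyCurl (s T)))
  - pairSum (fun T F =>
      faceInt F (constCross (outwardNormal T.1 F.1) (uHat F) ⬝ᵥ polyCurl (s T)))
  - pairSum (fun T F => faceInt F (constCross (outwardNormal T.1 F.1) (cHat F) ⬝ᵥ s T))

/-- `c_h` on polynomials. -/
def cPoly (q : M.cells → Poly3) (qHat : M.faces → Poly3) (u : M.cells → Fin 3 → Poly3) : ℝ :=
  ∑ T, cellInt T (polyDiv (u T) * q T)
  - pairSum (fun T F => faceInt F (constDot (outwardNormal T.1 F.1) (u T) * qHat F))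

/-- `s_h^u` on polynomials. -/
def suPoly (u : M.cells → Fin 3 → Poly3) (uHat cHat : M.faces → Fin 3 → Poly3)
    (v : M.cells → Fin 3 → Poly3) (vHat dHat : M.faces → Fin 3 → Poly3) : ℝ :=
  pairSum (fun T F => (faceDiam F.1 ^ 3)⁻¹ *
    faceInt F (constCross (outwardNormal T.1 F.1) (u T - uHat F) ⬝ᵥ
      constCross (outwardNormal T.1 F.1) (v T - vHat F)))
  + pairSum (fun T F => (faceDiam F.1)⁻¹ *
    faceInt F (constCross (outwardNormal T.1 F.1) (polyCurl (u T) - cHat F) ⬝ᵥ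
      constCross (outwardNormal T.1 F.1) (polyCurl (v T) - dHat F)))

/-- `s_h^p` on polynomials. -/
def spPoly (p : M.cells → Poly3) (pHat : M.faces → Poly3) (q : M.cells → Poly3)
    (qHat : M.faces → Poly3) : ℝ :=
  pairSum (fun T F => (faceDiam F.1)⁻¹ * faceInt F ((p T - pHat F) * (q T - qHat F)))

open PolyTuple in
/-- `B_h` on polynomials. -/
def BPoly (σ τ : M.PolyTuple) : ℝ :=
  aPoly (r σ) (r τ) + bPoly (u σ) (uHat σ) (cHat σ) (r τ)
  + bPoly (u τ) (uHat τ) (cHat τ) (r σ) + cPoly (p σ) (pHat σ) (u τ)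
  - suPoly (u σ) (uHat σ) (cHat σ) (u τ) (uHat τ) (cHat τ)
  + cPoly (p τ) (pHat τ) (u σ) + spPoly (p σ) (pHat σ) (p τ) (pHat τ)

lemma aForm_eq (r s : M.cells → Fin 3 → Poly3) : M.aForm r s = aPoly r s :=
  cellSum_eq fun _ _ => (pval_dot _ _ _).symm

lemma bForm_eq (u : M.cells → Fin 3 → Poly3) (uHat cHat : M.faces → Fin 3 → Poly3)
    (s : M.cells → Fin 3 → Poly3) :
    M.bForm u (fun F => faceField F.1 (uHat F)) (fun F => faceField F.1 (cHat F)) s =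
      bPoly u uHat cHat s := by
  unfold bForm bPoly
  congr 1
  · congr 1
    · exact congrArg _ (cellSum_eq fun _ _ => (pval_dot _ _ _).symm)
    · refine boundarySum_eq fun T F x hx => ?_
      dsimp only
      rw [pval_dot, vval_constCross, faceField_of_mem _ hx]
  · refine boundarySum_eq fun T F x hx => ?_
    dsimp only
    rw [pval_dot, vval_constCross, faceField_of_mem _ hx]

lemma cForm_eq (q : M.cells → Poly3) (qHat : M.faces → Poly3) (u : M.cells → Fin 3 → Poly3) :
    M.cForm q (fun F => (simplexSet F.1).indicator (pval (qHat F))) u = cPoly q qHat u := by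
  unfold cForm cPoly
  congr 1
  · exact cellSum_eq fun _ _ => (pval_mul _ _ _).symm
  · refine boundarySum_eq fun T F x hx => ?_
    dsimp only
    rw [pval_mul, pval_constDot, Set.indicator_of_mem hx]

lemma pairSum_weight (c : M.faces → ℝ) (Q : M.cells → M.faces → Poly3) :
    pairSum (fun T F => faceInt F (c F • Q T F)) = pairSum fun T F => c F * faceInt F (Q T F) := by
  simp only [map_smul, smul_eq_mul]

lemma suForm_eq (u : M.cells → Fin 3 → Poly3) (uHat cHat : M.faces → Fin 3 → Poly3)
    (v : M.cells → Fin 3 → Poly3) (vHat dHat : M.faces → Fin 3 → Poly3) :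
    M.suForm u (fun F => faceField F.1 (uHat F)) (fun F => faceField F.1 (cHat F))
      v (fun F => faceField F.1 (vHat F)) (fun F => faceField F.1 (dHat F)) =
      suPoly u uHat cHat v vHat dHat := by
  unfold suForm suPoly
  congr 1
  · rw [← pairSum_weight]
    refine boundarySum_eq fun T F x hx => ?_
    dsimp only
    rw [pval_smul, pval_dot, vval_constCross, vval_constCross, vval_sub, vval_sub,
      faceField_of_mem _ hx, faceField_of_mem _ hx]
  · rw [← pairSum_weight]
    refine boundarySum_eq fun T F x hx => ?_
    dsimp only
    rw [pval_smul, pval_dot, vval_constCross, vval_constCross, vval_sub, vval_sub,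
      faceField_of_mem _ hx, faceField_of_mem _ hx]

lemma spForm_eq (p : M.cells → Poly3) (pHat : M.faces → Poly3) (q : M.cells → Poly3)
    (qHat : M.faces → Poly3) :
    M.spForm p (fun F => (simplexSet F.1).indicator (pval (pHat F)))
      q (fun F => (simplexSet F.1).indicator (pval (qHat F))) = spPoly p pHat q qHat := by
  unfold spForm spPoly
  rw [← pairSum_weight]
  refine boundarySum_eq fun T F x hx => ?_
  dsimp only
  rw [pval_smul, pval_mul, pval_sub, pval_sub, Set.indicator_of_mem hx, Set.indicator_of_mem hx]

/-- The form only sees values on cells and faces, so the scheme can be studied on polynomial tuples.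
Representatives on faces are not unique; accordingly uniqueness is asserted for `toTuple`. -/
lemma BForm_toTuple (σ τ : M.PolyTuple) : M.BForm σ.toTuple τ.toTuple = BPoly σ τ := by
  unfold BForm BPoly
  simp only [PolyTuple.toTuple]
  rw [aForm_eq, bForm_eq, bForm_eq, cForm_eq, cForm_eq, suForm_eq, spForm_eq]

/-! ### Bilinearity -/

lemma polyCurl_add (v w : Fin 3 → Poly3) : polyCurl (v + w) = polyCurl v + polyCurl w := by
  funext i
  fin_cases i <;> simp [polyCurl] <;> ring

lemma polyCurl_smul (c : ℝ) (v : Fin 3 → Poly3) : polyCurl (c • v) = c • polyCurl v := by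
  funext i
  fin_cases i <;> simp [polyCurl, smul_sub]

lemma polyDiv_add (v w : Fin 3 → Poly3) : polyDiv (v + w) = polyDiv v + polyDiv w := by
  simp [polyDiv, Finset.sum_add_distrib]

lemma polyDiv_smul (c : ℝ) (v : Fin 3 → Poly3) : polyDiv (c • v) = c • polyDiv v := by
  simp [polyDiv, Finset.smul_sum]

lemma constCross_add (n : Vec) (v w : Fin 3 → Poly3) :
    constCross n (v + w) = constCross n v + constCross n w := map_add _ _ _

lemma constCross_smul (n : Vec) (c : ℝ) (v : Fin 3 → Poly3) :
    constCross n (c • v) = c • constCross n v := by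
  funext i
  fin_cases i <;> simp [constCross, cross_apply, smul_sub]

lemma constDot_add (n : Vec) (v w : Fin 3 → Poly3) :
    constDot n (v + w) = constDot n v + constDot n w := by
  simp [constDot, mul_add, Finset.sum_add_distrib]

lemma constDot_smul (n : Vec) (c : ℝ) (v : Fin 3 → Poly3) :
    constDot n (c • v) = c • constDot n v := by
  simp [constDot, Finset.smul_sum]

lemma suPoly_comm (u : M.cells → Fin 3 → Poly3) (uHat cHat : M.faces → Fin 3 → Poly3)
    (v : M.cells → Fin 3 → Poly3) (vHat dHat : M.faces → Fin 3 → Poly3) :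
    suPoly u uHat cHat v vHat dHat = suPoly v vHat dHat u uHat cHat := by
  have h1 : ∀ (T : M.cells) (F : M.faces), F.1 ⊆ T.1 →
      (faceDiam F.1 ^ 3)⁻¹ * faceInt F (constCross (outwardNormal T.1 F.1) (u T - uHat F) ⬝ᵥ
        constCross (outwardNormal T.1 F.1) (v T - vHat F)) =
      (faceDiam F.1 ^ 3)⁻¹ * faceInt F (constCross (outwardNormal T.1 F.1) (v T - vHat F) ⬝ᵥ
        constCross (outwardNormal T.1 F.1) (u T - uHat F)) := fun T F _ => by
    rw [dotProduct_comm (constCross _ (u T - uHat F))]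
  have h2 : ∀ (T : M.cells) (F : M.faces), F.1 ⊆ T.1 →
      (faceDiam F.1)⁻¹ * faceInt F (constCross (outwardNormal T.1 F.1)
        (polyCurl (u T) - cHat F) ⬝ᵥ constCross (outwardNormal T.1 F.1)
          (polyCurl (v T) - dHat F)) =
      (faceDiam F.1)⁻¹ * faceInt F (constCross (outwardNormal T.1 F.1)
        (polyCurl (v T) - dHat F) ⬝ᵥ constCross (outwardNormal T.1 F.1)
          (polyCurl (u T) - cHat F)) := fun T F _ => by
    rw [dotProduct_comm (constCross _ (polyCurl (u T) - cHat F))]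
  rw [suPoly, pairSum_congr h1, pairSum_congr h2, suPoly]

lemma spPoly_comm (p : M.cells → Poly3) (pHat : M.faces → Poly3) (q : M.cells → Poly3)
    (qHat : M.faces → Poly3) : spPoly p pHat q qHat = spPoly q qHat p pHat :=
  pairSum_congr fun _ F _ => congrArg (fun z => _ * faceInt F z) (mul_comm _ _)

/-- Exchanging the arguments swaps the two b-terms and the two c-terms. By symmetry, triviality of
the homogeneous problem also controls the right kernel needed for solvability. -/
lemma BPoly_comm (σ τ : M.PolyTuple) : BPoly σ τ = BPoly τ σ := by
  have h1 : aPoly σ.1 τ.1 = aPoly τ.1 σ.1 :=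
    Finset.sum_congr rfl fun T _ => congrArg (cellInt T) (dotProduct_comm _ _)
  have h2 := suPoly_comm σ.u σ.uHat σ.cHat τ.u τ.uHat τ.cHat
  have h3 := spPoly_comm σ.p σ.pHat τ.p τ.pHat
  unfold BPoly
  rw [h1, h2, h3]
  ring

lemma BPoly_add (σ τ τ' : M.PolyTuple) : BPoly σ (τ + τ') = BPoly σ τ + BPoly σ τ' := by
  have e1 : ∀ a b c d : Fin 3 → Poly3, a + b - (c + d) = (a - c) + (b - d) := fun a b c d => by abel
  have e2 : ∀ a b c d : Poly3, a + b - (c + d) = (a - c) + (b - d) := fun a b c d => by abel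
  simp only [BPoly, aPoly, bPoly, cPoly, suPoly, spPoly, PolyTuple.r, PolyTuple.u, PolyTuple.uHat,
    PolyTuple.cHat, PolyTuple.p, PolyTuple.pHat, Prod.fst_add, Prod.snd_add, Pi.add_apply,
    polyCurl_add, polyDiv_add, constDot_add, e1, e2, constCross_add, dotProduct_add,
    add_dotProduct, mul_add, add_mul, map_add, Finset.sum_add_distrib, pairSum_add]
  ring

lemma BPoly_smul (c : ℝ) (σ τ : M.PolyTuple) : BPoly σ (c • τ) = c * BPoly σ τ := by
  simp only [BPoly, aPoly, bPoly, cPoly, suPoly, spPoly, PolyTuple.r, PolyTuple.u, PolyTuple.uHat,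
    PolyTuple.cHat, PolyTuple.p, PolyTuple.pHat, Prod.smul_fst, Prod.smul_snd,
    Pi.smul_apply, polyCurl_smul, polyDiv_smul, constDot_smul, ← smul_sub, constCross_smul,
    dotProduct_smul, smul_dotProduct, mul_smul_comm, smul_mul_assoc, map_smul, smul_eq_mul,
    mul_left_comm _ c, ← Finset.mul_sum, pairSum_mul]
  ring

lemma BPoly_sub_left (σ σ' τ : M.PolyTuple) : BPoly (σ - σ') τ = BPoly σ τ - BPoly σ' τ := by
  have h : σ - σ' = σ + (-1 : ℝ) • σ' := by rw [neg_one_smul, sub_eq_add_neg]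
  rw [BPoly_comm, h, BPoly_add, BPoly_smul, BPoly_comm τ, BPoly_comm τ]
  ring

end SimplicialMesh

/-! ### Integration by parts for curl, divergence and gradient. -/

lemma totalDegree_polyCurl_le {v : Fin 3 → Poly3} {k : ℕ} (h : ∀ i, (v i).totalDegree ≤ k)
    (i : Fin 3) : (polyCurl v i).totalDegree ≤ k - 1 := by
  have key : ∀ a b : Fin 3, (MvPolynomial.pderiv a (v b)).totalDegree ≤ k - 1 := fun a b =>
    (totalDegree_pderiv_le _ _).trans (Nat.sub_le_sub_right (h b) 1)
  fin_cases i <;>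
  exact (MvPolynomial.totalDegree_sub _ _).trans (max_le (key _ _) (key _ _))

lemma totalDegree_polyDiv_le {v : Fin 3 → Poly3} {k : ℕ} (h : ∀ i, (v i).totalDegree ≤ k) :
    (polyDiv v).totalDegree ≤ k - 1 :=
  MvPolynomial.totalDegree_finsetSum_le fun i _ =>
    (totalDegree_pderiv_le _ _).trans (Nat.sub_le_sub_right (h i) 1)

lemma polyCurl_zero : polyCurl 0 = 0 := by
  funext i
  fin_cases i <;> simp [polyCurl]

/-- The divergence of a cross product. -/
lemma polyDiv_cross (u z : Fin 3 → Poly3) :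
    polyDiv (crossProduct u z) = polyCurl u ⬝ᵥ z - u ⬝ᵥ polyCurl z := by
  simp only [polyDiv, cross_apply, polyCurl, dotProduct, Fin.sum_univ_three, Matrix.cons_val,
    map_sub, Derivation.leibniz, smul_eq_mul]
  ring

lemma constDot_cross (n : Vec) (u z : Fin 3 → Poly3) :
    constDot n (crossProduct u z) = constCross n u ⬝ᵥ z := by
  simp only [constDot, constCross, cross_apply, dotProduct, Fin.sum_univ_three, Matrix.cons_val]
  ring

/-- The gradient of a polynomial. -/
def polyGrad (p : Poly3) : Fin 3 → Poly3 := fun i => MvPolynomial.pderiv i p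

lemma polyDiv_mul (p : Poly3) (v : Fin 3 → Poly3) :
    polyDiv (fun i => p * v i) = polyDiv v * p + v ⬝ᵥ polyGrad p := by
  simp only [polyDiv, polyGrad, dotProduct, Fin.sum_univ_three, Derivation.leibniz, smul_eq_mul]
  ring

lemma constDot_mul (n : Vec) (p : Poly3) (v : Fin 3 → Poly3) :
    constDot n (fun i => p * v i) = constDot n v * p := by
  simp only [constDot, Fin.sum_univ_three]
  ring

namespace SimplicialMesh

variable {Ω : Set E3} {M : SimplicialMesh Ω}

open scoped Classical in
lemma cellInt_pderiv (T : M.cells) (i : Fin 3) (p : Poly3) :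
    cellInt T (MvPolynomial.pderiv i p) =
      ∑ F : M.faces with F.1 ⊆ T.1, outwardNormal T.1 F.1 i * faceInt F p := by
  have h := cellInt_dirDeriv T (EuclideanSpace.single i 1) p
  have e : dirDeriv (EuclideanSpace.single i (1 : ℝ)) p = MvPolynomial.pderiv i p := by
    rw [dirDeriv, Finset.sum_eq_single i]
    · simp
    · intro j _ hj; simp [hj]
    · simp
  rw [e] at h
  rw [h]
  refine Finset.sum_congr rfl fun F _ => ?_
  simp

lemma sum_cellInt_polyDiv (v : M.cells → Fin 3 → Poly3) : ∑ T, cellInt T (polyDiv (v T)) =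
    pairSum fun T F => faceInt F (constDot (outwardNormal T.1 F.1) (v T)) := by
  refine Finset.sum_congr rfl fun T _ => ?_
  rw [polyDiv, map_sum]
  simp only [cellInt_pderiv]
  rw [Finset.sum_comm]
  refine Finset.sum_congr rfl fun F _ => ?_
  simp only [constDot, map_sum, ← MvPolynomial.smul_eq_C_mul, map_smul, smul_eq_mul]

/-- The divergence theorem for u × z, whose flux through a face is (n × u) · z. -/
lemma sum_cellInt_curl (u z : M.cells → Fin 3 → Poly3) :
    ∑ T, cellInt T (polyCurl (u T) ⬝ᵥ z T) = ∑ T, cellInt T (u T ⬝ᵥ polyCurl (z T)) +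
      pairSum fun T F => faceInt F (constCross (outwardNormal T.1 F.1) (u T) ⬝ᵥ z T) := by
  have h := sum_cellInt_polyDiv fun T => crossProduct (u T) (z T)
  simp only [polyDiv_cross, map_sub, Finset.sum_sub_distrib, constDot_cross] at h
  linarith

/-- The divergence theorem for the field p v. -/
lemma sum_cellInt_grad (p : M.cells → Poly3) (v : M.cells → Fin 3 → Poly3) :
    ∑ T, cellInt T (polyDiv (v T) * p T) + ∑ T, cellInt T (v T ⬝ᵥ polyGrad (p T)) =
      pairSum fun T F => faceInt F (constDot (outwardNormal T.1 F.1) (v T) * p T) := by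
  have h := sum_cellInt_polyDiv fun T i => p T * v T i
  simpa only [polyDiv_mul, map_add, Finset.sum_add_distrib, constDot_mul] using h

lemma faceInt_congr {F : M.faces} {p q : Poly3} (h : ∀ x ∈ simplexSet F.1, pval p x = pval q x) :
    faceInt F p = faceInt F q := by
  rw [faceInt_apply, faceInt_apply]
  refine integral_congr_ae ?_
  filter_upwards [ae_mem_simplexSet F.1] with x hx using h x hx

lemma faceInt_eq_zero {F : M.faces} {p : Poly3} (h : ∀ x ∈ simplexSet F.1, pval p x = 0) :
    faceInt F p = 0 := by
  rw [faceInt_congr (q := 0) fun x hx => by rw [h x hx, pval_zero], map_zero]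

lemma pval_dot_self_nonneg (P : Fin 3 → Poly3) (x : E3) : 0 ≤ pval (P ⬝ᵥ P) x := by
  rw [pval_dot]
  exact Finset.sum_nonneg fun i _ => mul_self_nonneg _

lemma cellInt_dot_self_nonneg (T : M.cells) (P : Fin 3 → Poly3) : 0 ≤ cellInt T (P ⬝ᵥ P) :=
  integral_nonneg fun x => pval_dot_self_nonneg P x

lemma faceInt_dot_self_nonneg (F : M.faces) (P : Fin 3 → Poly3) : 0 ≤ faceInt F (P ⬝ᵥ P) :=
  integral_nonneg fun x => pval_dot_self_nonneg P x

lemma eq_zero_of_cellInt_dot_self {T : M.cells} {P : Fin 3 → Poly3}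
    (h : cellInt T (P ⬝ᵥ P) = 0) : P = 0 := by
  have h1 := cellInt_nonneg_eq_zero T (fun x => pval_dot_self_nonneg P x) h
  funext i
  refine eq_zero_of_eqOn_cell T fun x _ => ?_
  have h2 : vval P x ⬝ᵥ vval P x = 0 := by rw [← pval_dot, h1, pval_zero]
  exact congrFun (dotProduct_self_eq_zero.1 h2) i

lemma eq_zero_of_faceInt_dot_self {F : M.faces} {P : Fin 3 → Poly3}
    (h : faceInt F (P ⬝ᵥ P) = 0) : ∀ x ∈ simplexSet F.1, vval P x = 0 := by
  intro x hx
  have h1 := faceInt_nonneg_eq_zero F (fun x _ => pval_dot_self_nonneg P x) h x hx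
  rw [pval_dot] at h1
  exact dotProduct_self_eq_zero.1 h1

lemma eq_zero_of_sum_dot_self {P : M.cells → Fin 3 → Poly3}
    (h : ∑ T, cellInt T (P T ⬝ᵥ P T) = 0) : P = 0 := by
  funext T
  exact eq_zero_of_cellInt_dot_self ((Finset.sum_eq_zero_iff_of_nonneg fun T _ =>
    cellInt_dot_self_nonneg T (P T)).1 h T (Finset.mem_univ T))

lemma bPoly_smul (c : ℝ) (u : M.cells → Fin 3 → Poly3) (uHat cHat : M.faces → Fin 3 → Poly3)
    (s : M.cells → Fin 3 → Poly3) :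
    bPoly (c • u) (c • uHat) (c • cHat) s = c * bPoly u uHat cHat s := by
  simp only [bPoly, Pi.smul_apply, constCross_smul, smul_dotProduct, map_smul, smul_eq_mul,
    ← Finset.mul_sum, pairSum_mul]
  ring

lemma bPoly_zero_right (u : M.cells → Fin 3 → Poly3) (uHat cHat : M.faces → Fin 3 → Poly3) :
    bPoly u uHat cHat 0 = 0 := by
  simp only [bPoly, Pi.zero_apply, polyCurl_zero, dotProduct_zero, map_zero,
    Finset.sum_const_zero, pairSum_zero]
  norm_num

lemma cPoly_smul_right (c : ℝ) (q : M.cells → Poly3) (qHat : M.faces → Poly3)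
    (u : M.cells → Fin 3 → Poly3) : cPoly q qHat (c • u) = c * cPoly q qHat u := by
  simp only [cPoly, Pi.smul_apply, polyDiv_smul, constDot_smul, smul_mul_assoc, map_smul,
    smul_eq_mul, ← Finset.mul_sum, pairSum_mul]
  ring

lemma cPoly_zero_right (q : M.cells → Poly3) (qHat : M.faces → Poly3) : cPoly q qHat 0 = 0 := by
  simpa using cPoly_smul_right 0 q qHat 0

lemma cPoly_zero_left (u : M.cells → Fin 3 → Poly3) : cPoly 0 0 u = 0 := by
  simp only [cPoly, Pi.zero_apply, mul_zero, map_zero, Finset.sum_const_zero, pairSum_zero]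
  norm_num

lemma suPoly_smul_right (c : ℝ) (u : M.cells → Fin 3 → Poly3) (uHat cHat : M.faces → Fin 3 → Poly3)
    (v : M.cells → Fin 3 → Poly3) (vHat dHat : M.faces → Fin 3 → Poly3) :
    suPoly u uHat cHat (c • v) (c • vHat) (c • dHat) = c * suPoly u uHat cHat v vHat dHat := by
  simp only [suPoly, Pi.smul_apply, polyCurl_smul, ← smul_sub, constCross_smul, dotProduct_smul,
    map_smul, smul_eq_mul, mul_left_comm _ c, pairSum_mul]
  ring

/-! ### The trial and test spaces as sets of polynomial tuples. -/

namespace PolyTuple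

/-- The conditions on a tuple of polynomials that do not involve the boundary data. -/
structure Regular (k : ℕ) (σ : M.PolyTuple) : Prop where
  r_deg : ∀ T i, (r σ T i).totalDegree ≤ k - 1
  u_deg : ∀ T i, (u σ T i).totalDegree ≤ k
  uHat_deg : ∀ F i, (uHat σ F i).totalDegree ≤ k
  uHat_tan : ∀ F : M.faces, ∀ x ∈ simplexSet F.1, IsTangential F.1 (vval (uHat σ F) x)
  cHat_deg : ∀ F i, (cHat σ F i).totalDegree ≤ k - 1
  cHat_tan : ∀ F : M.faces, ∀ x ∈ simplexSet F.1, IsTangential F.1 (vval (cHat σ F) x)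
  p_deg : ∀ T, (p σ T).totalDegree ≤ k
  pHat_deg : ∀ F, (pHat σ F).totalDegree ≤ k
  pHat_bd : ∀ F : M.faces, M.IsBoundaryFace F → ∀ x ∈ simplexSet F.1, pval (pHat σ F) x = 0

/-- The conditions defining the homogeneous space. -/
structure Homogeneous (k : ℕ) (σ : M.PolyTuple) : Prop extends Regular k σ where
  uHat_bd : ∀ F : M.faces, M.IsBoundaryFace F → ∀ x ∈ simplexSet F.1, vval (uHat σ F) x = 0
  cHat_bd : ∀ F : M.faces, M.IsBoundaryFace F → ∀ x ∈ simplexSet F.1, vval (cHat σ F) x = 0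

end PolyTuple

lemma isTangential_zero (F : Finset E3) : IsTangential F 0 := Submodule.zero_mem _

lemma isTangential_add {F : Finset E3} {a b : Vec} (ha : IsTangential F a)
    (hb : IsTangential F b) : IsTangential F (a + b) := Submodule.add_mem _ ha hb

lemma isTangential_smul {F : Finset E3} {a : Vec} (ha : IsTangential F a) (c : ℝ) :
    IsTangential F (c • a) := Submodule.smul_mem _ c ha

lemma vval_zero (x : E3) : vval 0 x = 0 := by funext i; simp [vval, pval]
lemma vval_add (P Q : Fin 3 → Poly3) (x : E3) : vval (P + Q) x = vval P x + vval Q x := by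
  funext i; simp [vval, pval]
lemma vval_smul (c : ℝ) (P : Fin 3 → Poly3) (x : E3) : vval (c • P) x = c • vval P x := by
  funext i; simp [vval, pval]

namespace PolyTuple

lemma Regular.zero (k : ℕ) : Regular k (0 : M.PolyTuple) where
  r_deg _ _ := (MvPolynomial.totalDegree_zero).le.trans (Nat.zero_le _)
  u_deg _ _ := (MvPolynomial.totalDegree_zero).le.trans (Nat.zero_le _)
  uHat_deg _ _ := (MvPolynomial.totalDegree_zero).le.trans (Nat.zero_le _)
  uHat_tan _ _ _ := by
    change IsTangential _ (vval 0 _)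
    rw [vval_zero]; exact isTangential_zero _
  cHat_deg _ _ := (MvPolynomial.totalDegree_zero).le.trans (Nat.zero_le _)
  cHat_tan _ _ _ := by
    change IsTangential _ (vval 0 _)
    rw [vval_zero]; exact isTangential_zero _
  p_deg _ := (MvPolynomial.totalDegree_zero).le.trans (Nat.zero_le _)
  pHat_deg _ := (MvPolynomial.totalDegree_zero).le.trans (Nat.zero_le _)
  pHat_bd _ _ _ _ := pval_zero _

lemma Regular.add {k : ℕ} {σ τ : M.PolyTuple} (h : Regular k σ) (h' : Regular k τ) :
    Regular k (σ + τ) where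
  r_deg T i := (MvPolynomial.totalDegree_add _ _).trans (max_le (h.r_deg T i) (h'.r_deg T i))
  u_deg T i := (MvPolynomial.totalDegree_add _ _).trans (max_le (h.u_deg T i) (h'.u_deg T i))
  uHat_deg F i :=
    (MvPolynomial.totalDegree_add _ _).trans (max_le (h.uHat_deg F i) (h'.uHat_deg F i))
  uHat_tan F x hx := by
    change IsTangential _ (vval (uHat σ F + uHat τ F) x)
    rw [vval_add]
    exact isTangential_add (h.uHat_tan F x hx) (h'.uHat_tan F x hx)
  cHat_deg F i :=
    (MvPolynomial.totalDegree_add _ _).trans (max_le (h.cHat_deg F i) (h'.cHat_deg F i))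
  cHat_tan F x hx := by
    change IsTangential _ (vval (cHat σ F + cHat τ F) x)
    rw [vval_add]
    exact isTangential_add (h.cHat_tan F x hx) (h'.cHat_tan F x hx)
  p_deg T := (MvPolynomial.totalDegree_add _ _).trans (max_le (h.p_deg T) (h'.p_deg T))
  pHat_deg F := (MvPolynomial.totalDegree_add _ _).trans (max_le (h.pHat_deg F) (h'.pHat_deg F))
  pHat_bd F hF x hx := by
    change pval (pHat σ F + pHat τ F) x = 0
    rw [pval_add, h.pHat_bd F hF x hx, h'.pHat_bd F hF x hx, add_zero]

lemma Regular.smul {k : ℕ} {σ : M.PolyTuple} (h : Regular k σ) (c : ℝ) :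
    Regular k (c • σ) where
  r_deg T i := (MvPolynomial.totalDegree_smul_le _ _).trans (h.r_deg T i)
  u_deg T i := (MvPolynomial.totalDegree_smul_le _ _).trans (h.u_deg T i)
  uHat_deg F i := (MvPolynomial.totalDegree_smul_le _ _).trans (h.uHat_deg F i)
  uHat_tan F x hx := by
    change IsTangential _ (vval (c • uHat σ F) x)
    rw [vval_smul]
    exact isTangential_smul (h.uHat_tan F x hx) c
  cHat_deg F i := (MvPolynomial.totalDegree_smul_le _ _).trans (h.cHat_deg F i)
  cHat_tan F x hx := by
    change IsTangential _ (vval (c • cHat σ F) x)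
    rw [vval_smul]
    exact isTangential_smul (h.cHat_tan F x hx) c
  p_deg T := (MvPolynomial.totalDegree_smul_le _ _).trans (h.p_deg T)
  pHat_deg F := (MvPolynomial.totalDegree_smul_le _ _).trans (h.pHat_deg F)
  pHat_bd F hF x hx := by
    change pval (c • pHat σ F) x = 0
    rw [pval_smul, h.pHat_bd F hF x hx, mul_zero]

lemma Homogeneous.zero (k : ℕ) : Homogeneous k (0 : M.PolyTuple) where
  toRegular := Regular.zero k
  uHat_bd _ _ _ _ := vval_zero _
  cHat_bd _ _ _ _ := vval_zero _

lemma Homogeneous.add {k : ℕ} {σ τ : M.PolyTuple} (h : Homogeneous k σ) (h' : Homogeneous k τ) :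
    Homogeneous k (σ + τ) where
  toRegular := h.toRegular.add h'.toRegular
  uHat_bd F hF x hx := by
    change vval (uHat σ F + uHat τ F) x = 0
    rw [vval_add, h.uHat_bd F hF x hx, h'.uHat_bd F hF x hx, add_zero]
  cHat_bd F hF x hx := by
    change vval (cHat σ F + cHat τ F) x = 0
    rw [vval_add, h.cHat_bd F hF x hx, h'.cHat_bd F hF x hx, add_zero]

lemma Homogeneous.smul {k : ℕ} {σ : M.PolyTuple} (h : Homogeneous k σ) (c : ℝ) :
    Homogeneous k (c • σ) where
  toRegular := h.toRegular.smul c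
  uHat_bd F hF x hx := by
    change vval (c • uHat σ F) x = 0
    rw [vval_smul, h.uHat_bd F hF x hx, smul_zero]
  cHat_bd F hF x hx := by
    change vval (c • cHat σ F) x = 0
    rw [vval_smul, h.cHat_bd F hF x hx, smul_zero]

variable (M) in
/-- The homogeneous space as a space of polynomial tuples. -/
def homogeneousSpace (k : ℕ) : Submodule ℝ M.PolyTuple where
  carrier := {σ | Homogeneous k σ}
  add_mem' := Homogeneous.add
  zero_mem' := Homogeneous.zero k
  smul_mem' c _ h := Homogeneous.smul h c

instance (k : ℕ) : FiniteDimensional ℝ (homogeneousSpace M k) := by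
  -- All degree bounds are relaxed to k: the homogeneous space lies in the range of a
  -- finite-dimensional space.
  let X := (M.cells → Fin 3 → PolyLE 3 k) × (M.cells → Fin 3 → PolyLE 3 k) ×
    (M.faces → Fin 3 → PolyLE 3 k) × (M.faces → Fin 3 → PolyLE 3 k) × (M.cells → PolyLE 3 k) ×
    (M.faces → PolyLE 3 k)
  let L : X →ₗ[ℝ] M.PolyTuple :=
    { toFun := fun y => (fun T i => y.1 T i, fun T i => y.2.1 T i, fun F i => y.2.2.1 F i,
        fun F i => y.2.2.2.1 F i, fun T => y.2.2.2.2.1 T, fun F => y.2.2.2.2.2 F)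
      map_add' := fun _ _ => rfl
      map_smul' := fun _ _ => rfl }
  refine Submodule.finiteDimensional_of_le (S₂ := LinearMap.range L) fun σ h => ?_
  have h : Homogeneous k σ := h
  exact ⟨(fun T i => PolyLE.mk _ ((h.r_deg T i).trans (Nat.sub_le k 1)),
    fun T i => PolyLE.mk _ (h.u_deg T i), fun F i => PolyLE.mk _ (h.uHat_deg F i),
    fun F i => PolyLE.mk _ ((h.cHat_deg F i).trans (Nat.sub_le k 1)),
    fun T => PolyLE.mk _ (h.p_deg T), fun F => PolyLE.mk _ (h.pHat_deg F)), rfl⟩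

end PolyTuple

end SimplicialMesh

/-! ### The energy argument and its consequences for the homogeneous problem. -/

namespace SimplicialMesh

variable {Ω : Set E3} {M : SimplicialMesh Ω}

open PolyTuple

/-- The stabilisation of the tuple vanishes. -/
structure StabZero (σ : M.PolyTuple) : Prop where
  tr_u : ∀ (T : M.cells) (F : M.faces), F.1 ⊆ T.1 → ∀ x ∈ simplexSet F.1,
    crossProduct (outwardNormal T.1 F.1) (vval (u σ T) x) =
      crossProduct (outwardNormal T.1 F.1) (vval (uHat σ F) x)
  tr_c : ∀ (T : M.cells) (F : M.faces), F.1 ⊆ T.1 → ∀ x ∈ simplexSet F.1,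
    crossProduct (outwardNormal T.1 F.1) (vval (polyCurl (u σ T)) x) =
      crossProduct (outwardNormal T.1 F.1) (vval (cHat σ F) x)
  tr_p : ∀ (T : M.cells) (F : M.faces), F.1 ⊆ T.1 → ∀ x ∈ simplexSet F.1,
    pval (p σ T) x = pval (pHat σ F) x

lemma faceDiam_face_pos (F : M.faces) : 0 < faceDiam F.1 := faceDiam_pos (M.mem_faces.1 F.2).2

lemma suPoly_self (u : M.cells → Fin 3 → Poly3) (uHat cHat : M.faces → Fin 3 → Poly3) :
    0 ≤ suPoly u uHat cHat u uHat cHat ∧ (suPoly u uHat cHat u uHat cHat = 0 →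
      ∀ (T : M.cells) (F : M.faces), F.1 ⊆ T.1 → ∀ x ∈ simplexSet F.1,
        vval (constCross (outwardNormal T.1 F.1) (u T - uHat F)) x = 0 ∧
        vval (constCross (outwardNormal T.1 F.1) (polyCurl (u T) - cHat F)) x = 0) := by
  have hA : ∀ (T : M.cells) (F : M.faces), 0 ≤ (faceDiam F.1 ^ 3)⁻¹ *
      faceInt F (constCross (outwardNormal T.1 F.1) (u T - uHat F) ⬝ᵥ
        constCross (outwardNormal T.1 F.1) (u T - uHat F)) := fun T F =>
    mul_nonneg (inv_nonneg.2 (pow_nonneg (faceDiam_face_pos F).le 3)) (faceInt_dot_self_nonneg F _)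
  have hB : ∀ (T : M.cells) (F : M.faces), 0 ≤ (faceDiam F.1)⁻¹ *
      faceInt F (constCross (outwardNormal T.1 F.1) (polyCurl (u T) - cHat F) ⬝ᵥ
        constCross (outwardNormal T.1 F.1) (polyCurl (u T) - cHat F)) := fun T F =>
    mul_nonneg (inv_nonneg.2 (faceDiam_face_pos F).le) (faceInt_dot_self_nonneg F _)
  have hA' := pairSum_nonneg hA
  have hB' := pairSum_nonneg hB
  refine ⟨add_nonneg hA' hB', fun h T F hFT x hx => ?_⟩
  have h2 := (add_eq_zero_iff_of_nonneg hA' hB').1 h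
  have hd := (faceDiam_face_pos F).ne'
  exact ⟨eq_zero_of_faceInt_dot_self ((mul_eq_zero.1 (eq_zero_of_pairSum hA h2.1 hFT)).resolve_left
    (inv_ne_zero (pow_ne_zero 3 hd))) x hx, eq_zero_of_faceInt_dot_self
    ((mul_eq_zero.1 (eq_zero_of_pairSum hB h2.2 hFT)).resolve_left (inv_ne_zero hd)) x hx⟩

lemma faceInt_mul_self_nonneg (F : M.faces) (p : Poly3) : 0 ≤ faceInt F (p * p) :=
  integral_nonneg fun x => by
    rw [pval_mul]
    exact mul_self_nonneg _

lemma eq_zero_of_faceInt_mul_self {F : M.faces} {p : Poly3} (h : faceInt F (p * p) = 0) :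
    ∀ x ∈ simplexSet F.1, pval p x = 0 := by
  intro x hx
  have h1 := faceInt_nonneg_eq_zero F (fun x _ => by
    rw [pval_mul]; exact mul_self_nonneg _) h x hx
  rw [pval_mul] at h1
  exact mul_self_eq_zero.1 h1

lemma eq_zero_of_sum_mul_self {P : M.cells → Poly3} (h : ∑ T, cellInt T (P T * P T) = 0) :
    P = 0 := by
  have h0 : ∀ (p : Poly3) (x : E3), 0 ≤ pval (p * p) x := fun p x => by
    rw [pval_mul]; exact mul_self_nonneg _
  funext T
  exact mul_self_eq_zero.1 (cellInt_nonneg_eq_zero T (h0 _)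
    ((Finset.sum_eq_zero_iff_of_nonneg fun T _ => integral_nonneg (h0 (P T))).1 h T
      (Finset.mem_univ T)))

lemma spPoly_self (p : M.cells → Poly3) (pHat : M.faces → Poly3) :
    0 ≤ spPoly p pHat p pHat ∧ (spPoly p pHat p pHat = 0 →
      ∀ (T : M.cells) (F : M.faces), F.1 ⊆ T.1 → ∀ x ∈ simplexSet F.1,
        pval (p T - pHat F) x = 0) := by
  have hA : ∀ (T : M.cells) (F : M.faces), 0 ≤ (faceDiam F.1)⁻¹ *
      faceInt F ((p T - pHat F) * (p T - pHat F)) := fun T F =>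
    mul_nonneg (inv_nonneg.2 (faceDiam_face_pos F).le) (faceInt_mul_self_nonneg F _)
  refine ⟨pairSum_nonneg hA, fun h T F hFT x hx => ?_⟩
  exact eq_zero_of_faceInt_mul_self ((mul_eq_zero.1 (eq_zero_of_pairSum hA h hFT)).resolve_left
    (inv_ne_zero (faceDiam_face_pos F).ne')) x hx

/-- The energy argument. -/
lemma energy {k : ℕ} {σ : M.PolyTuple} (hσ : Homogeneous k σ)
    (h : ∀ τ, Homogeneous k τ → BPoly σ τ = 0) : r σ = 0 ∧ StabZero σ := by
  have hσ' := hσ.smul (-1)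
  -- With the signs of u, û and ĉ reversed, the b- and c-terms cancel and the nonnegative terms (r,
  -- r), s^u and s^p add up to zero.
  have h0 := h (r σ, (-1 : ℝ) • u σ, (-1 : ℝ) • uHat σ, (-1 : ℝ) • cHat σ, p σ, pHat σ)
    { r_deg := hσ.r_deg
      u_deg := hσ'.u_deg
      uHat_deg := hσ'.uHat_deg
      uHat_tan := hσ'.uHat_tan
      cHat_deg := hσ'.cHat_deg
      cHat_tan := hσ'.cHat_tan
      p_deg := hσ.p_deg
      pHat_deg := hσ.pHat_deg
      pHat_bd := hσ.pHat_bd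
      uHat_bd := hσ'.uHat_bd
      cHat_bd := hσ'.cHat_bd }
  rw [BPoly] at h0
  simp only [PolyTuple.r, PolyTuple.u, PolyTuple.uHat, PolyTuple.cHat, PolyTuple.p,
    PolyTuple.pHat] at h0
  rw [bPoly_smul, cPoly_smul_right, suPoly_smul_right] at h0
  have hsu := suPoly_self (u σ) (uHat σ) (cHat σ)
  have hsp := spPoly_self (p σ) (pHat σ)
  have ha : 0 ≤ aPoly (r σ) (r σ) := Finset.sum_nonneg fun T _ => cellInt_dot_self_nonneg T _
  have hsu0 := hsu.1
  have hsp0 := hsp.1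
  have e1 : aPoly (r σ) (r σ) = 0 := by linarith
  have e2 : suPoly (u σ) (uHat σ) (cHat σ) (u σ) (uHat σ) (cHat σ) = 0 := by linarith
  have e3 : spPoly (p σ) (pHat σ) (p σ) (pHat σ) = 0 := by linarith
  refine ⟨eq_zero_of_sum_dot_self e1, fun T F hFT x hx => ?_, fun T F hFT x hx => ?_,
    fun T F hFT x hx => ?_⟩
  · have := (hsu.2 e2 T F hFT x hx).1
    rwa [vval_constCross, vval_sub, map_sub, sub_eq_zero] at this
  · have := (hsu.2 e2 T F hFT x hx).2
    rwa [vval_constCross, vval_sub, map_sub, sub_eq_zero] at this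
  · have := hsp.2 e3 T F hFT x hx
    rwa [pval_sub, sub_eq_zero] at this

/-- What survives splits into three constraints, tested separately with s, with v and with (q, q̂)
below. -/
lemma BPoly_eq_of_stabZero {σ : M.PolyTuple} (hr : r σ = 0) (hz : StabZero σ) (τ : M.PolyTuple) :
    BPoly σ τ = bPoly (u σ) (uHat σ) (cHat σ) (r τ) + cPoly (p σ) (pHat σ) (u τ) +
      cPoly (p τ) (pHat τ) (u σ) := by
  have h1 : suPoly (u σ) (uHat σ) (cHat σ) (u τ) (uHat τ) (cHat τ) = 0 := by
    have hA : ∀ (T : M.cells) (F : M.faces), F.1 ⊆ T.1 → (faceDiam F.1 ^ 3)⁻¹ *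
        faceInt F (constCross (outwardNormal T.1 F.1) (u σ T - uHat σ F) ⬝ᵥ
        constCross (outwardNormal T.1 F.1) (u τ T - uHat τ F)) = 0 := fun T F hFT => by
      rw [faceInt_eq_zero, mul_zero]
      intro x hx
      rw [pval_dot, vval_constCross, vval_sub, map_sub, hz.tr_u T F hFT x hx, sub_self,
        zero_dotProduct]
    have hB : ∀ (T : M.cells) (F : M.faces), F.1 ⊆ T.1 → (faceDiam F.1)⁻¹ *
        faceInt F (constCross (outwardNormal T.1 F.1) (polyCurl (u σ T) - cHat σ F) ⬝ᵥ
        constCross (outwardNormal T.1 F.1) (polyCurl (u τ T) - cHat τ F)) = 0 :=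
      fun T F hFT => by
      rw [faceInt_eq_zero, mul_zero]
      intro x hx
      rw [pval_dot, vval_constCross, vval_sub, map_sub, hz.tr_c T F hFT x hx, sub_self,
        zero_dotProduct]
    rw [suPoly, pairSum_congr hA, pairSum_congr hB, pairSum_zero, add_zero]
  have h2 : spPoly (p σ) (pHat σ) (p τ) (pHat τ) = 0 := by
    have hA : ∀ (T : M.cells) (F : M.faces), F.1 ⊆ T.1 → (faceDiam F.1)⁻¹ *
        faceInt F ((p σ T - pHat σ F) * (p τ T - pHat τ F)) = 0 := fun T F hFT => by
      rw [faceInt_eq_zero, mul_zero]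
      intro x hx
      rw [pval_mul, pval_sub, hz.tr_p T F hFT x hx, sub_self, zero_mul]
    rw [spPoly, pairSum_congr hA, pairSum_zero]
  have h3 : aPoly (r σ) (r τ) = 0 := by
    rw [hr]
    exact Finset.sum_eq_zero fun T _ => by rw [Pi.zero_apply, zero_dotProduct, map_zero]
  rw [BPoly, h1, h2, h3, hr, bPoly_zero_right]
  ring

section Consequences

variable {k : ℕ} {σ : M.PolyTuple}

lemma bPoly_eq_zero (hσ : Homogeneous k σ) (h : ∀ τ, Homogeneous k τ → BPoly σ τ = 0)
    {s : M.cells → Fin 3 → Poly3} (hs : ∀ T i, (s T i).totalDegree ≤ k - 1) :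
    bPoly (u σ) (uHat σ) (cHat σ) s = 0 := by
  obtain ⟨hr, hz⟩ := energy hσ h
  have h0 := Homogeneous.zero (M := M) k
  have := h (s, 0) { h0 with r_deg := hs }
  rw [BPoly_eq_of_stabZero hr hz] at this
  change _ + cPoly _ _ 0 + cPoly 0 0 _ = 0 at this
  rwa [cPoly_zero_right, cPoly_zero_left, add_zero, add_zero] at this

lemma cPoly_eq_zero_right (hσ : Homogeneous k σ) (h : ∀ τ, Homogeneous k τ → BPoly σ τ = 0)
    {v : M.cells → Fin 3 → Poly3} (hv : ∀ T i, (v T i).totalDegree ≤ k) :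
    cPoly (p σ) (pHat σ) v = 0 := by
  obtain ⟨hr, hz⟩ := energy hσ h
  have h0 := Homogeneous.zero (M := M) k
  have := h (0, v, 0) { h0 with u_deg := hv }
  rw [BPoly_eq_of_stabZero hr hz] at this
  change bPoly _ _ _ 0 + _ + cPoly 0 0 _ = 0 at this
  rwa [bPoly_zero_right, cPoly_zero_left, zero_add, add_zero] at this

lemma cPoly_eq_zero_left (hσ : Homogeneous k σ) (h : ∀ τ, Homogeneous k τ → BPoly σ τ = 0)
    {q : M.cells → Poly3} {qHat : M.faces → Poly3} (hq : ∀ T, (q T).totalDegree ≤ k)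
    (hqHat : ∀ F, (qHat F).totalDegree ≤ k)
    (hb : ∀ F : M.faces, M.IsBoundaryFace F → ∀ x ∈ simplexSet F.1, pval (qHat F) x = 0) :
    cPoly q qHat (u σ) = 0 := by
  obtain ⟨hr, hz⟩ := energy hσ h
  have h0 := Homogeneous.zero (M := M) k
  have := h (0, 0, 0, 0, q, qHat) { h0 with p_deg := hq, pHat_deg := hqHat, pHat_bd := hb }
  rw [BPoly_eq_of_stabZero hr hz] at this
  change bPoly _ _ _ 0 + cPoly _ _ 0 + _ = 0 at this
  rwa [bPoly_zero_right, cPoly_zero_right, zero_add, zero_add] at this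

lemma constCross_neg_left (n : Vec) (P : Fin 3 → Poly3) :
    constCross (-n) P = -constCross n P := by
  have e : (fun i => MvPolynomial.C ((-n) i) : Fin 3 → Poly3) = -fun i => MvPolynomial.C (n i) := by
    funext i; simp
  rw [constCross, e, map_neg, LinearMap.neg_apply]
  rfl

lemma constDot_neg_left (n : Vec) (P : Fin 3 → Poly3) : constDot (-n) P = -constDot n P := by
  simp [constDot]

/-- The curl of `u` vanishes. -/
lemma polyCurl_eq_zero (hΩ : IsAdmissibleDomain Ω) (hσ : Homogeneous k σ)
    (h : ∀ τ, Homogeneous k τ → BPoly σ τ = 0) (T : M.cells) : polyCurl (u σ T) = 0 := by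
  obtain ⟨hr, hz⟩ := energy hσ h
  have hcc : (fun T => polyCurl (polyCurl (u σ T))) = 0 := by
    refine eq_zero_of_sum_dot_self ?_
    -- The test function is curl curl u. Once the hats are replaced by traces, two integrations by
    -- parts turn b_h into minus the sum of ∫ |curl curl u|².
    set s : M.cells → Fin 3 → Poly3 := fun T => polyCurl (polyCurl (u σ T)) with hs
    have hb := bPoly_eq_zero hσ h (s := s) fun T i => (totalDegree_polyCurl_le
      (totalDegree_polyCurl_le (hσ.u_deg T)) i).trans (Nat.sub_le _ 1)
    have e1 := sum_cellInt_curl (u σ) fun T => polyCurl (s T)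
    have e2 := sum_cellInt_curl (fun T => polyCurl (u σ T)) s
    have hA : ∀ (T : M.cells) (F : M.faces), F.1 ⊆ T.1 →
        faceInt F (constCross (outwardNormal T.1 F.1) (uHat σ F) ⬝ᵥ polyCurl (s T)) =
        faceInt F (constCross (outwardNormal T.1 F.1) (u σ T) ⬝ᵥ polyCurl (s T)) :=
      fun T F hFT => faceInt_congr fun x hx => by
        rw [pval_dot, pval_dot, vval_constCross, vval_constCross, hz.tr_u T F hFT x hx]
    have hB : ∀ (T : M.cells) (F : M.faces), F.1 ⊆ T.1 →
        faceInt F (constCross (outwardNormal T.1 F.1) (cHat σ F) ⬝ᵥ s T) =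
        faceInt F (constCross (outwardNormal T.1 F.1) (polyCurl (u σ T)) ⬝ᵥ s T) :=
      fun T F hFT => faceInt_congr fun x hx => by
        rw [pval_dot, pval_dot, vval_constCross, vval_constCross, hz.tr_c T F hFT x hx]
    rw [bPoly, pairSum_congr hA, pairSum_congr hB] at hb
    linarith
  have hcurl : (fun T => polyCurl (u σ T)) = 0 := by
    refine eq_zero_of_sum_dot_self ?_
    rw [sum_cellInt_curl (u σ) fun T => polyCurl (u σ T)]
    have e1 : ∀ T, polyCurl (polyCurl (u σ T)) = 0 := fun T => congrFun hcc T
    simp only [e1, dotProduct_zero, map_zero, Finset.sum_const_zero, zero_add]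
    -- The flux (n × u) · curl u involves tangential traces only, that is û and ĉ. These are
    -- single-valued, so interior contributions cancel, and ĉ = 0 on Γ.
    have hA : ∀ (T : M.cells) (F : M.faces), F.1 ⊆ T.1 →
        faceInt F (constCross (outwardNormal T.1 F.1) (u σ T) ⬝ᵥ polyCurl (u σ T)) =
        faceInt F (constCross (outwardNormal T.1 F.1) (uHat σ F) ⬝ᵥ cHat σ F) :=
      fun T F hFT => faceInt_congr fun x hx => by
        have ht : ∀ n a b : Vec, crossProduct n a ⬝ᵥ b = -(a ⬝ᵥ crossProduct n b) := by
          intro n a b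
          simp only [cross_apply, dot_fin_three]
          dsimp only [Matrix.cons_val]
          ring
        rw [pval_dot, pval_dot, vval_constCross, vval_constCross, hz.tr_u T F hFT x hx, ht, ht,
          hz.tr_c T F hFT x hx]
    rw [pairSum_congr hA]
    refine sum_odd_eq_zero hΩ (fun F n => faceInt F (constCross n (uHat σ F) ⬝ᵥ cHat σ F))
      (fun F n => ?_) fun F hF n => faceInt_eq_zero fun x hx => ?_
    · rw [constCross_neg_left, neg_dotProduct, map_neg]
    · rw [pval_dot, hσ.cHat_bd F hF x hx, dotProduct_zero]
  exact congrFun hcurl T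

lemma polyDiv_X : polyDiv (fun i => (MvPolynomial.X i : Poly3)) = MvPolynomial.C 3 := by
  simp [polyDiv, map_ofNat MvPolynomial.C 3]

/-- Testing with v = ∇p makes p constant on each cell. The divergence theorem for p² x then equates
3 ∫ p² with a sum of (x · n) p̂², which cancels across interior faces and vanishes on Γ. -/
lemma p_eq_zero (hΩ : IsAdmissibleDomain Ω) (hσ : Homogeneous k σ)
    (h : ∀ τ, Homogeneous k τ → BPoly σ τ = 0) : p σ = 0 := by
  obtain ⟨hr, hz⟩ := energy hσ h
  have hgrad : (fun T => polyGrad (p σ T)) = 0 := by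
    refine eq_zero_of_sum_dot_self ?_
    have hc := cPoly_eq_zero_right hσ h (v := fun T => polyGrad (p σ T)) fun T i =>
      (totalDegree_pderiv_le _ _).trans ((Nat.sub_le _ 1).trans (hσ.p_deg T))
    have hA : ∀ (T : M.cells) (F : M.faces), F.1 ⊆ T.1 →
        faceInt F (constDot (outwardNormal T.1 F.1) (polyGrad (p σ T)) * pHat σ F) =
        faceInt F (constDot (outwardNormal T.1 F.1) (polyGrad (p σ T)) * p σ T) :=
      fun T F hFT => faceInt_congr fun x hx => by
        rw [pval_mul, pval_mul, hz.tr_p T F hFT x hx]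
    rw [cPoly, pairSum_congr hA] at hc
    have e := sum_cellInt_grad (p σ) fun T => polyGrad (p σ T)
    linarith
  refine eq_zero_of_sum_mul_self ?_
  have e := sum_cellInt_grad (fun T => p σ T * p σ T) fun _ i => MvPolynomial.X i
  have hg : ∀ T, polyGrad (p σ T * p σ T) = 0 := by
    intro T
    funext i
    have : MvPolynomial.pderiv i (p σ T) = 0 := congrFun (congrFun hgrad T) i
    simp [polyGrad, Derivation.leibniz, this]
  simp only [hg, dotProduct_zero, map_zero, Finset.sum_const_zero, add_zero, polyDiv_X,
    ← MvPolynomial.smul_eq_C_mul, map_smul, smul_eq_mul, ← Finset.mul_sum] at e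
  have hA : ∀ (T : M.cells) (F : M.faces), F.1 ⊆ T.1 →
      faceInt F (constDot (outwardNormal T.1 F.1) (fun i => MvPolynomial.X i) *
        (p σ T * p σ T)) =
      faceInt F (constDot (outwardNormal T.1 F.1) (fun i => MvPolynomial.X i) *
        (pHat σ F * pHat σ F)) :=
    fun T F hFT => faceInt_congr fun x hx => by
      simp only [pval_mul]
      rw [hz.tr_p T F hFT x hx]
  have hodd : pairSum (fun (T : M.cells) (F : M.faces) =>
      faceInt F (constDot (outwardNormal T.1 F.1) (fun i => MvPolynomial.X i) *
        (pHat σ F * pHat σ F))) = 0 := by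
    refine sum_odd_eq_zero hΩ (fun F n => faceInt F (constDot n (fun i => MvPolynomial.X i) *
        (pHat σ F * pHat σ F)))
      (fun F n => ?_) fun F hF n => faceInt_eq_zero fun x hx => ?_
    · rw [constDot_neg_left, neg_mul, map_neg]
    · rw [pval_mul, pval_mul, hσ.pHat_bd F hF x hx, mul_zero, mul_zero]
  rw [pairSum_congr hA, hodd] at e
  linarith

/-- The divergence of u is itself an admissible q, taken together with q̂ = 0. -/
lemma polyDiv_eq_zero (hσ : Homogeneous k σ) (h : ∀ τ, Homogeneous k τ → BPoly σ τ = 0)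
    (T : M.cells) : polyDiv (u σ T) = 0 := by
  have hc := cPoly_eq_zero_left hσ h (q := fun T => polyDiv (u σ T)) (qHat := 0)
    (fun T => (totalDegree_polyDiv_le (hσ.u_deg T)).trans (Nat.sub_le k 1))
    (fun F => (MvPolynomial.totalDegree_zero).le.trans (Nat.zero_le _))
    (fun F _ x _ => pval_zero x)
  rw [cPoly] at hc
  simp only [Pi.zero_apply, mul_zero, map_zero, pairSum_zero, sub_zero] at hc
  exact congrFun (eq_zero_of_sum_mul_self hc) T

open scoped Classical in
lemma pairSum_comm (φ : M.cells → M.faces → ℝ) :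
    pairSum φ = ∑ F : M.faces, ∑ T : M.cells with F.1 ⊆ T.1, φ T F :=
  Finset.sum_comm' (by simp)

open scoped Classical in
/-- The field `u` is continuous across interior faces. -/
lemma vval_sub_eq_zero (hσ : Homogeneous k σ)
    (h : ∀ τ, Homogeneous k τ → BPoly σ τ = 0) {T T' : M.cells} {F : M.faces} (hne : T ≠ T')
    (hT : F.1 ⊆ T.1) (hT' : F.1 ⊆ T'.1) (hF : ¬ M.IsBoundaryFace F) :
    ∀ x ∈ simplexSet F.1, vval (u σ T - u σ T') x = 0 := by
  obtain ⟨hr, hz⟩ := energy hσ h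
  set n := outwardNormal T.1 F.1 with hn
  have hn' : outwardNormal T'.1 F.1 = -n :=
    normal_eq_neg T.2 T'.2 F.2 (fun h => hne (Subtype.ext h)) hT hT'
  set w := constDot n (u σ T - u σ T') with hw
  have hwd : w.totalDegree ≤ k := totalDegree_constDot_le fun i =>
    (MvPolynomial.totalDegree_sub _ _).trans (max_le (hσ.u_deg T i) (hσ.u_deg T' i))
  -- Take q̂ to be the normal jump w on F and zero on all other faces: the equation becomes ∫ w² = 0
  -- over F. The tangential jump vanishes because both traces equal û.
  have hc := cPoly_eq_zero_left hσ h (q := 0) (qHat := Pi.single F w)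
    (fun T => (MvPolynomial.totalDegree_zero).le.trans (Nat.zero_le _))
    (fun G => by
      by_cases hG : G = F
      · subst hG; rwa [Pi.single_eq_same]
      · rw [Pi.single_eq_of_ne hG, MvPolynomial.totalDegree_zero]; exact Nat.zero_le _)
    (fun G hG x _ => by
      have hGF : G ≠ F := fun e => hF (e ▸ hG)
      rw [Pi.single_eq_of_ne hGF, pval_zero])
  rw [cPoly, pairSum_comm, Finset.sum_eq_single F] at hc
  · rw [cells_of_face hne hT hT', Finset.sum_pair hne, Pi.single_eq_same, hn', ← hn,
      constDot_neg_left, ← map_add, ← add_mul, ← sub_eq_add_neg, ← constDot_sub, ← hw] at hc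
    simp only [Pi.zero_apply, mul_zero, map_zero, Finset.sum_const_zero, zero_sub,
      neg_eq_zero] at hc
    intro x hx
    have h1 := eq_zero_of_faceInt_mul_self hc x hx
    rw [hw, pval_constDot] at h1
    have h2 := cross_cross_normal (normal_unit T.2 F.2 hT) h1
    have h3 := hz.tr_u T' F hT' x hx
    rw [hn', map_neg, LinearMap.neg_apply, LinearMap.neg_apply, neg_inj] at h3
    rw [vval_sub, map_sub, hz.tr_u T F hT x hx, ← hn, h3, sub_self, map_zero, eq_comm,
      neg_eq_zero] at h2
    rw [vval_sub, h2]
  · intro G _ hG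
    refine Finset.sum_eq_zero fun S _ => ?_
    rw [Pi.single_eq_of_ne hG, mul_zero, map_zero]
  · exact fun hF => absurd (Finset.mem_univ F) hF

end Consequences

end SimplicialMesh

/-! ### Unique continuation across a face -/

/-- Annihilating all directions orthogonal to n means A = c ⊗ n. Symmetry makes c a multiple of n,
and the trace is n · c, so c = 0. -/
lemma eq_zero_of_symm_traceless {n : Vec} (hn : n ⬝ᵥ n = 1) {A : Fin 3 → Vec}
    (hs : ∀ i j, A i j = A j i) (ht : ∑ i, A i i = 0)
    (h : ∀ t : Vec, n ⬝ᵥ t = 0 → ∀ i, A i ⬝ᵥ t = 0) : A = 0 := by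
  set c : Vec := fun i => A i ⬝ᵥ n with hc
  have key : ∀ i j, A i j = n j * c i := by
    intro i j
    have h1 := h (Pi.single j 1 - n j • n) (by
      rw [dotProduct_sub, dotProduct_smul, hn, dotProduct_single_one, smul_eq_mul, mul_one,
        sub_self]) i
    rw [dotProduct_sub, dotProduct_smul, dotProduct_single_one, sub_eq_zero, smul_eq_mul] at h1
    exact h1
  have hnc : n ⬝ᵥ c = 0 := by
    rw [← ht]
    exact Finset.sum_congr rfl fun i _ => (key i i).symm
  have hc0 : ∀ i, c i = 0 := by
    intro i
    have h1 : c i = n i * (n ⬝ᵥ c) := by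
      calc c i = (n ⬝ᵥ n) * c i := by rw [hn, one_mul]
        _ = ∑ j, n j * (n j * c i) := by rw [dotProduct, Finset.sum_mul]; simp only [mul_assoc]
        _ = ∑ j, n j * (n i * c j) := by
          refine Finset.sum_congr rfl fun j _ => ?_
          rw [← key i j, hs i j, key j i]
        _ = n i * (n ⬝ᵥ c) := by
          rw [dotProduct, Finset.mul_sum]
          exact Finset.sum_congr rfl fun j _ => by ring
    rw [h1, hnc, mul_zero]
  funext i j
  rw [key, hc0, mul_zero, Pi.zero_apply, Pi.zero_apply]

lemma polyCurl_eq_zero_iff {w : Fin 3 → Poly3} :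
    polyCurl w = 0 ↔ ∀ i j, MvPolynomial.pderiv i (w j) = MvPolynomial.pderiv j (w i) := by
  constructor
  · intro h i j
    have h0 := congrFun h 0
    have h1 := congrFun h 1
    have h2 := congrFun h 2
    simp only [polyCurl, Matrix.cons_val, Pi.zero_apply, sub_eq_zero] at h0 h1 h2
    fin_cases i <;> fin_cases j <;> first | rfl | assumption | (symm; assumption)
  · intro h
    funext i
    fin_cases i <;> simp [polyCurl, h]

lemma pderiv_comm (i j : Fin 3) (p : Poly3) : MvPolynomial.pderiv i (MvPolynomial.pderiv j p) =
    MvPolynomial.pderiv j (MvPolynomial.pderiv i p) := by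
  induction p using MvPolynomial.induction_on with
  | C a => simp
  | add p q hp hq => simp [hp, hq]
  | mul_X p l hp =>
    simp only [Derivation.leibniz, map_add, smul_eq_mul, hp, MvPolynomial.pderiv_X]
    have h : ∀ i j : Fin 3, MvPolynomial.pderiv i
        ((Pi.single j (1 : Poly3) : Fin 3 → Poly3) l) = 0 := by
      intro i j
      by_cases hj : l = j
      · subst hj; simp
      · rw [Pi.single_eq_of_ne hj, map_zero]
    rw [h, h]
    ring

lemma pval_dirDeriv (w : E3) (p : Poly3) (x : E3) :
    pval (dirDeriv w p) x = ∑ i, w i * pval (MvPolynomial.pderiv i p) x := by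
  simp [dirDeriv, pval]

namespace FaceFrame

variable {F : Finset E3} {n : Vec}

lemma grad_dot_tangent_eq_zero (R : FaceFrame F n) (t : Vec) (ht : n ⬝ᵥ t = 0) {p : Poly3}
    (hp : ∀ x ∈ simplexSet F, pval p x = 0) :
    ∀ x ∈ simplexSet F, (fun j => pval (MvPolynomial.pderiv j p) x) ⬝ᵥ t = 0 := by
  have hp0 := (R.pullback_eq_zero_iff p).2 hp
  have hd : ∀ j : Fin 2, ∀ x ∈ simplexSet F,
      pval (dirDeriv (R.v j.succ - R.v 0) p) x = 0 := by
    intro j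
    rw [← R.pullback_eq_zero_iff, ← pderiv_pullback, hp0, map_zero]
  intro x hx
  have h1 : (fun j => pval (MvPolynomial.pderiv j p) x) ⬝ᵥ (R.v 1 - R.v 0).ofLp = 0 := by
    have := hd 0 x hx
    rw [pval_dirDeriv] at this
    rw [dotProduct_comm]
    exact this
  have h2 : (fun j => pval (MvPolynomial.pderiv j p) x) ⬝ᵥ (R.v 2 - R.v 0).ofLp = 0 := by
    have := hd 1 x hx
    rw [pval_dirDeriv] at this
    rw [dotProduct_comm]
    exact this
  rw [R.expand t ht, dotProduct_add, dotProduct_smul, dotProduct_smul, h1, h2, smul_zero,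
    smul_zero, add_zero]

/-- A curl-free and divergence-free polynomial field that vanishes on a triangle vanishes. -/
lemma eq_zero_of_curl_div (R : FaceFrame F n) : ∀ (d : ℕ) (w : Fin 3 → Poly3),
    (∀ i, (w i).totalDegree ≤ d) →
    polyCurl w = 0 → polyDiv w = 0 → (∀ x ∈ simplexSet F, vval w x = 0) → w = 0 := by
  obtain ⟨x₀, hx₀⟩ : (simplexSet F).Nonempty := ⟨R.v 0, subset_convexHull ℝ _ (by
    rw [← R.range_eq]; exact ⟨0, rfl⟩)⟩
  have hconst : ∀ w : Fin 3 → Poly3, (∀ i j, MvPolynomial.pderiv j (w i) = 0) →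
      (∀ x ∈ simplexSet F, vval w x = 0) → w = 0 := by
    intro w hw hv
    funext i
    have h1 := eq_C_of_pderiv_eq_zero (hw i)
    have h2 : pval (w i) x₀ = 0 := congrFun (hv x₀ hx₀) i
    rw [h1, pval_C] at h2
    rw [h1, h2, map_zero, Pi.zero_apply]
  intro d
  induction d with
  | zero =>
    intro w hd _ _ hv
    refine hconst w (fun i j => ?_) hv
    rw [MvPolynomial.totalDegree_eq_zero_iff_eq_C.1 (Nat.le_zero.1 (hd i)), MvPolynomial.pderiv_C]
  | succ d ih =>
    intro w hd hc hdiv hv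
    have hc' := polyCurl_eq_zero_iff.1 hc
    refine hconst w (fun i j => ?_) hv
    -- Each partial derivative of w is again curl- and divergence-free, of lower degree. On F the
    -- Jacobian of w is symmetric, traceless and zero on tangential directions, hence zero, so the
    -- induction hypothesis applies.
    have hz : (fun i => MvPolynomial.pderiv j (w i)) = 0 := by
      refine ih _ (fun i => (totalDegree_pderiv_le _ _).trans (by have := hd i; omega)) ?_ ?_ ?_
      · rw [polyCurl_eq_zero_iff]
        intro a b
        rw [pderiv_comm a j, hc' a b, pderiv_comm j b]
      · have : polyDiv (fun i => MvPolynomial.pderiv j (w i)) =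
            MvPolynomial.pderiv j (polyDiv w) := by
          rw [polyDiv, polyDiv, map_sum]
          exact Finset.sum_congr rfl fun i _ => pderiv_comm _ _ _
        rw [this, hdiv, map_zero]
      · intro x hx
        have hA := eq_zero_of_symm_traceless R.unit
          (A := fun i l => pval (MvPolynomial.pderiv l (w i)) x)
          (fun i l => by rw [hc']) ?_ fun t ht i =>
            R.grad_dot_tangent_eq_zero t ht (fun y hy => congrFun (hv y hy) i) x hx
        · funext i
          exact congrFun (congrFun hA i) j
        · have h0 : pval (polyDiv w) x = 0 := by rw [hdiv, pval_zero]
          simpa [polyDiv, pval] using h0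
    exact congrFun hz i

/-- A polynomial whose gradient is normal to a triangle is constant on it. -/
lemma exists_const_of_cross_grad (R : FaceFrame F n) {φ : Poly3}
    (h : ∀ x ∈ simplexSet F, crossProduct n (vval (polyGrad φ) x) = 0) :
    ∃ c : ℝ, ∀ x ∈ simplexSet F, pval φ x = c := by
  have hg : ∀ x ∈ simplexSet F, ∀ t : Vec, n ⬝ᵥ t = 0 → t ⬝ᵥ vval (polyGrad φ) x = 0 := by
    intro x hx t ht
    have h1 : ∀ a b : Vec, crossProduct n a ⬝ᵥ crossProduct n b =
        (n ⬝ᵥ n) * (a ⬝ᵥ b) - (n ⬝ᵥ b) * (a ⬝ᵥ n) := fun a b => by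
      rw [cross_dot_cross]
    have h2 := h1 t (vval (polyGrad φ) x)
    rw [h x hx, dotProduct_zero, R.unit, one_mul, dotProduct_comm t n, ht, mul_zero,
      sub_zero] at h2
    exact h2.symm
  have hp : ∀ j : Fin 2, MvPolynomial.pderiv j (pullback R.v φ) = 0 := by
    intro j
    rw [pderiv_pullback, R.pullback_eq_zero_iff]
    intro x hx
    rw [pval_dirDeriv]
    refine hg x hx (R.v j.succ - R.v 0).ofLp ?_
    fin_cases j
    · exact R.normal_dot_t₁
    · exact R.normal_dot_t₂
  have hC := eq_C_of_pderiv_eq_zero hp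
  refine ⟨MvPolynomial.coeff 0 (pullback R.v φ), fun x hx => ?_⟩
  rw [R.simplexSet_eq] at hx
  obtain ⟨y, -, rfl⟩ := hx
  have h1 := congrArg (MvPolynomial.eval y) hC
  rwa [eval_pullback, MvPolynomial.eval_C] at h1

end FaceFrame

/-! ### Vanishing of u and triviality of the homogeneous problem. -/

namespace SimplicialMesh

variable {Ω : Set E3} {M : SimplicialMesh Ω}

open PolyTuple

lemma nonempty_faceFrame {T : M.cells} {F : M.faces} (h : F.1 ⊆ T.1) :
    Nonempty (FaceFrame F.1 (outwardNormal T.1 F.1)) :=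
  exists_faceFrame (M.mem_faces.1 F.2).2 (indep_face F.2) (normal_unit T.2 F.2 h)
    fun _ hw => outwardNormal_dot hw

/-- A function that is constant on each boundary face is constant on the boundary. -/
lemma exists_const_of_boundaryFaces (hΩ : IsAdmissibleDomain Ω) {f : E3 → ℝ} (hf : Continuous f)
    (h : ∀ F : M.faces, M.IsBoundaryFace F → ∃ c : ℝ, ∀ x ∈ simplexSet F.1, f x = c) :
    ∃ c : ℝ, ∀ x ∈ frontier Ω, f x = c := by
  obtain ⟨x₀, hx₀⟩ := hΩ.connectedBoundary.nonempty
  refine ⟨f x₀, fun x hx => ?_⟩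
  -- The image of the connected boundary is connected in ℝ and finite, with at most one value per
  -- face, hence a single point.
  have hfin : (f '' frontier Ω).Finite := by
    choose c hc using h
    classical
    refine (Set.finite_range fun F : M.faces =>
      if hF : M.IsBoundaryFace F then c F hF else 0).subset ?_
    rintro _ ⟨y, hy, rfl⟩
    obtain ⟨F, hF, hyF⟩ := frontier_subset (M := M) hΩ hy
    exact ⟨F, by simp only [dif_pos hF]; exact (hc F hF y hyF).symm⟩
  have hpre : IsPreconnected (f '' frontier Ω) :=
    hΩ.connectedBoundary.isPreconnected.image f hf.continuousOn
  have key : ∀ {a b : ℝ}, a ∈ f '' frontier Ω → b ∈ f '' frontier Ω → ¬ a < b := fun ha hb hab =>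
    Set.Icc_infinite hab (hfin.subset (hpre.Icc_subset ha hb))
  exact le_antisymm (not_lt.1 (key ⟨x₀, hx₀, rfl⟩ ⟨x, hx, rfl⟩))
    (not_lt.1 (key ⟨x, hx, rfl⟩ ⟨x₀, hx₀, rfl⟩))

variable {k : ℕ} {σ : M.PolyTuple}

/-- Jumps across interior faces vanish on a triangle and are curl- and divergence-free, so u is the
same polynomial field on every cell and has a global potential φ. As û = 0 on Γ, φ is constant on
each boundary face, hence equal to some c on Γ. Then ∫ |u|² is the sum of the fluxes (n · u)(φ - c),
which cancel inside and vanish on Γ. -/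
lemma u_eq_zero (hΩ : IsAdmissibleDomain Ω) (hσ : Homogeneous k σ)
    (h : ∀ τ, Homogeneous k τ → BPoly σ τ = 0) : u σ = 0 := by
  obtain ⟨hr, hz⟩ := energy hσ h
  rcases isEmpty_or_nonempty M.cells with hE | ⟨⟨T₀⟩⟩
  · funext T; exact (hE.false T).elim
  have heq : ∀ T, u σ T = u σ T₀ := fun T => by
    refine eq_of_eq_across_faces hΩ (u σ) (fun S S' F hne hS hS' hF => ?_) T T₀
    obtain ⟨R⟩ := nonempty_faceFrame hS
    rw [← sub_eq_zero]
    have hneg : u σ S - u σ S' = u σ S + (-1 : ℝ) • u σ S' := by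
      rw [neg_one_smul, sub_eq_add_neg]
    refine R.eq_zero_of_curl_div k _ (fun i => (MvPolynomial.totalDegree_sub _ _).trans
      (max_le (hσ.u_deg S i) (hσ.u_deg S' i))) ?_ ?_ (vval_sub_eq_zero hσ h hne hS hS' hF)
    · rw [hneg, polyCurl_add, polyCurl_smul, polyCurl_eq_zero hΩ hσ h, polyCurl_eq_zero hΩ hσ h,
        smul_zero, add_zero]
    · rw [hneg, polyDiv_add, polyDiv_smul, polyDiv_eq_zero hσ h, polyDiv_eq_zero hσ h, smul_zero,
        add_zero]
  obtain ⟨φ, -, hφ⟩ := exists_potential (hσ.u_deg T₀)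
    (polyCurl_eq_zero_iff.1 (polyCurl_eq_zero hΩ hσ h T₀))
  have hφ' : polyGrad φ = u σ T₀ := funext hφ
  obtain ⟨c, hc⟩ := exists_const_of_boundaryFaces (M := M) hΩ (continuous_pval φ) fun F hF => by
    obtain ⟨T, hT, hFT⟩ := exists_cell_of_face (M.mem_faces.1 F.2).1
    obtain ⟨R⟩ := nonempty_faceFrame (T := ⟨T, hT⟩) hFT
    refine R.exists_const_of_cross_grad fun x hx => ?_
    rw [hφ', ← heq ⟨T, hT⟩, hz.tr_u ⟨T, hT⟩ F hFT x hx, hσ.uHat_bd F hF x hx, map_zero]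
  refine eq_zero_of_sum_dot_self ?_
  have e := sum_cellInt_grad (fun _ => φ - MvPolynomial.C c) (u σ)
  have hg : ∀ T, polyGrad (φ - MvPolynomial.C c) = u σ T := fun T => by
    rw [heq T, ← hφ']
    funext i
    simp [polyGrad]
  have e1 : ∀ T, u σ T ⬝ᵥ polyGrad (φ - MvPolynomial.C c) = u σ T ⬝ᵥ u σ T := fun T => by
    rw [← hg T]
  simp only [polyDiv_eq_zero hσ h, zero_mul, map_zero, Finset.sum_const_zero, zero_add, e1] at e
  rw [e]
  simp only [heq]
  refine sum_odd_eq_zero hΩ (fun F n => faceInt F (constDot n (u σ T₀) * (φ - MvPolynomial.C c)))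
    (fun F n => ?_) fun F hF n => faceInt_eq_zero fun x hx => ?_
  · rw [constDot_neg_left, neg_mul, map_neg]
  · rw [pval_mul, pval_sub, pval_C, hc x (hF hx), sub_self, mul_zero]

/-- The homogeneous problem has only the trivial solution. -/
theorem eq_zero_of_BPoly (hΩ : IsAdmissibleDomain Ω) (hσ : Homogeneous k σ)
    (h : ∀ τ, Homogeneous k τ → BPoly σ τ = 0) : σ.toTuple = (0 : M.PolyTuple).toTuple := by
  obtain ⟨hr, hz⟩ := energy hσ h
  have hu := u_eq_zero hΩ hσ h
  have hp := p_eq_zero hΩ hσ h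
  have hface : ∀ P : Fin 3 → Poly3, ∀ F : M.faces, (∀ x ∈ simplexSet F.1, vval P x = 0) →
      faceField F.1 P = faceField F.1 0 := by
    intro P F hP
    funext x
    by_cases hx : x ∈ simplexSet F.1
    · rw [faceField_of_mem _ hx, faceField_of_mem _ hx, hP x hx, vval_zero]
    · rw [faceField_of_notMem _ hx, faceField_of_notMem _ hx]
  ext1
  · exact hr
  · exact hu
  · funext F
    obtain ⟨T, hT, hFT⟩ := exists_cell_of_face (M.mem_faces.1 F.2).1
    obtain ⟨R⟩ := nonempty_faceFrame (T := ⟨T, hT⟩) hFT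
    refine hface _ F fun x hx => R.eq_of_cross_eq (hσ.uHat_tan F x hx) (isTangential_zero _) ?_
    rw [← hz.tr_u ⟨T, hT⟩ F hFT x hx, hu, Pi.zero_apply, vval_zero]
  · funext F
    obtain ⟨T, hT, hFT⟩ := exists_cell_of_face (M.mem_faces.1 F.2).1
    obtain ⟨R⟩ := nonempty_faceFrame (T := ⟨T, hT⟩) hFT
    refine hface _ F fun x hx => R.eq_of_cross_eq (hσ.cHat_tan F x hx) (isTangential_zero _) ?_
    rw [← hz.tr_c ⟨T, hT⟩ F hFT x hx, hu, Pi.zero_apply, polyCurl_zero, vval_zero]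
  · exact hp
  · funext F
    obtain ⟨T, hT, hFT⟩ := exists_cell_of_face (M.mem_faces.1 F.2).1
    refine Set.indicator_congr fun x hx => ?_
    rw [← hz.tr_p ⟨T, hT⟩ F hFT x hx, hp]
    rfl

end SimplicialMesh

namespace SimplicialMesh

variable {Ω : Set E3} {M : SimplicialMesh Ω} {k : ℕ} {g₁ g₂ : E3 → Vec}

open PolyTuple

/-! ### The affine space of trial functions -/

lemma exists_polyTuple {σ : HDGTuple M} (hσ : M.MemSigma k g₁ g₂ σ) :
    ∃ P : M.PolyTuple, Regular k P ∧ P.toTuple = σ := by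
  choose U hU hUt hUe using fun F => mem_tangentialFacePoly_iff.1 (hσ.uHat_mem F)
  choose C hC hCt hCe using fun F => mem_tangentialFacePoly_iff.1 (hσ.cHat_mem F)
  choose p hp hpe using hσ.pHat_mem
  refine ⟨(σ.r, σ.u, U, C, σ.p, p), ⟨hσ.r_mem, hσ.u_mem, hU, hUt, hC, hCt, hσ.p_mem, hp,
    fun F hF x hx => ?_⟩, ?_⟩
  · have h1 := congrFun (hpe F) x
    rw [hσ.pHat_boundary F hF, Set.indicator_of_mem hx] at h1
    exact h1.symm
  · ext1
    · rfl
    · rfl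
    · exact funext fun F => (hUe F).symm
    · exact funext fun F => (hCe F).symm
    · rfl
    · exact funext fun F => (hpe F).symm

lemma PolyTuple.Regular.memSigma {σ : M.PolyTuple} (h : Regular k σ)
    (h₁ : ∀ (T : M.cells) (F : M.faces), F.1 ⊆ T.1 → M.IsBoundaryFace F →
      IsDivFaceProjection k F.1 (outwardNormal T.1 F.1) g₁
        fun x => crossProduct (outwardNormal T.1 F.1) (faceField F.1 (uHat σ F) x))
    (h₂ : ∀ (T : M.cells) (F : M.faces), F.1 ⊆ T.1 → M.IsBoundaryFace F →
      IsL2FaceProjection (k - 1) F.1 g₂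
        fun x => crossProduct (outwardNormal T.1 F.1) (faceField F.1 (cHat σ F) x)) :
    M.MemSigma k g₁ g₂ σ.toTuple where
  r_mem := h.r_deg
  u_mem := h.u_deg
  uHat_mem F := mem_tangentialFacePoly_iff.2 ⟨_, h.uHat_deg F, h.uHat_tan F, rfl⟩
  uHat_boundary := h₁
  cHat_mem F := mem_tangentialFacePoly_iff.2 ⟨_, h.cHat_deg F, h.cHat_tan F, rfl⟩
  cHat_boundary := h₂
  p_mem := h.p_deg
  pHat_mem F := ⟨_, h.pHat_deg F, rfl⟩
  pHat_boundary F hF := by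
    funext x
    by_cases hx : x ∈ simplexSet F.1
    · exact (Set.indicator_of_mem hx _).trans (h.pHat_bd F hF x hx)
    · exact Set.indicator_of_notMem hx _

/-- Both projections are unique on each boundary face, so two tuples with the same data have the
same û and ĉ on Γ. -/
lemma PolyTuple.Regular.homogeneous_sub (hk : 1 ≤ k) {σ τ : M.PolyTuple} (hσ : Regular k σ)
    (hτ : Regular k τ) (h : M.MemSigma k g₁ g₂ σ.toTuple) (h' : M.MemSigma k g₁ g₂ τ.toTuple) :
    Homogeneous k (σ - τ) where
  toRegular := by
    rw [sub_eq_add_neg, ← neg_one_smul ℝ τ]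
    exact hσ.add (hτ.smul _)
  uHat_bd F hF x hx := by
    obtain ⟨T, hT, hFT⟩ := exists_cell_of_face (M.mem_faces.1 F.2).1
    obtain ⟨R⟩ := nonempty_faceFrame (T := ⟨T, hT⟩) hFT
    change vval (uHat σ F - uHat τ F) x = 0
    rw [vval_sub, sub_eq_zero]
    exact R.div_unique hk (hσ.uHat_deg F) (hτ.uHat_deg F) (hσ.uHat_tan F) (hτ.uHat_tan F)
      (h.uHat_boundary ⟨T, hT⟩ F hFT hF) (h'.uHat_boundary ⟨T, hT⟩ F hFT hF) x hx
  cHat_bd F hF x hx := by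
    obtain ⟨T, hT, hFT⟩ := exists_cell_of_face (M.mem_faces.1 F.2).1
    obtain ⟨R⟩ := nonempty_faceFrame (T := ⟨T, hT⟩) hFT
    change vval (cHat σ F - cHat τ F) x = 0
    rw [vval_sub, sub_eq_zero]
    exact R.l2_unique (hσ.cHat_deg F) (hτ.cHat_deg F) (hσ.cHat_tan F) (hτ.cHat_tan F)
      (h.cHat_boundary ⟨T, hT⟩ F hFT hF) (h'.cHat_boundary ⟨T, hT⟩ F hFT hF) x hx

lemma PolyTuple.Homogeneous.memSigma_add {σ τ : M.PolyTuple} (hσ : Homogeneous k σ)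
    (hτ : Regular k τ) (h : M.MemSigma k g₁ g₂ τ.toTuple) :
    M.MemSigma k g₁ g₂ (σ + τ).toTuple := by
  refine (hσ.toRegular.add hτ).memSigma (fun T F hFT hF => ?_) fun T F hFT hF => ?_
  · refine isDivFaceProjection_congr (fun x hx => ?_) (h.uHat_boundary T F hFT hF)
    change crossProduct _ (faceField F.1 (uHat τ F) x) =
      crossProduct _ (faceField F.1 (uHat σ F + uHat τ F) x)
    rw [faceField_of_mem _ hx, faceField_of_mem _ hx, vval_add, hσ.uHat_bd F hF x hx, zero_add]
  · refine FaceFrame.isL2FaceProjection_congr (fun x hx => ?_) (h.cHat_boundary T F hFT hF)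
    change crossProduct _ (faceField F.1 (cHat τ F) x) =
      crossProduct _ (faceField F.1 (cHat σ F + cHat τ F) x)
    rw [faceField_of_mem _ hx, faceField_of_mem _ hx, vval_add, hσ.cHat_bd F hF x hx, zero_add]

lemma memSigma_zero (M : SimplicialMesh Ω) (k : ℕ) :
    M.MemSigma k 0 0 (0 : M.PolyTuple).toTuple := by
  have hz : ∀ (n : Vec) (F : M.faces), ∀ x ∈ simplexSet F.1,
      (0 : E3 → Vec) x = crossProduct n (faceField F.1 0 x) := by
    intro n F x hx
    rw [faceField_of_mem _ hx, vval_zero, map_zero, Pi.zero_apply]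
  refine (Regular.zero k).memSigma (fun T F hFT hF => ?_) fun T F hFT hF => ?_
  · refine isDivFaceProjection_congr (hz _ F) ⟨fun e he h2 w hw => ?_, fun _ _ _ _ _ => rfl⟩
    simpa using hasEdgeMoment_zero F.1 e w
  · exact FaceFrame.isL2FaceProjection_congr (hz _ F) fun _ _ => rfl

lemma PolyTuple.Homogeneous.memSigma {σ : M.PolyTuple} (hσ : Homogeneous k σ) :
    M.MemSigma k 0 0 σ.toTuple := by
  simpa using hσ.memSigma_add (Regular.zero k) (memSigma_zero M k)

lemma PolyTuple.Regular.homogeneous (hk : 1 ≤ k) {σ : M.PolyTuple} (hσ : Regular k σ)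
    (h : M.MemSigma k 0 0 σ.toTuple) : Homogeneous k σ := by
  simpa using hσ.homogeneous_sub hk (Regular.zero k) h (memSigma_zero M k)

/-- The trial space is non-empty. -/
lemma exists_memSigma (hΩ : IsAdmissibleDomain Ω) (hk : 1 ≤ k) (hg₁ : M.IsTangentialL2 g₁)
    (hg₁' : M.HasBoundaryEdgeMoments k g₁) (hg₂ : M.IsTangentialL2 g₂) :
    ∃ σ : M.PolyTuple, Regular k σ ∧ M.MemSigma k g₁ g₂ σ.toTuple := by
  have h₁ : ∀ F : M.faces, ∃ P : Fin 3 → Poly3, (∀ i, (P i).totalDegree ≤ k) ∧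
      (∀ x ∈ simplexSet F.1, IsTangential F.1 (vval P x)) ∧
      (M.IsBoundaryFace F → ∀ T : M.cells, F.1 ⊆ T.1 →
        IsDivFaceProjection k F.1 (outwardNormal T.1 F.1) g₁
          fun x => crossProduct (outwardNormal T.1 F.1) (faceField F.1 P x)) := by
    intro F
    by_cases hF : M.IsBoundaryFace F
    · obtain ⟨T, hT, hFT⟩ := exists_cell_of_face (M.mem_faces.1 F.2).1
      obtain ⟨R⟩ := nonempty_faceFrame (T := ⟨T, hT⟩) hFT
      obtain ⟨P, hP, hPt, hPg⟩ := R.div_exists hk (hg₁ F hF).1 (hg₁ F hF).2 (hg₁' F hF)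
      refine ⟨P, hP, hPt, fun _ T' hT' => ?_⟩
      -- The condition involves the normal of a cell; a boundary face has only one cell, so there is
      -- no ambiguity.
      rwa [← cell_unique_of_boundary hΩ hT T'.2 hF hFT hT']
    · exact ⟨0, (Regular.zero k).uHat_deg F, (Regular.zero k).uHat_tan F, fun h => (hF h).elim⟩
  have h₂ : ∀ F : M.faces, ∃ P : Fin 3 → Poly3, (∀ i, (P i).totalDegree ≤ k - 1) ∧
      (∀ x ∈ simplexSet F.1, IsTangential F.1 (vval P x)) ∧
      (M.IsBoundaryFace F → ∀ T : M.cells, F.1 ⊆ T.1 →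
        IsL2FaceProjection (k - 1) F.1 g₂
          fun x => crossProduct (outwardNormal T.1 F.1) (faceField F.1 P x)) := by
    intro F
    by_cases hF : M.IsBoundaryFace F
    · obtain ⟨T, hT, hFT⟩ := exists_cell_of_face (M.mem_faces.1 F.2).1
      obtain ⟨R⟩ := nonempty_faceFrame (T := ⟨T, hT⟩) hFT
      obtain ⟨P, hP, hPt, hPg⟩ := R.l2_exists (k - 1) (hg₂ F hF).1 (hg₂ F hF).2
      refine ⟨P, hP, hPt, fun _ T' hT' => ?_⟩
      rwa [← cell_unique_of_boundary hΩ hT T'.2 hF hFT hT']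
    · exact ⟨0, (Regular.zero k).cHat_deg F, (Regular.zero k).cHat_tan F, fun h => (hF h).elim⟩
  choose U hU hUt hUg using h₁
  choose C hC hCt hCg using h₂
  have h0 : Regular k (0 : M.PolyTuple) := Regular.zero k
  have hL : Regular k ((0, 0, U, C, 0, 0) : M.PolyTuple) :=
    ⟨h0.r_deg, h0.u_deg, hU, hUt, hC, hCt, h0.p_deg, h0.pHat_deg, h0.pHat_bd⟩
  exact ⟨_, hL, hL.memSigma (fun T F hFT hF => hUg F hF T hFT) fun T F hFT hF => hCg F hF T hFT⟩

lemma toTuple_eq_of_sub {σ τ : M.PolyTuple}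
    (h : (σ - τ).toTuple = (0 : M.PolyTuple).toTuple) : σ.toTuple = τ.toTuple := by
  have hr : r σ - r τ = 0 := congrArg HDGTuple.r h
  have hu : u σ - u τ = 0 := congrArg HDGTuple.u h
  have hp : p σ - p τ = 0 := congrArg HDGTuple.p h
  have hface : ∀ (F : M.faces) (P Q : Fin 3 → Poly3), faceField F.1 (P - Q) = faceField F.1 0 →
      faceField F.1 P = faceField F.1 Q := by
    intro F P Q hPQ
    funext x
    by_cases hx : x ∈ simplexSet F.1
    · have h1 := congrFun hPQ x
      rw [faceField_of_mem _ hx, faceField_of_mem _ hx, vval_sub, vval_zero, sub_eq_zero] at h1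
      rw [faceField_of_mem _ hx, faceField_of_mem _ hx, h1]
    · rw [faceField_of_notMem _ hx, faceField_of_notMem _ hx]
  ext1
  · exact sub_eq_zero.1 hr
  · exact sub_eq_zero.1 hu
  · exact funext fun F => hface F _ _ (congrFun (congrArg HDGTuple.uHat h) F)
  · exact funext fun F => hface F _ _ (congrFun (congrArg HDGTuple.cHat h) F)
  · exact sub_eq_zero.1 hp
  · funext F
    refine Set.indicator_congr fun x hx => ?_
    have h1 : (simplexSet F.1).indicator (pval (pHat σ F - pHat τ F)) x =
        (simplexSet F.1).indicator (pval 0) x := congrFun (congrFun (congrArg HDGTuple.pHat h) F) x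
    rw [Set.indicator_of_mem hx, Set.indicator_of_mem hx, pval_sub, pval_zero, sub_eq_zero] at h1
    exact h1

/-! ### The right-hand side -/

/-- A square integrable function on a bounded set is integrable, and a polynomial is bounded on a
cell. -/
lemma integrable_mul_pval (hΩ : IsAdmissibleDomain Ω) {g : E3 → ℝ}
    (hg : MemLp g 2 (volume.restrict Ω)) (T : Finset E3) (p : Poly3) :
    Integrable (fun x => g x * pval p x) (volume.restrict (Ω ∩ simplexSet T)) := by
  have hfin : IsFiniteMeasure (volume.restrict Ω) := ⟨by
    rw [Measure.restrict_apply_univ]; exact hΩ.bounded.measure_lt_top⟩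
  have hg1 : IntegrableOn g Ω volume := hg.integrable one_le_two
  exact (hg1.mono_set Set.inter_subset_left).mul_continuousOn_of_subset
    (continuous_pval p).continuousOn
    (hΩ.isOpen.measurableSet.inter (isCompact_simplexSet T).measurableSet)
    (isCompact_simplexSet T) Set.inter_subset_right

lemma integrable_dot_vval (hΩ : IsAdmissibleDomain Ω) {f : E3 → Vec}
    (hf : MemLp f 2 (volume.restrict Ω)) (T : Finset E3) (P : Fin 3 → Poly3) :
    Integrable (fun x => f x ⬝ᵥ vval P x) (volume.restrict (Ω ∩ simplexSet T)) :=
  integrable_finsetSum _ fun i _ => integrable_mul_pval hΩ (hf.eval i) T (P i)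

lemma FForm_add (hΩ : IsAdmissibleDomain Ω) {f : E3 → Vec} (hf : MemLp f 2 (volume.restrict Ω))
    {g : E3 → ℝ} (hg : MemLp g 2 (volume.restrict Ω)) (σ τ : M.PolyTuple) :
    M.FForm f g (σ + τ).toTuple = M.FForm f g σ.toTuple + M.FForm f g τ.toTuple := by
  have h1 : ∀ T : M.cells, ∫ x in Ω ∩ simplexSet T.1, f x ⬝ᵥ vval (u σ T + u τ T) x =
      (∫ x in Ω ∩ simplexSet T.1, f x ⬝ᵥ vval (u σ T) x) +
        ∫ x in Ω ∩ simplexSet T.1, f x ⬝ᵥ vval (u τ T) x := fun T => by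
    simp only [vval_add, dotProduct_add]
    exact integral_add (integrable_dot_vval hΩ hf _ _) (integrable_dot_vval hΩ hf _ _)
  have h2 : ∀ T : M.cells, ∫ x in Ω ∩ simplexSet T.1, g x * pval (p σ T + p τ T) x =
      (∫ x in Ω ∩ simplexSet T.1, g x * pval (p σ T) x) +
        ∫ x in Ω ∩ simplexSet T.1, g x * pval (p τ T) x := fun T => by
    simp only [pval_add, mul_add]
    exact integral_add (integrable_mul_pval hΩ hg _ _) (integrable_mul_pval hΩ hg _ _)
  change -(∑ T : M.cells, ∫ x in Ω ∩ simplexSet T.1, f x ⬝ᵥ vval (u σ T + u τ T) x) +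
    (∑ T : M.cells, ∫ x in Ω ∩ simplexSet T.1, g x * pval (p σ T + p τ T) x) = _
  simp only [h1, h2, Finset.sum_add_distrib, FForm, toTuple]
  ring

lemma FForm_smul (f : E3 → Vec) (g : E3 → ℝ) (c : ℝ) (σ : M.PolyTuple) :
    M.FForm f g (c • σ).toTuple = c * M.FForm f g σ.toTuple := by
  change -(∑ T : M.cells, ∫ x in Ω ∩ simplexSet T.1, f x ⬝ᵥ vval (c • u σ T) x) +
    (∑ T : M.cells, ∫ x in Ω ∩ simplexSet T.1, g x * pval (c • p σ T) x) = _
  simp only [vval_smul, pval_smul, dotProduct_smul, smul_eq_mul, mul_left_comm _ c,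
    integral_const_mul, ← Finset.mul_sum, FForm, toTuple]
  ring

/-! ### Well-posedness -/

/-- The bilinear form on the homogeneous space. -/
def homogeneousForm (M : SimplicialMesh Ω) (k : ℕ) :
    homogeneousSpace M k →ₗ[ℝ] homogeneousSpace M k →ₗ[ℝ] ℝ :=
  LinearMap.mk₂ ℝ (fun σ τ => BPoly σ.1 τ.1)
    (fun σ σ' τ => by
      rw [BPoly_comm, Submodule.coe_add, BPoly_add, BPoly_comm τ.1, BPoly_comm τ.1])
    (fun c σ τ => by rw [BPoly_comm, Submodule.coe_smul, BPoly_smul, BPoly_comm τ.1, smul_eq_mul])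
    (fun σ τ τ' => by rw [Submodule.coe_add, BPoly_add])
    (fun c σ τ => by rw [Submodule.coe_smul, BPoly_smul, smul_eq_mul])

/-- L carries the boundary data and σ is a homogeneous correction. A kernel element of the symmetric
form represents the zero functions by `eq_zero_of_BPoly`, and the right-hand side, including the
contribution of L, depends only on these functions; so it vanishes on the kernel and is represented.
-/
lemma exists_solution (hΩ : IsAdmissibleDomain Ω) {f : E3 → Vec}
    (hf : MemLp f 2 (volume.restrict Ω)) {g : E3 → ℝ} (hg : MemLp g 2 (volume.restrict Ω))
    (L : M.PolyTuple) :
    ∃ σ, Homogeneous k σ ∧ ∀ τ, Homogeneous k τ → BPoly (σ + L) τ = M.FForm f g τ.toTuple := by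
  let l : homogeneousSpace M k →ₗ[ℝ] ℝ :=
    { toFun := fun τ => M.FForm f g τ.1.toTuple - BPoly L τ.1
      map_add' := fun σ τ => by
        rw [Submodule.coe_add, FForm_add hΩ hf hg, BPoly_add]
        ring
      map_smul' := fun c τ => by
        rw [Submodule.coe_smul, FForm_smul, BPoly_smul, RingHom.id_apply, smul_eq_mul]
        ring }
  have hF0 : M.FForm f g (0 : M.PolyTuple).toTuple = 0 := by
    simpa using FForm_smul (M := M) f g 0 0
  have hB0 : BPoly L 0 = 0 := by simpa using BPoly_smul 0 L 0
  obtain ⟨σ, hσ⟩ := exists_representer (homogeneousForm M k) l fun τ hτ => by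
    have h0 : τ.1.toTuple = (0 : M.PolyTuple).toTuple :=
      eq_zero_of_BPoly hΩ τ.2 fun v hv => by
        rw [BPoly_comm]
        exact hτ ⟨v, hv⟩
    change M.FForm f g τ.1.toTuple - BPoly L τ.1 = 0
    rw [← BForm_toTuple, h0, BForm_toTuple, hF0, hB0, sub_zero]
  refine ⟨σ.1, σ.2, fun τ hτ => ?_⟩
  have h1 : BPoly σ.1 τ = M.FForm f g τ.toTuple - BPoly L τ :=
    congrArg (fun φ : homogeneousSpace M k →ₗ[ℝ] ℝ => φ ⟨τ, hτ⟩) hσ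
  rw [BPoly_comm, BPoly_add, BPoly_comm τ, BPoly_comm τ, h1, sub_add_cancel]

end SimplicialMesh

theorem mainTheorem2 (Ω : Set E3) (hΩ : IsAdmissibleDomain Ω) (M : SimplicialMesh Ω)
    (k : ℕ) (hk : 1 ≤ k)
    (f : E3 → Vec) (hf : MemLp f 2 (volume.restrict Ω))
    (g : E3 → ℝ) (hg : MemLp g 2 (volume.restrict Ω))
    (g₁ : E3 → Vec) (hg₁ : M.IsTangentialL2 g₁) (hg₁' : M.HasBoundaryEdgeMoments k g₁)
    (g₂ : E3 → Vec) (hg₂ : M.IsTangentialL2 g₂) :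
    ∃! σ : HDGTuple M, M.MemSigma k g₁ g₂ σ ∧
      ∀ τ : HDGTuple M, M.MemSigma k 0 0 τ → M.BForm σ τ = M.FForm f g τ := by
  obtain ⟨L, hL, hLm⟩ := SimplicialMesh.exists_memSigma hΩ hk hg₁ hg₁' hg₂
  obtain ⟨v, hv, hsol⟩ := SimplicialMesh.exists_solution hΩ hf hg L
  refine ⟨(v + L).toTuple, ⟨hv.memSigma_add hL hLm, fun τ hτ => ?_⟩, ?_⟩
  · obtain ⟨t, ht, rfl⟩ := SimplicialMesh.exists_polyTuple hτ
    rw [SimplicialMesh.BForm_toTuple]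
    exact hsol t (ht.homogeneous hk hτ)
  -- The difference of two solutions is homogeneous and solves the homogeneous problem.
  · rintro σ ⟨hσm, hσ⟩
    obtain ⟨s, hs, rfl⟩ := SimplicialMesh.exists_polyTuple hσm
    refine SimplicialMesh.toTuple_eq_of_sub (SimplicialMesh.eq_zero_of_BPoly (k := k) hΩ
      (hs.homogeneous_sub hk (hv.toRegular.add hL) hσm (hv.memSigma_add hL hLm)) fun τ hτ => ?_)
    rw [SimplicialMesh.BPoly_sub_left, hsol τ hτ, ← SimplicialMesh.BForm_toTuple,
      hσ _ hτ.memSigma, sub_self]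
end
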